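/- Let $X_1,X_2,\dots$ be i.i.d. real random variables that take only finitely many values, with $\mathbb E X_1=0$ and $\mathbb P(X_1\ne 0)>0$, and let $S_n=X_1+\dots+X_n$, $S_0=0$. For $c>0$ let $\mathcal L_c$ be the one-sided Lévy$(1/2)$ law (stable of index $1/2$ and skewness $1$) of scale $c$, i.e. the probability law on $\mathbb R$ with characteristic function $t\mapsto\exp\bigl(-c|t|^{1/2}(1-i\,\mathrm{sgn}\,t)\bigr)$. Say that a random time $T$ with values in $\mathbb N\cup\{\infty\}$ and $\mathbb P(T<\infty)>0$ is *of type $\mathcal Z_{[1,c]}$* if it lies, conditionally on being finite, in the domain of normal attraction of $\mathcal L_c$: if $Y_1,Y_2,\dots$ are i.i.d. with the law of $T$ conditioned on $T<\infty$, then $n^{-2}(Y_1+\dots+Y_n)\to\mathcal L_c$ in distribution. For $y,l>0$ let $$\tau_{-y,l}=\inf\{t\ge 0:\ -y+S_t=l,\ -y+S_{t'}\le 0\text{ for all }1\le t'<t\}\qquad(\inf\emptyset=\infty).$$ Let $\mathrm{sgn}(S_0)=+1$ and, for $n\ge1$, let $\mathrm{sgn}(S_n)$ be $+1$ if $S_n>0$,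 $-1$ if $S_n<0$, and $\mathrm{sgn}(S_{n-1})$ if $S_n=0$. Let $t_0=0$, $t_i=\min\{s>t_{i-1}:\ \mathrm{sgn}(S_s)\,\mathrm{sgn}(S_{s+1})=-1\}$, and let $\tau_i=t_i-t_{i-1}$ $(i\ge1)$ be the inter-half-excursion times. 1. Suppose that the walk is a lattice walk, i.e. $X_1\in h\mathbb Z$ almost surely for some $h>0$ (for instance, $X_1$ is integer-valued). Then there is an integer $d\ge1$, depending only on the walk, such that the following hold. (a) For all real $y,l>0$ with $\mathbb P(\tau_{-y,l}<\infty)>0$ there are $r\in\{0,\dots,d-1\}$ and $C=C(y,l)>0$ such that $\mathbb P(\tau_{-y,l}=n)=0$ unless $n\equiv r \pmod d$, and $$n^{3/2}\,\mathbb P(\tau_{-y,l}=n)\to C\qquad\text{as } n\to\infty,\ n\equiv r \pmod d;$$ moreover, there is $c=c(y,l)>0$ such that $\tau_{-y,l}$ is of type $\mathcal Z_{[1,c]}$. (b) For every $i\ge1$ there are constants $C_{i,0},\dots,C_{i,d-1}\ge0$, not all zero, such that for each $r\in\{0,\dots,d-1\}$, $n^{3/2}\,\mathbb P(\tau_i=n)\to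 C_{i,r}$ as $n\to\infty$ along $n\equiv r\pmod d$. 2. Whether or not the walk is a lattice walk, almost surely all crossing times $t_i$ are finite, and for every $i\ge1$ there is $c_i>0$, depending only on $i$ and on the law of the walk, such that $\tau_i$ is of type $\mathcal Z_{[1,c_i]}$. -/

import Mathlib

open MeasureTheory ProbabilityTheory Filter Topology
open scoped BoundedContinuousFunction

/-- Position at time `n` of the walk with steps `x 0, x 1, …`, started at `a`. -/
def walkFrom (a : ℝ) (x : ℕ → ℝ) (n : ℕ) : ℝ := a + ∑ k ∈ Finset.range n, x k

/-- First time at which the walk with steps `x`, started at `-y`, is at level `l`, having been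
`≤ 0` at all earlier times `1 ≤ t' < t`; it is `⊤` if this never happens. -/
noncomputable def jumpTime (y l : ℝ) (x : ℕ → ℝ) : ℕ∞ :=
  sInf {s : ℕ∞ | ∃ t : ℕ, s = (t : ℕ∞) ∧ walkFrom (-y) x t = l ∧
    ∀ t' : ℕ, 1 ≤ t' → t' < t → walkFrom (-y) x t' ≤ 0}

/-- Sign of the path `S` at each time: `+1` at time `0`, and a zero keeps the previous sign. -/
noncomputable def pathSign (S : ℕ → ℝ) : ℕ → ℤ
  | 0 => 1
  | n + 1 => if 0 < S (n + 1) then 1 else if S (n + 1) < 0 then -1 else pathSign S n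

/-- Crossing times: `t_0 = 0` and `t_{i+1}` is the least `s > t_i` such that the signs at times
`s` and `s + 1` are opposite (`⊤` if there is none). -/
noncomputable def crossingTime (S : ℕ → ℝ) : ℕ → ℕ∞
  | 0 => 0
  | i + 1 => sInf {s : ℕ∞ | ∃ n : ℕ, s = (n : ℕ∞) ∧ crossingTime S i < s ∧
      pathSign S n * pathSign S (n + 1) = -1}

/-- Inter-half-excursion time: `interTime S i` is `t_{i+1} - t_i`, for `i = 0, 1, 2, …`. -/
noncomputable def interTime (S : ℕ → ℝ) (i : ℕ) : ℕ∞ := crossingTime S (i + 1) - crossingTime S i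

/-- `ν` is the zero-shift stable law of index `1/2` with skewness `κ` and scale `c`: its
characteristic function is `exp (-c |t|^{1/2} (1 - i κ sgn t))`. -/
def IsHalfStable (κ c : ℝ) (ν : Measure ℝ) : Prop :=
  ∀ t : ℝ, charFun ν t =
    Complex.exp (-((c * Real.sqrt |t| : ℝ) : ℂ) * (1 - Complex.I * ((κ * Real.sign t : ℝ) : ℂ)))

/-- With `Y_1, Y_2, …` i.i.d. of law `μ`, the normalised sums `(Y_1 + ⋯ + Y_n) / n ^ 2`
converge in distribution to `ν`. The exponent `2 = 1 / α` is the one for stable laws of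
index `α = 1/2`. -/
def InHalfDomainOf (μ ν : Measure ℝ) : Prop :=
  IsProbabilityMeasure μ ∧ IsProbabilityMeasure ν ∧
    ∀ f : ℝ →ᵇ ℝ, Tendsto
      (fun n : ℕ => ∫ z : Fin n → ℝ, f ((∑ j, z j) / (n : ℝ) ^ 2) ∂(Measure.pi fun _ => μ))
      atTop (𝓝 (∫ u, f u ∂ν))

/-- The law, on the real line, of a random time `T` conditioned to be finite. -/
noncomputable def finiteTimeLaw {Ω : Type*} [MeasurableSpace Ω] (P : Measure Ω) (T : Ω → ℕ∞) :
    Measure ℝ :=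
  (cond P {ω | T ω ≠ ⊤}).map fun ω => ((T ω).toNat : ℝ)

/-- Conditioned to be finite, `T` is in the domain of (normal) attraction of the one-sided
(skewness `1`) Lévy(1/2) law of scale `c`. -/
def IsLevyHalfType {Ω : Type*} [MeasurableSpace Ω] (P : Measure Ω) (T : Ω → ℕ∞) (c : ℝ) : Prop :=
  ∃ ν : Measure ℝ, IsHalfStable 1 c ν ∧ InHalfDomainOf (finiteTimeLaw P T) ν

/-- `n ^ (3/2) * P (T = n)` tends to `C` as `n → ∞` along `n = r, r + d, r + 2 d, …`. -/
def HasMassLimit {Ω : Type*} [MeasurableSpace Ω] (P : Measure Ω) (T : Ω → ℕ∞) (d r : ℕ) (C : ℝ) :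
    Prop :=
  Tendsto (fun k : ℕ => ((r + d * k : ℕ) : ℝ) ^ (3 / 2 : ℝ) *
    P.real {ω | T ω = ((r + d * k : ℕ) : ℕ∞)}) atTop (𝓝 C)

/-! Normalised sums of copies of `T` converge to the one-sided Lévy law as soon as the sums `∑ P(T =
n) (1 - exp (iθn))`, divided by `√θ`, tend to a positive multiple of `1 - i` as `θ ↓ 0`
(`exists_isHalfStable_inHalfDomainOf`, `isLevyHalfType_of_tendsto`). So every stable-type claim is a
statement about such an "oscillation" sum.

For the first passage `T` of the walk above a level `y ≥ 0` the sum is found by optional stopping.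
Near the origin the equation `E exp (lX) = exp (-iθ)` has a root `l` with positive real part and `l
~ √θ (1 - i) / √(E X²)` (`IsStepMass.exists_laplace_root`). The martingale `exp (iθn + l S_n)` stays
bounded up to time `T`, because the walk is bounded above and the overshoot is bounded. Hence `E exp
(iθT + l S_T) = 1`, and `E (1 - exp (iθT)) = E exp (iθT) (exp (l S_T) - 1) ~ l E S_T`. No lattice
assumption enters. A crossing that lands at `x` starts afresh as a first passage above `|x|` of the
walk or of its reflection. Landing points are bounded by the largest step, so the time to the next
crossing is a mixture of passage times with uniform bounds, and dominated convergence gives the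
second half of the theorem.

The local statements use the lattice. The local limit theorem gives `P(S_n = x) ~ κ n^(-1/2)` on the
residue class of `n` in which `x` is reachable (`IsStepMass.exists_local_limit`). Wiener–Hopf
factorisation, differentiated in the generating variable, gives Baxter's recursion
(`natCast_mul_coeff_passMass`): `n P(T = n, S_T = z)` is `P(S_n = z)` minus finitely many
convolutions of ladder masses at `x < z` with `P(S_j = z - x)`. The ladder masses are `O(n^(-3/2))`,
so the convolutions keep the order `n^(-1/2)` with periodic coefficients. The limit for `z` is
positive because the ladder heights below `z` leave out at least the mass at `z`. A renewal
decomposition at the ladder points carries this from level `0` to every `y`.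

A sequence with a periodic `n^(-3/2)` limit is compared with the total passage mass above `0`:
subtract the multiple that makes the periodic coefficients sum to zero. What remains oscillates as
`o(√θ)` (`AsympPeriodic.tendsto_oscillation_zero`), so the restricted passage times inherit their
stable limit from the optional stopping computation. -/

/-! ### Domain of attraction from the characteristic function at the origin. -/

lemma continuous_halfStable_charFun (c : ℝ) :
    Continuous fun t : ℝ => Complex.exp (-((c * Real.sqrt |t| : ℝ) : ℂ) *
      (1 - Complex.I * ((1 * Real.sign t : ℝ) : ℂ))) := by
  have h : Continuous fun t : ℝ => Real.sqrt |t| * Real.sign t := by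
    rw [continuous_iff_continuousAt]
    intro t
    rcases lt_trichotomy t 0 with ht | rfl | ht
    · have : (fun t : ℝ => Real.sqrt |t| * Real.sign t) =ᶠ[𝓝 t] fun t => -Real.sqrt |t| := by
        filter_upwards [gt_mem_nhds ht] with u hu
        simp [Real.sign_of_neg hu]
      exact (ContinuousAt.congr (by fun_prop) this.symm)
    · have h0 : Tendsto (fun t : ℝ => Real.sqrt |t|) (𝓝 0) (𝓝 0) := by
        have : ContinuousAt (fun t : ℝ => Real.sqrt |t|) 0 := by fun_prop
        simpa [ContinuousAt] using this
      rw [ContinuousAt]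
      simp only [abs_zero, Real.sqrt_zero, zero_mul]
      refine squeeze_zero_norm (fun t => ?_) h0
      rcases lt_trichotomy t 0 with ht | rfl | ht
      · simp [Real.sign_of_neg ht, abs_of_nonneg (Real.sqrt_nonneg _)]
      · simp
      · simp [Real.sign_of_pos ht, abs_of_nonneg (Real.sqrt_nonneg _)]
    · have : (fun t : ℝ => Real.sqrt |t| * Real.sign t) =ᶠ[𝓝 t] fun t => Real.sqrt |t| := by
        filter_upwards [lt_mem_nhds ht] with u hu
        simp [Real.sign_of_pos hu]
      exact (ContinuousAt.congr (by fun_prop) this.symm)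
  have h2 : Continuous fun t : ℝ => Real.sqrt |t| := by fun_prop
  have : (fun t : ℝ => Complex.exp (-((c * Real.sqrt |t| : ℝ) : ℂ) *
      (1 - Complex.I * ((1 * Real.sign t : ℝ) : ℂ)))) = fun t : ℝ =>
      Complex.exp (-(c * (Real.sqrt |t| : ℝ)) +
        c * Complex.I * ((Real.sqrt |t| * Real.sign t : ℝ) : ℂ)) := by
    funext t
    push_cast
    ring_nf
  rw [this]
  fun_prop

/-- At `θ = t / n²` one has `n = √t / √θ`, which settles `t > 0`. Negative `t` follow by complex
conjugation, and that is where the sign of `t` in the limit comes from. -/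
lemma tendsto_sq_scaled_charFun {μ : Measure ℝ} [IsProbabilityMeasure μ] {c : ℝ}
    (h : Tendsto (fun θ : ℝ => (1 - charFun μ θ) / (Real.sqrt θ : ℂ)) (𝓝[>] 0)
      (𝓝 (c * (1 - Complex.I)))) (t : ℝ) :
    Tendsto (fun n : ℕ => (n : ℂ) * (charFun μ (t / (n : ℝ) ^ 2) - 1)) atTop
      (𝓝 (-((c * Real.sqrt |t| : ℝ) : ℂ) * (1 - Complex.I * ((1 * Real.sign t : ℝ) : ℂ)))) := by
  have key : ∀ t : ℝ, 0 < t →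
      Tendsto (fun n : ℕ => (n : ℂ) * (charFun μ (t / (n : ℝ) ^ 2) - 1)) atTop
      (𝓝 (-((c * Real.sqrt t : ℝ) : ℂ) * (1 - Complex.I))) := by
    intro t ht
    have h1 : Tendsto (fun n : ℕ => t / (n : ℝ) ^ 2) atTop (𝓝[>] 0) := by
      refine tendsto_nhdsWithin_iff.2 ⟨?_, ?_⟩
      · exact tendsto_const_nhds.div_atTop
          ((tendsto_pow_atTop two_ne_zero).comp tendsto_natCast_atTop_atTop)
      · filter_upwards [eventually_gt_atTop 0] with n hn
        have : (0 : ℝ) < n := by exact_mod_cast hn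
        exact div_pos ht (by positivity)
    have h2 := (h.comp h1).mul_const (-(Real.sqrt t : ℂ))
    have h3 : (c * (1 - Complex.I)) * (-(Real.sqrt t : ℂ)) =
        -((c * Real.sqrt t : ℝ) : ℂ) * (1 - Complex.I) := by push_cast; ring
    rw [h3] at h2
    refine h2.congr' ?_
    filter_upwards [eventually_gt_atTop 0] with n hn
    have hn' : (n : ℂ) ≠ 0 := by exact_mod_cast hn.ne'
    have hst : ((Real.sqrt t : ℝ) : ℂ) ≠ 0 := by
      exact_mod_cast (Real.sqrt_pos.2 ht).ne'
    simp only [Function.comp_apply]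
    rw [Real.sqrt_div ht.le, Real.sqrt_sq (by positivity)]
    push_cast
    field_simp
    ring
  rcases lt_trichotomy t 0 with ht | rfl | ht
  · have h1 := (key (-t) (by linarith))
    have h2 := (Complex.continuous_conj.tendsto _).comp h1
    refine (h2.congr fun n => ?_).trans_eq ?_
    · simp only [Function.comp_apply, map_mul, map_sub, map_one, Complex.conj_natCast]
      rw [← charFun_neg]
      congr 3
      ring
    · rw [abs_of_neg ht, Real.sign_of_neg ht]
      simp [Complex.conj_ofReal]
  · simp
  · simpa [abs_of_pos ht, Real.sign_of_pos ht] using key t ht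

/-- The stable law is constructed along the way. Pointwise convergence of the characteristic
functions to a function continuous at `0` gives tightness, a limit along an ultrafilter supplies a
law with the right characteristic function, and Lévy's continuity theorem then gives convergence of
the whole sequence. -/
lemma exists_isHalfStable_inHalfDomainOf {μ : Measure ℝ} [IsProbabilityMeasure μ] {c : ℝ}
    (h : Tendsto (fun θ : ℝ => (1 - charFun μ θ) / (Real.sqrt θ : ℂ)) (𝓝[>] 0)
      (𝓝 (c * (1 - Complex.I)))) :
    ∃ ν : Measure ℝ, IsHalfStable 1 c ν ∧ InHalfDomainOf μ ν := by
  have hm : ∀ n : ℕ, Measurable fun z : Fin n → ℝ => (∑ j, z j) / (n : ℝ) ^ 2 := fun n => by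
    fun_prop
  let L : ℕ → ProbabilityMeasure ℝ := fun n =>
    ⟨(Measure.pi fun _ : Fin n => μ).map fun z => (∑ j, z j) / (n : ℝ) ^ 2,
      Measure.isProbabilityMeasure_map (hm n).aemeasurable⟩
  have hL : ∀ n t, charFun (L n : Measure ℝ) t = (charFun μ (t / (n : ℝ) ^ 2)) ^ n := by
    intro n t
    have h1 : (L n : Measure ℝ) = ((Measure.pi fun _ : Fin n => μ).map fun z => ∑ j, z j).map
        (((n : ℝ) ^ 2)⁻¹ * ·) := by
      rw [Measure.map_map (by fun_prop) (by fun_prop)]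
      simp only [L, ProbabilityMeasure.coe_mk]
      congr 1
      funext z
      simp [div_eq_inv_mul]
    rw [h1, charFun_map_mul, charFun_map_sum_pi_eq_prod]
    simp [div_eq_inv_mul]
  let f : ℝ → ℂ := fun t => Complex.exp (-((c * Real.sqrt |t| : ℝ) : ℂ) *
      (1 - Complex.I * ((1 * Real.sign t : ℝ) : ℂ)))
  have hlim : ∀ t, Tendsto (fun n => charFun (L n : Measure ℝ) t) atTop (𝓝 (f t)) := by
    intro t
    have := Complex.tendsto_one_add_pow_exp_of_tendsto (tendsto_sq_scaled_charFun h t)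
    refine this.congr fun n => ?_
    rw [hL]
    ring
  have htight := isTightMeasureSet_of_tendsto_charFun
    (continuous_halfStable_charFun c).continuousAt hlim
  have hcomp : IsCompact (closure (Set.range L)) := by
    refine isCompact_closure_of_isTightMeasureSet ?_
    convert htight using 1
    ext m
    simp
  obtain ⟨ν, -, hUν : Tendsto L (hyperfilter ℕ : Filter ℕ) (𝓝 ν)⟩ :=
    hcomp.ultrafilter_le_nhds ((hyperfilter ℕ).map L)
      (.trans (by simp) (monotone_principal subset_closure))
  have hU : (hyperfilter ℕ : Filter ℕ) ≤ atTop := Nat.hyperfilter_le_atTop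
  have hchar : ∀ t, charFun (ν : Measure ℝ) t = f t := by
    intro t
    refine tendsto_nhds_unique ?_ ((hlim t).mono_left hU)
    rw [ProbabilityMeasure.tendsto_iff_forall_integral_rclike_tendsto ℂ] at hUν
    simp_rw [charFun_eq_integral_innerProbChar]
    exact hUν _
  refine ⟨ν, hchar, inferInstance, inferInstance, fun g => ?_⟩
  have hconv : Tendsto L atTop (𝓝 ν) :=
    ProbabilityMeasure.tendsto_of_tendsto_charFun fun t => by rw [hchar]; exact hlim t
  have := (ProbabilityMeasure.tendsto_iff_forall_integral_tendsto.1 hconv) g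
  refine this.congr fun n => ?_
  simp only [L, ProbabilityMeasure.coe_mk]
  rw [integral_map (hm n).aemeasurable (by fun_prop)]

/-! ### Wiener–Hopf factorisation in the group algebra, where convolution is multiplication. -/

/-- `f` has no mass outside `s`. -/
def SupportedIn (s : Set ℝ) (f : AddMonoidAlgebra ℝ ℝ) : Prop := ∀ x ∉ s, f.coeff x = 0

/-- Restriction of a finitely supported mass function to `s`. -/
noncomputable def restrictMass (s : Set ℝ) (f : AddMonoidAlgebra ℝ ℝ) : AddMonoidAlgebra ℝ ℝ :=
  open Classical in .ofCoeff (f.coeff.filter (· ∈ s))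

/-- Mass function of the position at time `n` of the walk with step mass function `p`, started at
`0`, on the event that it has been at most `y` at times `1, …, n`. -/
noncomputable def stayMass (p : AddMonoidAlgebra ℝ ℝ) (y : ℝ) : ℕ → AddMonoidAlgebra ℝ ℝ
  | 0 => 1
  | n + 1 => restrictMass (Set.Iic y) (stayMass p y n * p)

/-- Mass function of the position at time `n` of the walk with step mass function `p`, started at
`0`, on the event that it exceeds `y` for the first time at time `n`. -/
noncomputable def passMass (p : AddMonoidAlgebra ℝ ℝ) (y : ℝ) : ℕ → AddMonoidAlgebra ℝ ℝ
  | 0 => 0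
  | n + 1 => restrictMass (Set.Ioi y) (stayMass p y n * p)

section Algebra

variable {p f g : AddMonoidAlgebra ℝ ℝ} {s t u : Set ℝ}

lemma massExt (h : ∀ x, f.coeff x = g.coeff x) : f = g := by
  ext x; exact h x

open Classical in
lemma coeff_restrictMass (s : Set ℝ) (f : AddMonoidAlgebra ℝ ℝ) (x : ℝ) :
    (restrictMass s f).coeff x = if x ∈ s then f.coeff x else 0 := by
  simp [restrictMass, Finsupp.filter_apply]

lemma supportedIn_restrictMass (s : Set ℝ) (f : AddMonoidAlgebra ℝ ℝ) :
    SupportedIn s (restrictMass s f) := fun x hx => by simp [coeff_restrictMass, hx]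

lemma coeff_mul_eq_sum (f g : AddMonoidAlgebra ℝ ℝ) (z : ℝ) :
    (f * g).coeff z = ∑ x ∈ f.coeff.support, f.coeff x * g.coeff (z - x) := by
  classical
  rw [AddMonoidAlgebra.coeff_mul, Finsupp.sum]
  refine Finset.sum_congr rfl fun x _ => ?_
  rw [Finsupp.sum]
  have : ∀ w ∈ g.coeff.support, (if x + w = z then f.coeff x * g.coeff w else 0) =
      if w = z - x then f.coeff x * g.coeff (z - x) else 0 := by
    intro w _
    by_cases h : w = z - x
    · subst h; simp
    · rw [if_neg h, if_neg (fun h' => h (by linarith))]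
  rw [Finset.sum_congr rfl this, Finset.sum_ite_eq']
  split_ifs with h
  · rfl
  · simp [Finsupp.notMem_support_iff.1 h]

lemma coeff_mul_eq_sum_of_subset (f g : AddMonoidAlgebra ℝ ℝ) (z : ℝ) {I : Finset ℝ}
    (hI : ∀ x, f.coeff x ≠ 0 → g.coeff (z - x) ≠ 0 → x ∈ I) :
    (f * g).coeff z = ∑ x ∈ I, f.coeff x * g.coeff (z - x) := by
  classical
  rw [coeff_mul_eq_sum]
  rw [← Finset.sum_subset (s₁ := f.coeff.support ∩ I) Finset.inter_subset_left,
    ← Finset.sum_subset (s₁ := f.coeff.support ∩ I) (s₂ := I) Finset.inter_subset_right]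
  · intro x hx hx'
    have : x ∉ f.coeff.support := fun h => hx' (Finset.mem_inter.2 ⟨h, hx⟩)
    simp [Finsupp.notMem_support_iff.1 this]
  · intro x hx hx'
    by_contra hne
    refine hx' (Finset.mem_inter.2 ⟨hx, hI x (left_ne_zero_of_mul hne) (right_ne_zero_of_mul hne)⟩)

lemma coeff_mul_nonneg (hf : ∀ x, 0 ≤ f.coeff x) (hg : ∀ x, 0 ≤ g.coeff x) (z : ℝ) :
    0 ≤ (f * g).coeff z := by
  rw [coeff_mul_eq_sum]
  exact Finset.sum_nonneg fun x _ => mul_nonneg (hf x) (hg _)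

lemma SupportedIn.mono (h : SupportedIn s f) (hst : s ⊆ t) : SupportedIn t f :=
  fun x hx => h x fun hx' => hx (hst hx')

lemma SupportedIn.add (hf : SupportedIn s f) (hg : SupportedIn s g) : SupportedIn s (f + g) :=
  fun x hx => by simp [hf x hx, hg x hx]

lemma SupportedIn.sub (hf : SupportedIn s f) (hg : SupportedIn s g) : SupportedIn s (f - g) :=
  fun x hx => by simp [hf x hx, hg x hx]

lemma SupportedIn.smul (c : ℝ) (hf : SupportedIn s f) : SupportedIn s (c • f) :=
  fun x hx => by simp [hf x hx]

lemma supportedIn_zero (s : Set ℝ) : SupportedIn s 0 := fun x _ => by simp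

lemma SupportedIn.sum {ι : Type*} {I : Finset ι} {F : ι → AddMonoidAlgebra ℝ ℝ}
    (h : ∀ i ∈ I, SupportedIn s (F i)) : SupportedIn s (∑ i ∈ I, F i) :=
  fun x hx => by
    rw [AddMonoidAlgebra.coeff_sum, Finsupp.finsetSum_apply]
    exact Finset.sum_eq_zero fun i hi => h i hi x hx

lemma SupportedIn.mul (hf : SupportedIn s f) (hg : SupportedIn t g)
    (h : ∀ x ∈ s, ∀ y ∈ t, x + y ∈ u) : SupportedIn u (f * g) := fun z hz => by
  rw [coeff_mul_eq_sum]
  refine Finset.sum_eq_zero fun x _ => ?_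
  by_contra hne
  refine hz ?_
  have hx : x ∈ s := by_contra fun hx => left_ne_zero_of_mul hne (hf x hx)
  have hy : z - x ∈ t := by_contra fun hx => right_ne_zero_of_mul hne (hg _ hx)
  simpa using h x hx _ hy

lemma supportedIn_single {x : ℝ} (hx : x ∈ s) (c : ℝ) :
    SupportedIn s (AddMonoidAlgebra.single x c) := fun z hz => by
  have : x ≠ z := fun h => hz (h ▸ hx)
  simp [this]

lemma supportedIn_one (h : (0 : ℝ) ∈ s) : SupportedIn s 1 := by
  rw [AddMonoidAlgebra.one_def]
  exact supportedIn_single h 1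

lemma eq_zero_of_supportedIn_compl (h : SupportedIn s f) (h' : SupportedIn sᶜ f) : f = 0 :=
  massExt fun x => by
    by_cases hx : x ∈ s
    · simpa using h' x (by simpa using hx)
    · simpa using h x hx

lemma restrictMass_add_compl (s : Set ℝ) (f : AddMonoidAlgebra ℝ ℝ) :
    restrictMass s f + restrictMass sᶜ f = f := massExt fun x => by
  by_cases hx : x ∈ s <;> simp [coeff_restrictMass, hx]

lemma stayMass_succ_add_passMass_succ (p : AddMonoidAlgebra ℝ ℝ) (y : ℝ) (n : ℕ) :
    stayMass p y (n + 1) + passMass p y (n + 1) = stayMass p y n * p := by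
  rw [stayMass, passMass, ← Set.compl_Iic, restrictMass_add_compl]

lemma supportedIn_stayMass {y : ℝ} (hy : 0 ≤ y) (n : ℕ) :
    SupportedIn (Set.Iic y) (stayMass p y n) := by
  cases n with
  | zero => exact supportedIn_one hy
  | succ n => exact supportedIn_restrictMass _ _

lemma supportedIn_passMass (y : ℝ) (n : ℕ) : SupportedIn (Set.Ioi y) (passMass p y n) := by
  cases n with
  | zero => exact supportedIn_zero _
  | succ n => exact supportedIn_restrictMass _ _

lemma stayMass_nonneg (hp : ∀ x, 0 ≤ p.coeff x) (y : ℝ) (n : ℕ) (x : ℝ) :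
    0 ≤ (stayMass p y n).coeff x := by
  classical
  induction n generalizing x with
  | zero =>
    rw [stayMass, AddMonoidAlgebra.one_def, AddMonoidAlgebra.coeff_single, Finsupp.single_apply]
    split_ifs <;> norm_num
  | succ n ih =>
    rw [stayMass, coeff_restrictMass]
    split_ifs
    · exact coeff_mul_nonneg ih hp x
    · exact le_rfl

lemma passMass_nonneg (hp : ∀ x, 0 ≤ p.coeff x) (y : ℝ) (n : ℕ) (x : ℝ) :
    0 ≤ (passMass p y n).coeff x := by
  classical
  cases n with
  | zero => simp [passMass]
  | succ n =>
    rw [passMass, coeff_restrictMass]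
    split_ifs
    · exact coeff_mul_nonneg (stayMass_nonneg hp y n) hp x
    · exact le_rfl

-- A step from a surviving position either survives or passes; summed over time this is `D (1 - X p)
-- = 1 - A`, the one relation from which the factorisation arguments below start.
open PowerSeries in
lemma mk_stayMass_mul (p : AddMonoidAlgebra ℝ ℝ) (y : ℝ) :
    (PowerSeries.mk (stayMass p y)) * (1 - X * C p) = 1 - PowerSeries.mk (passMass p y) := by
  ext1 n
  cases n with
  | zero => simp [stayMass, passMass]
  | succ n =>
    have := stayMass_succ_add_passMass_succ p y n
    rw [mul_sub, mul_one, mul_comm X, ← mul_assoc]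
    simp [PowerSeries.coeff_succ_mul_X, PowerSeries.coeff_one, ← this]

open PowerSeries in
/-- The factorisation of a power series into a part with coefficients in `s` and a part with
coefficients off `s`, modulo `1 - X p`, is unique. -/
lemma eq_zero_of_mul_one_sub {E F : PowerSeries (AddMonoidAlgebra ℝ ℝ)}
    (h : F * (1 - X * C p) = E) (hF : ∀ n, SupportedIn s (PowerSeries.coeff n F))
    (hE : ∀ n, SupportedIn sᶜ (PowerSeries.coeff n E)) : F = 0 ∧ E = 0 := by
  -- Once the lower coefficients of `F` vanish, the `n`-th coefficients of `F` and `E` coincide, and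
  -- they live on complementary sets.
  have hF0 : ∀ n, PowerSeries.coeff n F = 0 := by
    intro n
    induction n with
    | zero =>
      refine eq_zero_of_supportedIn_compl (hF 0) ?_
      have hn := congrArg (PowerSeries.coeff 0) h
      have h0 := hE 0
      rw [← hn] at h0
      simpa using h0
    | succ n ih =>
      refine eq_zero_of_supportedIn_compl (hF (n + 1)) ?_
      have hn := congrArg (PowerSeries.coeff (n + 1)) h
      rw [mul_sub, mul_one, mul_comm X, ← mul_assoc] at hn
      simp only [map_sub, PowerSeries.coeff_succ_mul_X, PowerSeries.coeff_mul_C, ih, zero_mul,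
        sub_zero] at hn
      rw [hn]
      exact hE (n + 1)
  have : F = 0 := PowerSeries.ext fun n => by simpa using hF0 n
  exact ⟨this, by rw [← h, this, zero_mul]⟩

-- This is the logarithmic derivative of `D (1 - X p) = 1 - A`, sorted by sign. Split `W = 1 / (1 -
-- X p)` as `G + N` into its parts on `(0, ∞)` and `(-∞, 0]`. The differentiated relation says that
-- `D (N - 1) - X D'`, supported on `(-∞, 0]`, becomes `X A' - G (1 - A)`, supported on `(0, ∞)`,
-- when multiplied by `1 - X p`. By uniqueness both vanish, and the second one, read
-- coefficientwise, is the recursion.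
open PowerSeries in
lemma natCast_smul_passMass (p : AddMonoidAlgebra ℝ ℝ) (n : ℕ) :
    (n : ℝ) • passMass p 0 n = restrictMass (Set.Ioi 0) (p ^ n) -
      ∑ ij ∈ Finset.HasAntidiagonal.antidiagonal n, restrictMass (Set.Ioi 0) (p ^ ij.1) * passMass p 0 ij.2 := by
  set D := PowerSeries.mk (stayMass p 0)
  set A := PowerSeries.mk (passMass p 0)
  set G := PowerSeries.mk fun n => restrictMass (Set.Ioi 0) (p ^ n)
  set N := PowerSeries.mk fun n => restrictMass (Set.Iic 0) (p ^ n)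
  set W := PowerSeries.mk fun n => p ^ n
  have hDA : D * (1 - X * C p) = 1 - A := mk_stayMass_mul p 0
  have hGN : G + N = W := by
    ext1 n
    simp only [G, N, W, map_add, PowerSeries.coeff_mk]
    rw [add_comm, ← Set.compl_Iic, restrictMass_add_compl]
  have hW : W * (1 - X * C p) = 1 := by
    ext1 n
    cases n with
    | zero => simp [W]
    | succ n =>
      rw [mul_sub, mul_one, mul_comm X, ← mul_assoc]
      simp [PowerSeries.coeff_succ_mul_X, PowerSeries.coeff_one, W, pow_succ]
  have hder : derivative (AddMonoidAlgebra ℝ ℝ) D * (1 - X * C p) - D * C p =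
      -derivative (AddMonoidAlgebra ℝ ℝ) A := by
    have := congrArg (derivative (AddMonoidAlgebra ℝ ℝ)) hDA
    simp only [Derivation.leibniz, map_sub, Derivation.map_one_eq_zero, smul_eq_mul,
      PowerSeries.derivative_X, PowerSeries.derivative_C] at this
    linear_combination this
  have hmain := eq_zero_of_mul_one_sub (p := p) (s := Set.Iic 0)
    (F := D * (N - 1) - X * derivative (AddMonoidAlgebra ℝ ℝ) D)
    (E := X * derivative (AddMonoidAlgebra ℝ ℝ) A - G * (1 - A)) ?_ ?_ ?_
  · have hn := congrArg (PowerSeries.coeff n) hmain.2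
    rw [mul_sub, mul_one, mul_comm X] at hn
    have hX : PowerSeries.coeff n (derivative (AddMonoidAlgebra ℝ ℝ) A * X) =
        (n : ℝ) • passMass p 0 n := by
      cases n with
      | zero => simp
      | succ n =>
        rw [PowerSeries.coeff_succ_mul_X, PowerSeries.coeff_derivative, PowerSeries.coeff_mk,
          Nat.cast_smul_eq_nsmul, nsmul_eq_mul]
        push_cast
        ring
    rw [map_sub, map_sub, hX, PowerSeries.coeff_mul] at hn
    simp only [G, A, PowerSeries.coeff_mk, map_zero] at hn
    linear_combination hn
  · linear_combination N * hDA - X * hder + (1 - A) * hGN - W * hDA + D * hW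
  · intro n
    rw [map_sub]
    refine SupportedIn.sub ?_ ?_
    · rw [PowerSeries.coeff_mul]
      refine SupportedIn.sum fun ij _ => ?_
      refine SupportedIn.mul (s := Set.Iic 0) (t := Set.Iic 0) ?_ ?_ ?_
      · simpa [D] using supportedIn_stayMass le_rfl _
      · rw [map_sub]
        refine SupportedIn.sub (by simpa [N] using supportedIn_restrictMass _ _) ?_
        rw [PowerSeries.coeff_one]
        split_ifs
        · exact supportedIn_one (by simp)
        · exact supportedIn_zero _
      · intro x hx y hy
        simp only [Set.mem_Iic] at *
        linarith
    · cases n with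
      | zero => simpa using supportedIn_zero _
      | succ n =>
        rw [mul_comm, PowerSeries.coeff_succ_mul_X, PowerSeries.coeff_derivative,
          PowerSeries.coeff_mk]
        have := (supportedIn_stayMass (p := p) le_rfl (n + 1)).smul ((n + 1 : ℕ) : ℝ)
        convert this using 1
        rw [Nat.cast_smul_eq_nsmul, nsmul_eq_mul]
        push_cast
        ring
  · intro n
    rw [Set.compl_Iic, map_sub]
    refine SupportedIn.sub ?_ ?_
    · cases n with
      | zero => simpa using supportedIn_zero _
      | succ n =>
        rw [mul_comm, PowerSeries.coeff_succ_mul_X, PowerSeries.coeff_derivative,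
          PowerSeries.coeff_mk]
        have := (supportedIn_passMass (p := p) 0 (n + 1)).smul ((n + 1 : ℕ) : ℝ)
        convert this using 1
        rw [Nat.cast_smul_eq_nsmul, nsmul_eq_mul]
        push_cast
        ring
    · rw [mul_sub, mul_one, map_sub, PowerSeries.coeff_mul]
      refine SupportedIn.sub (by simpa [G] using supportedIn_restrictMass _ _)
        (SupportedIn.sum fun ij _ => ?_)
      refine SupportedIn.mul (s := Set.Ioi 0) (t := Set.Ioi 0)
        (by simpa [G] using supportedIn_restrictMass _ _)
        (by simpa [A] using supportedIn_passMass _ _) ?_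
      intro x hx y hy
      simp only [Set.mem_Ioi] at *
      linarith

/-- Baxter's recursion for the joint law of the first passage time above `0` and the position. -/
lemma natCast_mul_coeff_passMass (p : AddMonoidAlgebra ℝ ℝ) (n : ℕ) {z : ℝ} (hz : 0 < z)
    {I : Finset ℝ} (hI : ∀ i x, (passMass p 0 i).coeff x ≠ 0 → x < z → x ∈ I)
    (hIz : ∀ x ∈ I, x < z) :
    (n : ℝ) * (passMass p 0 n).coeff z = (p ^ n).coeff z -
      ∑ x ∈ I, ∑ ij ∈ Finset.HasAntidiagonal.antidiagonal n,
        (passMass p 0 ij.1).coeff x * (p ^ ij.2).coeff (z - x) := by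
  have h := congrArg (fun f => f.coeff z) (natCast_smul_passMass p n)
  simp only [AddMonoidAlgebra.coeff_smul, Finsupp.smul_apply, smul_eq_mul,
    AddMonoidAlgebra.coeff_sub, Finsupp.sub_apply, coeff_restrictMass, Set.mem_Ioi, hz, if_true,
    AddMonoidAlgebra.coeff_sum, Finsupp.finsetSum_apply] at h
  rw [h, Finset.sum_comm, ← Finset.Nat.sum_antidiagonal_swap]
  congr 1
  refine Finset.sum_congr rfl fun ij _ => ?_
  simp only [Prod.fst_swap, Prod.snd_swap]
  -- The power factor is restricted to `(0, ∞)`, so only landing points `x < z` contribute.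
  rw [mul_comm, coeff_mul_eq_sum_of_subset (I := I)]
  · refine Finset.sum_congr rfl fun x hx => ?_
    rw [coeff_restrictMass, if_pos]
    simpa using hIz x hx
  · intro x hx hx'
    refine hI _ x hx ?_
    by_contra hlt
    exact hx' (by rw [coeff_restrictMass, if_neg (by simpa using hlt)])

open PowerSeries in
/-- Decomposition of a first passage above `y` at the first passage above `0`. -/
lemma coeff_passMass_renewal (p : AddMonoidAlgebra ℝ ℝ) {y z : ℝ} (hy : 0 ≤ y) (hz : y < z)
    {I : Finset ℝ} (hI : ∀ i x, (passMass p 0 i).coeff x ≠ 0 → x ≤ y → x ∈ I)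
    (hIy : ∀ x ∈ I, x ≤ y) (n : ℕ) :
    (passMass p y n).coeff z = (passMass p 0 n).coeff z + ∑ x ∈ I,
      ∑ ij ∈ Finset.HasAntidiagonal.antidiagonal n,
        (passMass p 0 ij.1).coeff x * (passMass p (y - x) ij.2).coeff (z - x) := by
  classical
  let a : ℝ → PowerSeries (AddMonoidAlgebra ℝ ℝ) := fun x =>
    PowerSeries.mk fun i => AddMonoidAlgebra.single x ((passMass p 0 i).coeff x)
  have hD := fun y => mk_stayMass_mul p y
  -- `F` is the defect in the decomposition of the surviving mass, `E` the one for the passing mass.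
  -- The difference of the level-`0` passage series and `∑ a x` is the part of the first passage
  -- above `0` that already exceeds `y`; the remaining terms restart from a ladder point `x ≤ y`
  -- with level `y - x`.
  have hmain := eq_zero_of_mul_one_sub (p := p) (s := Set.Iic y)
    (F := PowerSeries.mk (stayMass p 0) +
      ∑ x ∈ I, a x * PowerSeries.mk (stayMass p (y - x)) - PowerSeries.mk (stayMass p y))
    (E := PowerSeries.mk (passMass p y) - (PowerSeries.mk (passMass p 0) - ∑ x ∈ I, a x) -
      ∑ x ∈ I, a x * PowerSeries.mk (passMass p (y - x))) ?_ ?_ ?_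
  · have hn := congrArg (fun E => (PowerSeries.coeff n E).coeff z) hmain.2
    have h1 : ∀ x ∈ I, ((PowerSeries.coeff n) (a x)).coeff z = 0 := by
      intro x hx
      have : x ≠ z := by have := hIy x hx; intro h; linarith
      simp [a, this]
    simp only [map_sub, map_sum, PowerSeries.coeff_mk, PowerSeries.coeff_mul,
      AddMonoidAlgebra.coeff_sub, AddMonoidAlgebra.coeff_sum, Finsupp.sub_apply,
      Finsupp.finsetSum_apply, map_zero, AddMonoidAlgebra.coeff_zero, Finsupp.zero_apply] at hn
    rw [Finset.sum_eq_zero h1] at hn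
    have h2 : ∀ x ∈ I, ∀ ij ∈ Finset.HasAntidiagonal.antidiagonal n,
        ((PowerSeries.coeff ij.1 (a x)) * passMass p (y - x) ij.2).coeff z =
        (passMass p 0 ij.1).coeff x * (passMass p (y - x) ij.2).coeff (z - x) := by
      intro x _ ij _
      simp only [a, PowerSeries.coeff_mk]
      rw [AddMonoidAlgebra.coeff_single_mul_apply]
      congr 2
      ring
    rw [Finset.sum_congr rfl fun x hx => Finset.sum_congr rfl (h2 x hx)] at hn
    linarith
  · simp only [sub_mul, add_mul, Finset.sum_mul, mul_assoc, hD]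
    simp only [mul_sub, mul_one, Finset.sum_sub_distrib]
    ring
  · intro n
    simp only [map_sub, map_add, map_sum, PowerSeries.coeff_mk, PowerSeries.coeff_mul]
    refine SupportedIn.sub (SupportedIn.add
      ((supportedIn_stayMass le_rfl n).mono (Set.Iic_subset_Iic.2 hy))
      (SupportedIn.sum fun x hx => SupportedIn.sum fun ij _ => ?_)) (supportedIn_stayMass hy n)
    refine SupportedIn.mul (s := {x}) (t := Set.Iic (y - x)) ?_
      (supportedIn_stayMass (by linarith [hIy x hx]) _) ?_
    · simpa [a] using supportedIn_single (by simp) _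
    · intro u hu v hv
      simp only [Set.mem_singleton_iff, Set.mem_Iic] at *
      linarith
  · intro n
    rw [Set.compl_Iic]
    simp only [map_sub, map_sum, PowerSeries.coeff_mk, PowerSeries.coeff_mul]
    refine SupportedIn.sub (SupportedIn.sub (supportedIn_passMass _ _) ?_)
      (SupportedIn.sum fun x hx => SupportedIn.sum fun ij _ => ?_)
    · intro x hx
      simp only [a, PowerSeries.coeff_mk, AddMonoidAlgebra.coeff_sub, Finsupp.sub_apply,
        AddMonoidAlgebra.coeff_sum, Finsupp.finsetSum_apply, AddMonoidAlgebra.coeff_single,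
        Finsupp.single_apply, Finset.sum_ite_eq']
      split_ifs with h
      · simp
      · by_contra hne
        exact h (hI n x (by simpa using hne) (by simpa using hx))
    · refine SupportedIn.mul (s := {x}) (t := Set.Ioi (y - x)) ?_ (supportedIn_passMass _ _) ?_
      · simpa [a] using supportedIn_single (by simp) _
      · intro u hu v hv
        simp only [Set.mem_singleton_iff, Set.mem_Ioi] at *
        linarith

end Algebra

/-! ### Convolutions of sequences with periodic power-law asymptotics. -/

/-- `n ^ α * a n` is asymptotic, additively, to the `d`-periodic sequence `c n`. -/
def AsympPeriodic (d : ℕ) (α : ℝ) (a : ℕ → ℝ) (c : ZMod d → ℝ) : Prop :=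
  Tendsto (fun n : ℕ => (n : ℝ) ^ α * a n - c (n : ZMod d)) atTop (𝓝 0)

section AsympPeriodic

variable {d : ℕ} {α : ℝ} {a b : ℕ → ℝ} {c c' : ZMod d → ℝ}

lemma AsympPeriodic.add (ha : AsympPeriodic d α a c) (hb : AsympPeriodic d α b c') :
    AsympPeriodic d α (fun n => a n + b n) (fun r => c r + c' r) := by
  have := Tendsto.add ha hb
  rw [add_zero] at this
  exact this.congr fun n => by ring

lemma AsympPeriodic.const_mul (k : ℝ) (ha : AsympPeriodic d α a c) :
    AsympPeriodic d α (fun n => k * a n) (fun r => k * c r) := by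
  have := Tendsto.const_mul k ha
  rw [mul_zero] at this
  exact this.congr fun n => by ring

lemma AsympPeriodic.sub (ha : AsympPeriodic d α a c) (hb : AsympPeriodic d α b c') :
    AsympPeriodic d α (fun n => a n - b n) (fun r => c r - c' r) := by
  have := Tendsto.sub ha hb
  rw [sub_zero] at this
  exact this.congr fun n => by ring

lemma asympPeriodic_zero : AsympPeriodic d α (fun _ => 0) (fun _ => 0) := by
  simp [AsympPeriodic]

lemma AsympPeriodic.sum {ι : Type*} {I : Finset ι} {a : ι → ℕ → ℝ} {c : ι → ZMod d → ℝ}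
    (h : ∀ i ∈ I, AsympPeriodic d α (a i) (c i)) :
    AsympPeriodic d α (fun n => ∑ i ∈ I, a i n) (fun r => ∑ i ∈ I, c i r) := by
  have := tendsto_finsetSum I h
  rw [Finset.sum_const_zero] at this
  exact this.congr fun n => by rw [Finset.sum_sub_distrib, Finset.mul_sum]

lemma AsympPeriodic.tendsto_class [NeZero d] (ha : AsympPeriodic d α a c) (r : ℕ) :
    Tendsto (fun k : ℕ => ((r + d * k : ℕ) : ℝ) ^ α * a (r + d * k)) atTop (𝓝 (c (r : ZMod d))) := by
  have h1 : Tendsto (fun k : ℕ => r + d * k) atTop atTop :=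
    tendsto_atTop_mono (fun k => (Nat.le_mul_of_pos_left k (Nat.pos_of_neZero d)).trans
      (Nat.le_add_left _ _)) tendsto_id
  have h2 := (ha.comp h1).add_const (c (r : ZMod d))
  rw [zero_add] at h2
  refine h2.congr fun k => ?_
  simp

lemma AsympPeriodic.nonneg [NeZero d] (ha : AsympPeriodic d α a c) (h : ∀ n, 0 ≤ a n)
    (r : ZMod d) : 0 ≤ c r := by
  have h1 := ha.tendsto_class r.val
  rw [ZMod.natCast_zmod_val] at h1
  exact ge_of_tendsto' h1 fun k => mul_nonneg (by positivity) (h _)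

lemma exists_bound_zmod [NeZero d] (c : ZMod d → ℝ) : ∃ K, 0 ≤ K ∧ ∀ r, |c r| ≤ K :=
  ⟨∑ r, |c r|, Finset.sum_nonneg fun _ _ => abs_nonneg _, fun r =>
    Finset.single_le_sum (f := fun r => |c r|) (fun _ _ => abs_nonneg _) (Finset.mem_univ r)⟩

lemma AsympPeriodic.exists_bound [NeZero d] (ha : AsympPeriodic d α a c) :
    ∃ K, 0 ≤ K ∧ ∀ n : ℕ, (n : ℝ) ^ α * |a n| ≤ K := by
  obtain ⟨K, hK, hc⟩ := exists_bound_zmod c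
  obtain ⟨B, hB⟩ := (Metric.isBounded_range_of_tendsto _ ha).exists_norm_le
  refine ⟨B + K, add_nonneg ((norm_nonneg _).trans (hB _ ⟨0, rfl⟩)) hK, fun n => ?_⟩
  have h1 := hB _ ⟨n, rfl⟩
  rw [Real.norm_eq_abs] at h1
  have h2 : (n : ℝ) ^ α * |a n| = |(n : ℝ) ^ α * a n| := by
    rw [abs_mul, abs_of_nonneg (a := (n : ℝ) ^ α) (by positivity)]
  rw [h2]
  calc _ = |((n : ℝ) ^ α * a n - c n) + c n| := by ring_nf
    _ ≤ _ := (abs_add_le _ _).trans (add_le_add h1 (hc _))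

lemma summable_of_rpow_bound {a : ℕ → ℝ} {K : ℝ}
    (h : ∀ n : ℕ, (n : ℝ) ^ (3 / 2 : ℝ) * |a n| ≤ K) : Summable fun n => |a n| := by
  have h1 : Summable fun n : ℕ => K * (1 / (n : ℝ) ^ (3 / 2 : ℝ)) :=
    (Real.summable_one_div_nat_rpow.2 (by norm_num)).mul_left K
  refine Summable.of_norm_bounded_eventually_nat h1 ?_
  filter_upwards [eventually_gt_atTop 0] with n hn
  have : (0 : ℝ) < (n : ℝ) ^ (3 / 2 : ℝ) := Real.rpow_pos_of_pos (by exact_mod_cast hn) _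
  rw [Real.norm_eq_abs, abs_abs, mul_one_div, le_div_iff₀ this, mul_comm]
  exact h n

lemma tendsto_natCast_div_sub_rpow (α : ℝ) (i : ℕ) :
    Tendsto (fun n : ℕ => ((n : ℝ) / ((n - i : ℕ) : ℝ)) ^ α) atTop (𝓝 1) := by
  have h1 : Tendsto (fun n : ℕ => (n : ℝ) / ((n - i : ℕ) : ℝ)) atTop (𝓝 1) := by
    have h2 : Tendsto (fun n : ℕ => 1 + (i : ℝ) / (n : ℝ)) atTop (𝓝 (1 + 0)) :=
      tendsto_const_nhds.add (tendsto_const_nhds.div_atTop tendsto_natCast_atTop_atTop)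
    rw [add_zero] at h2
    refine (h2.comp (tendsto_sub_atTop_nat i)).congr' ?_
    filter_upwards [eventually_gt_atTop i] with n hn
    have h3 : ((n - i : ℕ) : ℝ) ≠ 0 := by
      exact_mod_cast (Nat.sub_pos_of_lt hn).ne'
    simp only [Function.comp_apply]
    rw [eq_div_iff h3, add_mul, div_mul_cancel₀ _ h3, Nat.cast_sub hn.le]
    ring
  have := h1.rpow_const (p := α) (Or.inl one_ne_zero)
  simpa using this

/-- The contribution to a convolution of the terms whose index for the summable factor is at
most half. -/
lemma tendsto_half_convolution [NeZero d] (hα : 0 ≤ α) (ha : Summable fun n => |a n|)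
    (hb : AsympPeriodic d α b c) (q : ℕ → ℕ → Prop) [∀ n i, Decidable (q n i)]
    (hq : ∀ n i, q n i → 2 * i ≤ n) (hq' : ∀ i, ∀ᶠ n in atTop, q n i) :
    Tendsto (fun n : ℕ => (n : ℝ) ^ α * ∑ ij ∈ Finset.HasAntidiagonal.antidiagonal n,
      (if q n ij.1 then a ij.1 * b ij.2 else 0) - ∑' i, a i * c ((n : ZMod d) - i))
      atTop (𝓝 0) := by
  obtain ⟨K, hK, hbK⟩ := hb.exists_bound
  obtain ⟨K', hK', hcK⟩ := exists_bound_zmod c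
  have hsc : ∀ n : ℕ, Summable fun i : ℕ => a i * c ((n : ZMod d) - i) := fun n =>
    Summable.of_norm_bounded (ha.mul_right K') fun i => by
      rw [norm_mul]; exact mul_le_mul_of_nonneg_left (hcK _) (abs_nonneg _)
  have hsum : ∀ n : ℕ, (n : ℝ) ^ α * ∑ ij ∈ Finset.HasAntidiagonal.antidiagonal n,
      (if q n ij.1 then a ij.1 * b ij.2 else 0) =
      ∑' i, if q n i then a i * ((n : ℝ) ^ α * b (n - i)) else 0 := by
    intro n
    rw [tsum_eq_sum (s := Finset.range (n + 1)), Finset.Nat.sum_antidiagonal_eq_sum_range_succ_mk,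
      Finset.mul_sum]
    · refine Finset.sum_congr rfl fun i _ => ?_
      simp only
      split_ifs <;> ring
    · intro i hi
      rw [if_neg]
      intro h
      have := hq n i h
      simp at hi
      omega
  have hss : ∀ n : ℕ, Summable fun i => if q n i then a i * ((n : ℝ) ^ α * b (n - i)) else 0 := by
    intro n
    refine summable_of_ne_finset_zero (s := Finset.range (n + 1)) fun i hi => ?_
    rw [if_neg]
    intro h
    have := hq n i h
    simp at hi
    omega
  -- When `2 i ≤ n` the other index is at least `n / 2`, so `n ^ α * b (n - i)` is bounded uniformly
  -- in `i`; this is the domination needed to pass to the limit under the sum.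
  have hbound : ∀ n i : ℕ, 2 * i ≤ n → |(n : ℝ) ^ α * b (n - i)| ≤ 2 ^ α * K := by
    intro n i h
    have h1 : (n : ℝ) ≤ 2 * ((n - i : ℕ) : ℝ) := by
      rw [Nat.cast_sub (by omega)]
      have : (2 : ℝ) * i ≤ n := by exact_mod_cast h
      linarith
    have h2 : (n : ℝ) ^ α ≤ 2 ^ α * ((n - i : ℕ) : ℝ) ^ α := by
      rw [← Real.mul_rpow (by norm_num) (by positivity)]
      exact Real.rpow_le_rpow (by positivity) h1 hα
    rw [abs_mul, abs_of_nonneg (by positivity)]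
    calc (n : ℝ) ^ α * |b (n - i)| ≤ 2 ^ α * ((n - i : ℕ) : ℝ) ^ α * |b (n - i)| :=
          mul_le_mul_of_nonneg_right h2 (abs_nonneg _)
      _ = 2 ^ α * (((n - i : ℕ) : ℝ) ^ α * |b (n - i)|) := by ring
      _ ≤ _ := mul_le_mul_of_nonneg_left (hbK _) (by positivity)
  have hterm : ∀ i : ℕ, Tendsto (fun n : ℕ => (if q n i then a i * ((n : ℝ) ^ α * b (n - i))
      else 0) - a i * c ((n : ZMod d) - i)) atTop (𝓝 0) := by
    intro i
    have h1 := (hb.comp (tendsto_sub_atTop_nat i))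
    have h2 : Tendsto (fun n : ℕ => (((n : ℝ) / ((n - i : ℕ) : ℝ)) ^ α - 1) *
        (((n - i : ℕ) : ℝ) ^ α * b (n - i))) atTop (𝓝 0) := by
      have h3 := (tendsto_natCast_div_sub_rpow α i).sub_const 1
      rw [sub_self] at h3
      refine bdd_le_mul_tendsto_zero' K (Eventually.of_forall fun n => ?_) h3 |>.congr
        fun n => mul_comm _ _
      rw [abs_mul, abs_of_nonneg (by positivity)]
      exact hbK _
    have h4 := (h1.add h2).const_mul (a i)
    rw [add_zero, mul_zero] at h4
    refine h4.congr' ?_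
    filter_upwards [hq' i, eventually_gt_atTop i] with n hn hni
    have h3 : (0 : ℝ) < ((n - i : ℕ) : ℝ) := by
      exact_mod_cast (Nat.sub_pos_of_lt hni)
    rw [if_pos hn]
    simp only [Function.comp_apply]
    rw [Real.div_rpow (by positivity) h3.le, Nat.cast_sub hni.le (R := ZMod d)]
    have : ((n - i : ℕ) : ℝ) ^ α ≠ 0 := (Real.rpow_pos_of_pos h3 _).ne'
    field_simp
    ring
  have hmain := tendsto_tsum_of_dominated_convergence
    (f := fun (n : ℕ) i => (if q n i then a i * ((n : ℝ) ^ α * b (n - i))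
      else 0) - a i * c ((n : ZMod d) - i)) (g := fun _ => 0) (𝓕 := atTop)
    (bound := fun i => |a i| * (2 ^ α * K + K')) (ha.mul_right _) hterm
    (Eventually.of_forall fun n i => ?_)
  · rw [tsum_zero] at hmain
    refine hmain.congr fun n => ?_
    rw [(hss n).tsum_sub (hsc n), hsum]
  · refine (norm_sub_le _ _).trans ?_
    rw [mul_add]
    refine add_le_add ?_ ?_
    · split_ifs with h
      · rw [norm_mul]
        exact mul_le_mul_of_nonneg_left (hbound n i (hq n i h)) (abs_nonneg _)
      · rw [norm_zero]; positivity
    · rw [norm_mul]; exact mul_le_mul_of_nonneg_left (hcK _) (abs_nonneg _)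

/-- The strict inequality in the second half keeps the diagonal term from being counted twice. -/
lemma sum_antidiagonal_split (a b : ℕ → ℝ) (n : ℕ) :
    ∑ ij ∈ Finset.HasAntidiagonal.antidiagonal n, a ij.1 * b ij.2 =
      ∑ ij ∈ Finset.HasAntidiagonal.antidiagonal n,
        (if 2 * ij.1 ≤ n then a ij.1 * b ij.2 else 0) +
      ∑ ij ∈ Finset.HasAntidiagonal.antidiagonal n,
        (if 2 * ij.1 < n then b ij.1 * a ij.2 else 0) := by
  rw [← Finset.Nat.sum_antidiagonal_swap (f := fun ij : ℕ × ℕ =>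
    if 2 * ij.1 < n then b ij.1 * a ij.2 else 0), ← Finset.sum_add_distrib]
  refine Finset.sum_congr rfl fun ij hij => ?_
  have := Finset.HasAntidiagonal.mem_antidiagonal.1 hij
  simp only [Prod.fst_swap, Prod.snd_swap]
  by_cases h : 2 * ij.1 ≤ n
  · rw [if_pos h, if_neg (by omega), add_zero]
  · rw [if_neg h, if_pos (by omega), zero_add, mul_comm]

/-- The principle of a single large index: one factor takes the index near `n` and the other is
summed freely, which gives one term of the limit for each choice. -/
lemma AsympPeriodic.convolution [NeZero d] (ha : AsympPeriodic d (3 / 2) a c)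
    (hb : AsympPeriodic d (3 / 2) b c') :
    AsympPeriodic d (3 / 2)
      (fun n => ∑ ij ∈ Finset.HasAntidiagonal.antidiagonal n, a ij.1 * b ij.2)
      (fun r => ∑' i, a i * c' (r - i) + ∑' i, b i * c (r - i)) := by
  obtain ⟨K, -, hK⟩ := ha.exists_bound
  obtain ⟨K', -, hK'⟩ := hb.exists_bound
  have h1 := tendsto_half_convolution (by norm_num) (summable_of_rpow_bound hK) hb
    (fun n i => 2 * i ≤ n) (fun n i h => h) fun i => eventually_ge_atTop _
  have h2 := tendsto_half_convolution (by norm_num) (summable_of_rpow_bound hK') ha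
    (fun n i => 2 * i < n) (fun n i h => le_of_lt h) fun i => eventually_gt_atTop _
  have h3 := h1.add h2
  rw [add_zero] at h3
  refine h3.congr fun n => ?_
  simp only
  rw [sum_antidiagonal_split]
  ring

/-- Only the half where `a` has the small index survives. In the other half `a` is at most a
constant times `n^(-3/2)`, so after multiplication by `n^(1/2)` the sum is bounded by a multiple of
the Cesàro mean of `|b|`, which tends to `0`. A bound on `a` therefore suffices, which is what
allows this to be applied before the asymptotics of `a` are known. -/
lemma AsympPeriodic.convolution_of_bound [NeZero d] {K : ℝ}
    (ha : ∀ n : ℕ, (n : ℝ) ^ (3 / 2 : ℝ) * |a n| ≤ K) (hb : AsympPeriodic d (1 / 2) b c) :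
    AsympPeriodic d (1 / 2)
      (fun n => ∑ ij ∈ Finset.HasAntidiagonal.antidiagonal n, a ij.1 * b ij.2)
      (fun r => ∑' i, a i * c (r - i)) := by
  have h1 := tendsto_half_convolution (by norm_num) (summable_of_rpow_bound ha) hb
    (fun n i => 2 * i ≤ n) (fun n i h => h) fun i => eventually_ge_atTop _
  have hb0 : Tendsto (fun n => |b n|) atTop (𝓝 0) := by
    obtain ⟨B, hB, hbB⟩ := hb.exists_bound
    have h2 : Tendsto (fun n : ℕ => B * (1 / (n : ℝ) ^ (1 / 2 : ℝ))) atTop (𝓝 (B * 0)) :=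
      ((tendsto_const_nhds (x := (1 : ℝ))).div_atTop
        ((tendsto_rpow_atTop (by norm_num)).comp tendsto_natCast_atTop_atTop)).const_mul B
    rw [mul_zero] at h2
    refine squeeze_zero' (Eventually.of_forall fun n => abs_nonneg _) ?_ h2
    filter_upwards [eventually_gt_atTop 0] with n hn
    have : (0 : ℝ) < (n : ℝ) ^ (1 / 2 : ℝ) := Real.rpow_pos_of_pos (by exact_mod_cast hn) _
    rw [mul_one_div, le_div_iff₀ this, mul_comm]
    exact hbB n
  have hces := hb0.cesaro.const_mul (2 ^ (3 / 2 : ℝ) * K)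
  rw [mul_zero] at hces
  have h2 : Tendsto (fun n : ℕ => (n : ℝ) ^ (1 / 2 : ℝ) *
      ∑ ij ∈ Finset.HasAntidiagonal.antidiagonal n,
        (if 2 * ij.1 < n then b ij.1 * a ij.2 else 0)) atTop (𝓝 0) := by
    refine squeeze_zero_norm' ?_ hces
    filter_upwards [eventually_gt_atTop 0] with n hn
    have hn' : (0 : ℝ) < n := by exact_mod_cast hn
    rw [Finset.Nat.sum_antidiagonal_eq_sum_range_succ_mk, norm_mul, Real.norm_eq_abs,
      abs_of_nonneg (by positivity), Finset.sum_range_succ, if_neg (by simp only; omega), add_zero]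
    have h3 : ‖∑ i ∈ Finset.range n, (if 2 * i < n then b i * a (n - i) else 0)‖ ≤
        ∑ i ∈ Finset.range n, |b i| * (2 ^ (3 / 2 : ℝ) * K * (n : ℝ) ^ (-(3 / 2) : ℝ)) := by
      have hK : 0 ≤ K := (by positivity : (0 : ℝ) ≤ _).trans (ha 0)
      refine (norm_sum_le _ _).trans (Finset.sum_le_sum fun i _ => ?_)
      split_ifs with h
      · rw [norm_mul]
        refine mul_le_mul_of_nonneg_left ?_ (abs_nonneg _)
        rw [Real.rpow_neg hn'.le, ← div_eq_mul_inv, le_div_iff₀ (Real.rpow_pos_of_pos hn' _)]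
        have h4 : (n : ℝ) ≤ 2 * ((n - i : ℕ) : ℝ) := by
          rw [Nat.cast_sub (by omega)]
          have : (2 : ℝ) * i < n := by exact_mod_cast h
          linarith
        have h5 : (n : ℝ) ^ (3 / 2 : ℝ) ≤ 2 ^ (3 / 2 : ℝ) * ((n - i : ℕ) : ℝ) ^ (3 / 2 : ℝ) := by
          rw [← Real.mul_rpow (by norm_num) (by positivity)]
          exact Real.rpow_le_rpow (by positivity) h4 (by norm_num)
        calc ‖a (n - i)‖ * (n : ℝ) ^ (3 / 2 : ℝ) ≤
            |a (n - i)| * (2 ^ (3 / 2 : ℝ) * ((n - i : ℕ) : ℝ) ^ (3 / 2 : ℝ)) :=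
              mul_le_mul_of_nonneg_left h5 (abs_nonneg _)
          _ = 2 ^ (3 / 2 : ℝ) * (((n - i : ℕ) : ℝ) ^ (3 / 2 : ℝ) * |a (n - i)|) := by ring
          _ ≤ _ := mul_le_mul_of_nonneg_left (ha _) (by positivity)
      · rw [norm_zero]; positivity
    refine (mul_le_mul_of_nonneg_left h3 (by positivity)).trans_eq ?_
    rw [← Finset.sum_mul]
    have h6 : (n : ℝ) ^ (1 / 2 : ℝ) * (n : ℝ) ^ (-(3 / 2) : ℝ) = (n : ℝ)⁻¹ := by
      rw [← Real.rpow_add hn', ← Real.rpow_neg_one]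
      norm_num
    rw [← h6]
    ring
  have h3 := h1.add h2
  rw [add_zero] at h3
  refine h3.congr fun n => ?_
  simp only
  rw [sum_antidiagonal_split]
  ring

end AsympPeriodic

/-! ### Oscillation sums near the origin for `n^(-3/2)` sequences. -/

section Oscillation

lemma norm_one_sub_exp_le (θ : ℝ) (n : ℕ) :
    ‖1 - Complex.exp ((θ * n : ℝ) * Complex.I)‖ ≤ |θ| * n := by
  rw [norm_sub_rev, mul_comm]
  have := Real.norm_exp_I_mul_ofReal_sub_one_le (x := θ * n)
  rwa [Real.norm_eq_abs, abs_mul, Nat.abs_cast] at this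

lemma norm_one_sub_exp_le_two (θ : ℝ) (n : ℕ) :
    ‖1 - Complex.exp ((θ * n : ℝ) * Complex.I)‖ ≤ 2 := by
  refine (norm_sub_le _ _).trans ?_
  rw [Complex.norm_exp_ofReal_mul_I, norm_one]
  norm_num

lemma rpow_neg_three_halves_eq {x : ℝ} (hx : 0 < x) :
    x ^ (-(3 / 2) : ℝ) = 1 / (x * √x) := by
  rw [show (-(3 / 2) : ℝ) = -(1 + 1 / 2) by norm_num, Real.rpow_neg hx.le, Real.rpow_add hx,
    Real.rpow_one, Real.sqrt_eq_rpow, inv_eq_one_div]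

/-- Instead of comparing with `∫ x^(-3/2) min (2, θx) dx`, the partial sums are bounded inductively
by `16 √θ` times `t / (1 + t)` at `t = √(θN)`: with `r = √θ` and `a = √(θ (N + 1))`, this ratio
grows by at least `r² / (2 a (1 + a)²)` from `N` to `N + 1`, enough to absorb the new summand both
for `a ≤ 1` and for `a ≥ 1`. -/
lemma sum_rpow_mul_min_le {θ : ℝ} (hθ : 0 < θ) (N : ℕ) :
    ∑ n ∈ Finset.range N, (n : ℝ) ^ (-(3 / 2) : ℝ) * min 2 (θ * n) ≤ 16 * √θ := by
  have key : ∀ N : ℕ, ∑ n ∈ Finset.range (N + 1), (n : ℝ) ^ (-(3 / 2) : ℝ) * min 2 (θ * n) ≤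
      16 * √θ * (√(θ * N) / (1 + √(θ * N))) := by
    intro N
    induction N with
    | zero => simp
    | succ N ih =>
      rw [Finset.sum_range_succ]
      set x : ℝ := ((N + 1 : ℕ) : ℝ)
      have hx : 0 < x := by positivity
      have hNx : (N : ℝ) = x - 1 := by simp [x]
      set r := √θ
      have hr : 0 < r := Real.sqrt_pos.2 hθ
      have hr2 : r * r = θ := Real.mul_self_sqrt hθ.le
      set u := √x
      have hu : 0 < u := Real.sqrt_pos.2 hx
      have hu2 : u * u = x := Real.mul_self_sqrt hx.le
      have ha : √(θ * x) = r * u := Real.sqrt_mul hθ.le _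
      set b := √(θ * N)
      have hb : 0 ≤ b := Real.sqrt_nonneg _
      have hb2 : b * b = θ * N := Real.mul_self_sqrt (by positivity)
      have hba : b * b = (r * u) * (r * u) - r * r := by
        rw [hb2, hNx, ← hr2, ← hu2]; ring
      have hab : b ≤ r * u := by nlinarith [mul_pos hr hu, mul_pos hr hr]
      have h1 : (r * u) / (1 + r * u) - b / (1 + b) ≥ r * r / (2 * (r * u) * (1 + r * u) ^ 2) := by
        have ha0 : 0 < r * u := mul_pos hr hu
        rw [div_sub_div _ _ (by positivity) (by positivity), ge_iff_le,
          div_le_div_iff₀ (by positivity) (by positivity)]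
        have e1 : r * u * (1 + b) - (1 + r * u) * b = r * u - b := by ring
        rw [e1]
        have e2 : r * r = (r * u - b) * (r * u + b) := by linarith
        rw [e2]
        have e3 : (r * u + b) * ((1 + r * u) * (1 + b)) ≤ 2 * (r * u) * (1 + r * u) ^ 2 := by
          have : (1 + r * u) * (1 + b) ≤ (1 + r * u) ^ 2 := by nlinarith
          have h2 : r * u + b ≤ 2 * (r * u) := by linarith
          exact mul_le_mul h2 this (by positivity) (by positivity)
        nlinarith [mul_le_mul_of_nonneg_left e3 (sub_nonneg.2 hab)]
      have h2 : x ^ (-(3 / 2) : ℝ) * min 2 (θ * x) ≤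
          16 * r * (r * r / (2 * (r * u) * (1 + r * u) ^ 2)) := by
        have ha0 : 0 < r * u := mul_pos hr hu
        rw [rpow_neg_three_halves_eq hx]
        have e1 : 16 * r * (r * r / (2 * (r * u) * (1 + r * u) ^ 2)) =
            1 / (x * u) * (8 * (r * u) ^ 2 / (1 + r * u) ^ 2) := by
          rw [← hu2]
          field_simp
          ring
        rw [e1]
        refine mul_le_mul_of_nonneg_left ?_ (by positivity)
        rw [le_div_iff₀ (by positivity)]
        have hmx : θ * x = (r * u) ^ 2 := by rw [← hr2, ← hu2]; ring
        rw [hmx]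
        rcases le_total (r * u) 1 with h | h
        · have : (1 + r * u) ^ 2 ≤ 4 := by nlinarith
          nlinarith [min_le_right 2 ((r * u) ^ 2), mul_pos ha0 ha0,
            mul_le_mul_of_nonneg_right (min_le_right 2 ((r * u) ^ 2))
              (by positivity : 0 ≤ (1 + r * u) ^ 2)]
        · have : (1 + r * u) ^ 2 ≤ 4 * (r * u) ^ 2 := by nlinarith
          nlinarith [mul_le_mul_of_nonneg_right (min_le_left 2 ((r * u) ^ 2))
              (by positivity : 0 ≤ (1 + r * u) ^ 2)]
      rw [ha]
      have h3 := mul_le_mul_of_nonneg_left h1 (by positivity : (0 : ℝ) ≤ 16 * r)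
      rw [mul_sub] at h3
      linarith
  have h1 : (0 : ℝ) ≤ (N : ℝ) ^ (-(3 / 2) : ℝ) * min 2 (θ * N) := by positivity
  have h2 := key N
  rw [Finset.sum_range_succ] at h2
  have h3 : √(θ * N) / (1 + √(θ * N)) ≤ 1 := by
    rw [div_le_one (by positivity)]; linarith
  have h4 := mul_le_mul_of_nonneg_left h3 (by positivity : (0 : ℝ) ≤ 16 * √θ)
  linarith

lemma tendsto_oscillation_of_isLittleO {e : ℕ → ℝ}
    (he : Tendsto (fun n : ℕ => (n : ℝ) ^ (3 / 2 : ℝ) * e n) atTop (𝓝 0)) :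
    Tendsto (fun θ : ℝ => (∑' n : ℕ, (e n : ℂ) * (1 - Complex.exp ((θ * n : ℝ) * Complex.I))) /
      (√θ : ℂ)) (𝓝[>] 0) (𝓝 0) := by
  rw [Metric.tendsto_nhds]
  intro ε hε
  -- With the constant `16` of `sum_rpow_mul_min_le` the tail costs `ε / 2`, and the finite head,
  -- which is `O(θ)`, costs `ε / 4`, both relative to `√θ`.
  have h1 := Metric.tendsto_atTop.1 he (ε / 32) (by positivity)
  obtain ⟨N, hN⟩ := h1
  set B := ∑ n ∈ Finset.range (N + 1), |e n| * n
  have hlim : Tendsto (fun θ : ℝ => B * √θ) (𝓝[>] 0) (𝓝 0) := by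
    have : ContinuousAt (fun θ : ℝ => B * √θ) 0 := by fun_prop
    have h2 := this.tendsto
    simp only [Real.sqrt_zero, mul_zero] at h2
    exact h2.mono_left nhdsWithin_le_nhds
  filter_upwards [hlim.eventually (gt_mem_nhds (by positivity : (0 : ℝ) < ε / 4)),
    self_mem_nhdsWithin] with θ hθB hθ
  have hθ : 0 < θ := hθ
  have hr : 0 < √θ := Real.sqrt_pos.2 hθ
  let w : ℕ → ℝ := fun n => (n : ℝ) ^ (-(3 / 2) : ℝ) * min 2 (θ * n)
  have hw0 : ∀ n, 0 ≤ w n := fun n => by positivity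
  have hws : Summable w := summable_of_sum_range_le hw0 (sum_rpow_mul_min_le hθ)
  have hwt : ∑' n, w n ≤ 16 * √θ := Real.tsum_le_of_sum_range_le hw0 (sum_rpow_mul_min_le hθ)
  let f : ℕ → ℝ := fun n => if n ∈ Finset.range (N + 1) then |e n| * n * θ else 0
  have hfs : Summable f := summable_of_ne_finset_zero (s := Finset.range (N + 1)) fun n hn => by
    simp only [f]; rw [if_neg hn]
  have hft : ∑' n, f n = B * θ := by
    rw [tsum_eq_sum (s := Finset.range (N + 1)) fun n hn => by simp only [f]; rw [if_neg hn],
      Finset.sum_mul]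
    exact Finset.sum_congr rfl fun n hn => by simp only [f]; rw [if_pos hn]
  have hbound : ∀ n : ℕ, ‖(e n : ℂ) * (1 - Complex.exp ((θ * n : ℝ) * Complex.I))‖ ≤
      f n + ε / 32 * w n := by
    intro n
    rw [norm_mul, Complex.norm_real, Real.norm_eq_abs]
    have hA := norm_one_sub_exp_le θ n
    rw [abs_of_pos hθ] at hA
    have hA2 := norm_one_sub_exp_le_two θ n
    by_cases hn : n ∈ Finset.range (N + 1)
    · simp only [f]
      rw [if_pos hn]
      have := mul_le_mul_of_nonneg_left hA (abs_nonneg (e n))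
      have : 0 ≤ ε / 32 * w n := mul_nonneg (by positivity) (hw0 n)
      linarith
    · simp only [f]
      rw [if_neg hn, zero_add]
      have hn' : N < n := by simpa using hn
      have hn0 : (0 : ℝ) < n := by exact_mod_cast (Nat.zero_le N).trans_lt hn'
      have h3 := hN n hn'.le
      rw [dist_zero_right, norm_mul, Real.norm_eq_abs, Real.norm_eq_abs,
        abs_of_nonneg (a := (n : ℝ) ^ (3 / 2 : ℝ)) (by positivity)] at h3
      have h4 : |e n| ≤ ε / 32 * (n : ℝ) ^ (-(3 / 2) : ℝ) := by
        rw [Real.rpow_neg hn0.le, ← div_eq_mul_inv, le_div_iff₀ (Real.rpow_pos_of_pos hn0 _)]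
        linarith
      simp only [w]
      rw [← mul_assoc]
      exact mul_le_mul h4 (le_min hA2 hA) (norm_nonneg _) (by positivity)
  have hsum := hfs.add (hws.mul_left (ε / 32))
  have h5 := tsum_of_norm_bounded hsum.hasSum hbound
  rw [hfs.tsum_add (hws.mul_left _), hft, tsum_mul_left] at h5
  rw [dist_zero_right, norm_div, Complex.norm_real, Real.norm_eq_abs, abs_of_pos hr,
    div_lt_iff₀ hr]
  have h6 : B * θ = B * √θ * √θ := by rw [mul_assoc, Real.mul_self_sqrt hθ.le]
  have h7 : B * √θ * √θ ≤ ε / 4 * √θ := mul_le_mul_of_nonneg_right hθB.le hr.le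
  have h8 : ε / 32 * ∑' n, w n ≤ ε / 32 * (16 * √θ) := mul_le_mul_of_nonneg_left hwt (by positivity)
  nlinarith [mul_pos hε hr]

lemma sum_zmod_eq_sum_range {d : ℕ} [NeZero d] (c : ZMod d → ℝ) :
    ∑ r, c r = ∑ n ∈ Finset.range d, c (n : ZMod d) := by
  refine Finset.sum_bij' (fun r _ => r.val) (fun n _ => (n : ZMod d)) ?_ ?_ ?_ ?_ ?_
  · intro r _; simpa using ZMod.val_lt r
  · intro n _; simp
  · intro r _; simp
  · intro n hn; exact ZMod.val_cast_of_lt (by simpa using hn)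
  · intro r _; simp

lemma exists_bound_sum_range_periodic {d : ℕ} [NeZero d] {c : ZMod d → ℝ} (hc : ∑ r, c r = 0) :
    ∃ K, 0 ≤ K ∧ ∀ N : ℕ, |∑ n ∈ Finset.range N, c (n : ZMod d)| ≤ K := by
  have hper : ∀ m k : ℕ, ∑ n ∈ Finset.range (m + d * k), c (n : ZMod d) =
      ∑ n ∈ Finset.range m, c (n : ZMod d) := by
    intro m k
    have hd : ∑ n ∈ Finset.range (d * k), c (n : ZMod d) = 0 := by
      induction k with
      | zero => simp
      | succ k ih =>
        rw [Nat.mul_succ, Finset.sum_range_add, ih, zero_add, ← hc, sum_zmod_eq_sum_range]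
        simp
    rw [add_comm, Finset.sum_range_add, hd, zero_add]
    simp
  refine ⟨∑ m ∈ Finset.range d, |∑ n ∈ Finset.range m, c (n : ZMod d)|,
    Finset.sum_nonneg fun _ _ => abs_nonneg _, fun N => ?_⟩
  rw [← Nat.mod_add_div N d, hper]
  exact Finset.single_le_sum (f := fun m => |∑ n ∈ Finset.range m, c (n : ZMod d)|)
    (fun _ _ => abs_nonneg _) (Finset.mem_range.2 (Nat.mod_lt _ (Nat.pos_of_neZero d)))

lemma sum_range_mul_eq_by_parts (c : ℕ → ℂ) (u : ℕ → ℂ) (N : ℕ) :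
    ∑ n ∈ Finset.range N, c n * u n = (∑ n ∈ Finset.range N, c n) * u N -
      ∑ n ∈ Finset.range N, (∑ k ∈ Finset.range (n + 1), c k) * (u (n + 1) - u n) := by
  induction N with
  | zero => simp
  | succ N ih =>
    rw [Finset.sum_range_succ, ih, Finset.sum_range_succ (fun n =>
      (∑ k ∈ Finset.range (n + 1), c k) * (u (n + 1) - u n)), Finset.sum_range_succ c]
    ring

/-- The factor `n + 1` comes from `|1 - exp (iθ(n + 1))| ≤ θ (n + 1)` in the summation by parts
below; the difference of powers is of order `n^(-5/2)` and absorbs it. -/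
lemma succ_mul_rpow_sub_le {n : ℕ} (hn : 0 < n) :
    ((n : ℝ) + 1) * ((n : ℝ) ^ (-(3 / 2) : ℝ) - ((n : ℝ) + 1) ^ (-(3 / 2) : ℝ)) ≤
      2 * (n : ℝ) ^ (-(3 / 2) : ℝ) := by
  have hn' : (0 : ℝ) < n := by exact_mod_cast hn
  rw [rpow_neg_three_halves_eq hn', rpow_neg_three_halves_eq (by positivity)]
  set s := √(n : ℝ)
  set t := √((n : ℝ) + 1)
  have hs : 0 < s := Real.sqrt_pos.2 hn'
  have ht : 0 < t := Real.sqrt_pos.2 (by positivity)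
  have hs2 : (n : ℝ) = s * s := (Real.mul_self_sqrt hn'.le).symm
  have ht2 : s * s + 1 = t * t := by rw [← hs2]; exact (Real.mul_self_sqrt (by positivity)).symm
  rw [hs2, ht2]
  have hst : s ≤ t := by nlinarith
  have e : t * t * (1 / (s * s * s) - 1 / (t * t * t)) = t * t / (s * s * s) - 1 / t := by
    field_simp
  rw [e, mul_one_div, sub_le_iff_le_add, div_add_div _ _ (by positivity) (by positivity),
    div_le_div_iff₀ (by positivity) (by positivity)]
  have : t * t * t ≤ 2 * t + s * s * s := by
    have h1 : t * (t * t) = t * (s * s + 1) := by rw [ht2]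
    have h2 : s * s * (t - s) ≤ t := by nlinarith [mul_pos hs ht]
    nlinarith
  nlinarith [mul_le_mul_of_nonneg_left this (by positivity : 0 ≤ s * s * s)]

/-- Periodic coefficients of sum zero have bounded partial sums. Abel summation moves the difference
onto `n^(-3/2) (1 - exp (iθn))`, whose increments are `θ` times a summable sequence, so the whole
sum is `O(θ)`, hence `o(√θ)`. -/
lemma tendsto_oscillation_of_periodic {d : ℕ} [NeZero d] {c : ZMod d → ℝ} (hc : ∑ r, c r = 0) :
    Tendsto (fun θ : ℝ => (∑' n : ℕ, (((n : ℝ) ^ (-(3 / 2) : ℝ) * c (n : ZMod d) : ℝ) : ℂ) *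
      (1 - Complex.exp ((θ * n : ℝ) * Complex.I))) / (√θ : ℂ)) (𝓝[>] 0) (𝓝 0) := by
  obtain ⟨K, hK, hKc⟩ := exists_bound_sum_range_periodic hc
  obtain ⟨B, hB, hBc⟩ := exists_bound_zmod c
  have hsum : Summable fun n : ℕ => (n : ℝ) ^ (-(3 / 2) : ℝ) :=
    Real.summable_nat_rpow.2 (by norm_num)
  -- The `3` is `1` from the increment of the exponential and `2` from `succ_mul_rpow_sub_le`. Since
  -- `0 ^ (-3/2)` is `0` here, the increment from `0` to `1` needs the extra `1` at `n = 0`.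
  let v : ℕ → ℝ := fun n => 3 * (n : ℝ) ^ (-(3 / 2) : ℝ) + if n = 0 then 1 else 0
  have hv0 : ∀ n, 0 ≤ v n := fun n => by simp only [v]; positivity
  have hv : Summable v := (hsum.mul_left 3).add
    (summable_of_ne_finset_zero (s := {0}) fun n hn => by
      rw [if_neg (by simpa using hn)])
  have hbound : ∀ θ : ℝ, 0 < θ → ‖∑' n : ℕ, (((n : ℝ) ^ (-(3 / 2) : ℝ) * c (n : ZMod d) : ℝ) : ℂ) *
      (1 - Complex.exp ((θ * n : ℝ) * Complex.I))‖ ≤ K * (1 + ∑' n, v n) * θ := by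
    intro θ hθ
    let u : ℕ → ℂ := fun n => (((n : ℝ) ^ (-(3 / 2) : ℝ) : ℝ) : ℂ) *
      (1 - Complex.exp ((θ * n : ℝ) * Complex.I))
    have hs : Summable fun n : ℕ => (((n : ℝ) ^ (-(3 / 2) : ℝ) * c (n : ZMod d) : ℝ) : ℂ) *
        (1 - Complex.exp ((θ * n : ℝ) * Complex.I)) := by
      refine Summable.of_norm_bounded (hsum.mul_right (B * 2)) fun n => ?_
      rw [norm_mul, Complex.norm_real, norm_mul, mul_assoc, Real.norm_eq_abs,
        abs_of_nonneg (by positivity)]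
      refine mul_le_mul_of_nonneg_left ?_ (by positivity)
      exact mul_le_mul (hBc _) (norm_one_sub_exp_le_two _ _) (norm_nonneg _) hB
    refine le_of_tendsto hs.hasSum.tendsto_sum_nat.norm (Eventually.of_forall fun N => ?_)
    have hu : ∀ n, ‖u (n + 1) - u n‖ ≤ θ * v n := by
      intro n
      rcases Nat.eq_zero_or_pos n with rfl | hn
      · have h1 := norm_one_sub_exp_le θ 1
        simp only [u, v, if_true]
        rw [abs_of_pos hθ] at h1
        simpa using h1
      · have hn' : (0 : ℝ) < n := by exact_mod_cast hn
        have e : u (n + 1) - u n = (((n : ℝ) ^ (-(3 / 2) : ℝ) : ℝ) : ℂ) *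
            (Complex.exp ((θ * n : ℝ) * Complex.I) *
              (1 - Complex.exp ((θ * (1 : ℕ) : ℝ) * Complex.I))) -
            (((n : ℝ) ^ (-(3 / 2) : ℝ) - ((n : ℝ) + 1) ^ (-(3 / 2) : ℝ) : ℝ) : ℂ) *
              (1 - Complex.exp ((θ * (n + 1 : ℕ) : ℝ) * Complex.I)) := by
          have : Complex.exp ((θ * (n + 1 : ℕ) : ℝ) * Complex.I) =
              Complex.exp ((θ * n : ℝ) * Complex.I) *
                Complex.exp ((θ * (1 : ℕ) : ℝ) * Complex.I) := by
            rw [← Complex.exp_add]; congr 1; push_cast; ring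
          simp only [u]
          rw [this]
          push_cast
          ring
        rw [e]
        have hmono : ((n : ℝ) + 1) ^ (-(3 / 2) : ℝ) ≤ (n : ℝ) ^ (-(3 / 2) : ℝ) :=
          Real.rpow_le_rpow_of_nonpos hn' (by linarith) (by norm_num)
        refine (norm_sub_le _ _).trans ?_
        rw [norm_mul, norm_mul, norm_mul, Complex.norm_real, Complex.norm_real,
          Complex.norm_exp_ofReal_mul_I, one_mul, Real.norm_eq_abs, Real.norm_eq_abs,
          abs_of_nonneg (by positivity), abs_of_nonneg (sub_nonneg.2 hmono)]
        have h1 := norm_one_sub_exp_le θ 1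
        have h2 := norm_one_sub_exp_le θ (n + 1)
        rw [abs_of_pos hθ] at h1 h2
        have h3 := mul_le_mul_of_nonneg_left h1
          (by positivity : (0 : ℝ) ≤ (n : ℝ) ^ (-(3 / 2) : ℝ))
        have h4 := mul_le_mul_of_nonneg_left h2 (sub_nonneg.2 hmono)
        have h5 := mul_le_mul_of_nonneg_left (succ_mul_rpow_sub_le hn) hθ.le
        simp only [v]
        rw [if_neg hn.ne', add_zero]
        push_cast at h3 h4 ⊢
        nlinarith
    have huN : ‖u N‖ ≤ θ := by
      rcases Nat.eq_zero_or_pos N with rfl | hn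
      · simp [u, hθ.le]
      · have hn' : (1 : ℝ) ≤ N := by exact_mod_cast hn
        simp only [u]
        rw [norm_mul, Complex.norm_real, Real.norm_eq_abs, abs_of_nonneg (by positivity)]
        have h1 := norm_one_sub_exp_le θ N
        rw [abs_of_pos hθ] at h1
        have h2 : (N : ℝ) ^ (-(3 / 2) : ℝ) ≤ (N : ℝ)⁻¹ := by
          rw [← Real.rpow_neg_one]
          exact Real.rpow_le_rpow_of_exponent_le hn' (by norm_num)
        calc _ ≤ (N : ℝ)⁻¹ * (θ * N) := mul_le_mul h2 h1 (norm_nonneg _) (by positivity)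
          _ = θ := by field_simp
    have hCn : ∀ n : ℕ, ‖∑ k ∈ Finset.range n, ((c (k : ZMod d) : ℝ) : ℂ)‖ ≤ K := fun n => by
      rw [← Complex.ofReal_sum, Complex.norm_real]
      exact hKc n
    have e : ∀ n : ℕ, (((n : ℝ) ^ (-(3 / 2) : ℝ) * c (n : ZMod d) : ℝ) : ℂ) *
        (1 - Complex.exp ((θ * n : ℝ) * Complex.I)) = ((c (n : ZMod d) : ℝ) : ℂ) * u n := by
      intro n; simp only [u]; push_cast; ring
    simp_rw [e]
    rw [sum_range_mul_eq_by_parts]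
    calc _ ≤ K * θ + ∑ n ∈ Finset.range N, K * (θ * v n) := by
          refine (norm_sub_le _ _).trans (add_le_add ?_ ((norm_sum_le _ _).trans
            (Finset.sum_le_sum fun n _ => ?_)))
          · rw [norm_mul]; exact mul_le_mul (hCn _) huN (norm_nonneg _) hK
          · rw [norm_mul]; exact mul_le_mul (hCn _) (hu n) (norm_nonneg _) hK
      _ = K * (1 + ∑ n ∈ Finset.range N, v n) * θ := by
          rw [← Finset.mul_sum, ← Finset.mul_sum]; ring
      _ ≤ _ := by
          have := hv.sum_le_tsum (Finset.range N) fun n _ => hv0 n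
          gcongr
  have hlim : Tendsto (fun θ : ℝ => K * (1 + ∑' n, v n) * √θ) (𝓝[>] 0) (𝓝 0) := by
    have : ContinuousAt (fun θ : ℝ => K * (1 + ∑' n, v n) * √θ) 0 := by fun_prop
    have h2 := this.tendsto
    simp only [Real.sqrt_zero, mul_zero] at h2
    exact h2.mono_left nhdsWithin_le_nhds
  refine squeeze_zero_norm' ?_ hlim
  filter_upwards [self_mem_nhdsWithin] with θ hθ
  have hθ : 0 < θ := hθ
  have hr : 0 < √θ := Real.sqrt_pos.2 hθ
  rw [norm_div, Complex.norm_real, Real.norm_eq_abs, abs_of_pos hr, div_le_iff₀ hr, mul_assoc,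
    Real.mul_self_sqrt hθ.le]
  exact hbound θ hθ

lemma summable_mul_one_sub_exp {e : ℕ → ℝ} (he : Summable fun n => |e n|) (θ : ℝ) :
    Summable fun n : ℕ => (e n : ℂ) * (1 - Complex.exp ((θ * n : ℝ) * Complex.I)) :=
  Summable.of_norm_bounded (he.mul_right 2) fun n => by
    rw [norm_mul, Complex.norm_real]
    exact mul_le_mul_of_nonneg_left (norm_one_sub_exp_le_two _ _) (abs_nonneg _)

lemma AsympPeriodic.tendsto_oscillation_zero {d : ℕ} [NeZero d] {e : ℕ → ℝ} {c : ZMod d → ℝ}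
    (he : AsympPeriodic d (3 / 2) e c) (hc : ∑ r, c r = 0) :
    Tendsto (fun θ : ℝ => (∑' n : ℕ, (e n : ℂ) * (1 - Complex.exp ((θ * n : ℝ) * Complex.I))) /
      (√θ : ℂ)) (𝓝[>] 0) (𝓝 0) := by
  obtain ⟨K, -, hK⟩ := he.exists_bound
  have hes := summable_of_rpow_bound hK
  obtain ⟨B, hB, hBc⟩ := exists_bound_zmod c
  have hvs : Summable fun n : ℕ => |(n : ℝ) ^ (-(3 / 2) : ℝ) * c (n : ZMod d)| := by
    refine Summable.of_nonneg_of_le (fun n => abs_nonneg _) (fun n => ?_)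
      ((Real.summable_nat_rpow.2 (by norm_num : (-(3 / 2) : ℝ) < -1)).mul_right B)
    rw [abs_mul, abs_of_nonneg (a := (n : ℝ) ^ (-(3 / 2) : ℝ)) (by positivity)]
    exact mul_le_mul_of_nonneg_left (hBc _) (by positivity)
  have h1 : Tendsto (fun n : ℕ => (n : ℝ) ^ (3 / 2 : ℝ) *
      (e n - (n : ℝ) ^ (-(3 / 2) : ℝ) * c (n : ZMod d))) atTop (𝓝 0) := by
    refine Tendsto.congr' ?_ he
    filter_upwards [eventually_gt_atTop 0] with n hn
    have hn' : (0 : ℝ) < n := by exact_mod_cast hn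
    rw [mul_sub, ← mul_assoc, ← Real.rpow_add hn']
    norm_num
  have h2 := (tendsto_oscillation_of_isLittleO h1).add (tendsto_oscillation_of_periodic hc)
  rw [add_zero] at h2
  refine h2.congr fun θ => ?_
  have hds : Summable fun n : ℕ => |e n - (n : ℝ) ^ (-(3 / 2) : ℝ) * c (n : ZMod d)| :=
    Summable.of_nonneg_of_le (fun n => abs_nonneg _) (fun n => abs_sub _ _) (hes.add hvs)
  rw [← add_div, ← (summable_mul_one_sub_exp hds θ).tsum_add (summable_mul_one_sub_exp hvs θ)]
  congr 2
  funext n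
  push_cast
  ring

/-- Two sequences with periodic local asymptotics have proportional characteristic function
asymptotics at the origin. -/
lemma AsympPeriodic.tendsto_oscillation {d : ℕ} [NeZero d] {a b : ℕ → ℝ} {ca cb : ZMod d → ℝ}
    (ha : AsympPeriodic d (3 / 2) a ca) (hb : AsympPeriodic d (3 / 2) b cb)
    (hcb : ∑ r, cb r ≠ 0) {L : ℂ}
    (hL : Tendsto (fun θ : ℝ => (∑' n : ℕ, (b n : ℂ) *
      (1 - Complex.exp ((θ * n : ℝ) * Complex.I))) / (√θ : ℂ)) (𝓝[>] 0) (𝓝 L)) :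
    Tendsto (fun θ : ℝ => (∑' n : ℕ, (a n : ℂ) *
      (1 - Complex.exp ((θ * n : ℝ) * Complex.I))) / (√θ : ℂ)) (𝓝[>] 0)
      (𝓝 (((∑ r, ca r) / (∑ r, cb r) : ℝ) * L)) := by
  -- This choice makes the periodic limit of `a - ρ b` sum to zero over a period, so that difference
  -- oscillates as `o(√θ)`.
  set ρ := (∑ r, ca r) / (∑ r, cb r)
  have he := ha.sub (hb.const_mul ρ)
  have hc : ∑ r, (ca r - ρ * cb r) = 0 := by
    rw [Finset.sum_sub_distrib, ← Finset.mul_sum, div_mul_cancel₀ _ hcb, sub_self]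
  have h := (he.tendsto_oscillation_zero hc).add (hL.const_mul (ρ : ℂ))
  rw [zero_add] at h
  refine h.congr fun θ => ?_
  obtain ⟨K, -, hK⟩ := he.exists_bound
  obtain ⟨K', -, hK'⟩ := hb.exists_bound
  rw [mul_div_assoc', ← add_div, ← tsum_mul_left, ← (summable_mul_one_sub_exp
    (summable_of_rpow_bound hK) θ).tsum_add
    ((summable_mul_one_sub_exp (summable_of_rpow_bound hK') θ).mul_left _)]
  congr 2
  funext n
  push_cast
  ring

end Oscillation

/-! ### The Laplace transform of a step and its root near the origin. -/

/-- The Laplace transform `∑ f x * exp (l x)` of a finitely supported mass function. -/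
noncomputable def laplace (l : ℂ) : AddMonoidAlgebra ℝ ℝ →ₐ[ℝ] ℂ :=
  AddMonoidAlgebra.lift ℝ ℂ ℝ
    { toFun := fun x => Complex.exp (l * (Multiplicative.toAdd x : ℝ))
      map_one' := by simp
      map_mul' := fun x y => by
        rw [← Complex.exp_add, toAdd_mul]
        push_cast
        ring_nf }

/-- Centred, nondegenerate, finitely supported probability mass functions. -/
structure IsStepMass (p : AddMonoidAlgebra ℝ ℝ) : Prop where
  nonneg : ∀ x, 0 ≤ p.coeff x
  sum_eq_one : ∑ x ∈ p.coeff.support, p.coeff x = 1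
  mean_eq_zero : ∑ x ∈ p.coeff.support, p.coeff x * x = 0
  variance_pos : 0 < ∑ x ∈ p.coeff.support, p.coeff x * x ^ 2

/-- The second moment of a mass function. -/
noncomputable def secondMoment (p : AddMonoidAlgebra ℝ ℝ) : ℝ :=
  ∑ x ∈ p.coeff.support, p.coeff x * x ^ 2

/-- The entire function `(exp z - 1 - z) / z ^ 2`. -/
noncomputable def expRemainder : ℂ → ℂ := dslope (dslope Complex.exp 0) 0

section Laplace

variable {p : AddMonoidAlgebra ℝ ℝ}

lemma laplace_eq_sum (l : ℂ) (f : AddMonoidAlgebra ℝ ℝ) :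
    laplace l f = ∑ x ∈ f.coeff.support, (f.coeff x : ℂ) * Complex.exp (l * x) := by
  rw [laplace, AddMonoidAlgebra.lift_apply, Finsupp.sum]
  simp

lemma differentiable_expRemainder : Differentiable ℂ expRemainder := by
  rw [← differentiableOn_univ, expRemainder, Complex.differentiableOn_dslope univ_mem,
    Complex.differentiableOn_dslope univ_mem, differentiableOn_univ]
  exact Complex.differentiable_exp

lemma sq_mul_expRemainder (z : ℂ) : z ^ 2 * expRemainder z = Complex.exp z - 1 - z := by
  have h1 := sub_smul_dslope (dslope Complex.exp 0) 0 z
  have h2 := sub_smul_dslope Complex.exp 0 z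
  simp only [sub_zero, smul_eq_mul, Complex.exp_zero, dslope_same] at h1 h2
  rw [(Complex.hasDerivAt_exp 0).deriv, Complex.exp_zero] at h1
  rw [expRemainder, sq, mul_assoc, h1, mul_sub, h2, mul_one]

lemma expRemainder_zero : expRemainder 0 = 1 / 2 := by
  have h1 : Tendsto expRemainder (𝓝[≠] 0) (𝓝 (expRemainder 0)) :=
    (differentiable_expRemainder.continuous.tendsto 0).mono_left nhdsWithin_le_nhds
  refine tendsto_nhds_unique h1 ?_
  rw [tendsto_iff_norm_sub_tendsto_zero]
  have h2 : Tendsto (fun z : ℂ => ‖z‖ * Real.exp ‖z‖) (𝓝[≠] 0) (𝓝 0) := by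
    have : Continuous fun z : ℂ => ‖z‖ * Real.exp ‖z‖ := by fun_prop
    have h3 := this.tendsto 0
    simp only [norm_zero, zero_mul] at h3
    exact h3.mono_left nhdsWithin_le_nhds
  refine squeeze_zero' (Eventually.of_forall fun z => norm_nonneg _) ?_ h2
  filter_upwards [self_mem_nhdsWithin] with z hz
  have hz : z ≠ 0 := hz
  have h3 := Complex.norm_exp_sub_sum_le_norm_mul_exp z 3
  have h4 : Complex.exp z - ∑ m ∈ Finset.range 3, z ^ m / (m.factorial : ℂ) =
      z ^ 2 * (expRemainder z - 1 / 2) := by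
    rw [mul_sub, sq_mul_expRemainder]
    simp [Finset.sum_range_succ, Nat.factorial]
    ring
  rw [h4, norm_mul, norm_pow] at h3
  have hz' : 0 < ‖z‖ ^ 2 := by positivity
  refine le_of_mul_le_mul_left ?_ hz'
  linarith [h3]

/-- The entire function `k` with `laplace l p = 1 + l ^ 2 * k l`. -/
noncomputable def laplaceRemainder (p : AddMonoidAlgebra ℝ ℝ) (l : ℂ) : ℂ :=
  ∑ x ∈ p.coeff.support, (p.coeff x * x ^ 2 : ℝ) * expRemainder (l * x)

lemma differentiable_laplaceRemainder (p : AddMonoidAlgebra ℝ ℝ) :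
    Differentiable ℂ (laplaceRemainder p) := by
  unfold laplaceRemainder
  refine Differentiable.fun_sum fun x _ => ?_
  exact (differentiable_const _).mul (differentiable_expRemainder.comp
    (differentiable_id.mul_const _))

lemma laplaceRemainder_zero (p : AddMonoidAlgebra ℝ ℝ) :
    laplaceRemainder p 0 = (secondMoment p / 2 : ℝ) := by
  simp only [laplaceRemainder, zero_mul, expRemainder_zero, secondMoment]
  rw [← Finset.sum_mul]
  push_cast
  ring

lemma IsStepMass.laplace_eq (hp : IsStepMass p) (l : ℂ) :
    laplace l p = 1 + l ^ 2 * laplaceRemainder p l := by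
  have h1 : (∑ x ∈ p.coeff.support, (p.coeff x : ℂ)) = 1 := by exact_mod_cast hp.sum_eq_one
  have h2 : (∑ x ∈ p.coeff.support, (p.coeff x : ℂ) * (x : ℂ)) = 0 := by
    exact_mod_cast hp.mean_eq_zero
  have h3 : ∀ x : ℝ, (p.coeff x : ℂ) * Complex.exp (l * x) = (p.coeff x : ℂ) +
      l * ((p.coeff x : ℂ) * (x : ℂ)) + l ^ 2 * ((p.coeff x * x ^ 2 : ℝ) * expRemainder (l * x)) := by
    intro x
    have := sq_mul_expRemainder (l * x)
    push_cast
    linear_combination -(p.coeff x : ℂ) * this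
  rw [laplace_eq_sum, Finset.sum_congr rfl fun x _ => h3 x, Finset.sum_add_distrib,
    Finset.sum_add_distrib, h1, ← Finset.mul_sum, h2, mul_zero, add_zero, ← Finset.mul_sum,
    laplaceRemainder]

/-- With `k` the remainder function, the equation reads `l² k(l) = exp (-iθ) - 1`. The map `ψ(l) = l
√k(l)` is analytic near `0` with nonzero derivative, so it has a local inverse `η`. Taking `l =
η(w)` for a square root `w` of `exp (-iθ) - 1` solves the equation, and `w ~ √θ (1 - i) / √2` gives
the asymptotics. Here `σ` denotes the variance. -/
lemma IsStepMass.exists_laplace_root (hp : IsStepMass p) :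
    ∃ l : ℝ → ℂ, (∀ᶠ θ in 𝓝[>] (0 : ℝ), laplace (l θ) p = Complex.exp (-(θ * Complex.I)) ∧
      0 < (l θ).re) ∧
      Tendsto (fun θ : ℝ => l θ / (√θ : ℂ)) (𝓝[>] 0)
        (𝓝 ((1 / √(secondMoment p) : ℝ) * (1 - Complex.I))) := by
  set σ := secondMoment p
  have hσ : 0 < σ := hp.variance_pos
  set k := laplaceRemainder p
  have hk0 : k 0 = (σ / 2 : ℝ) := laplaceRemainder_zero p
  have hkd : Differentiable ℂ k := differentiable_laplaceRemainder p
  have hslit : k 0 ∈ Complex.slitPlane := by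
    rw [hk0]; exact Complex.ofReal_mem_slitPlane.2 (by positivity)
  let ψ : ℂ → ℂ := fun l => l * Complex.exp (Complex.log (k l) / 2)
  have hψa : AnalyticAt ℂ ψ 0 := by
    have hka : AnalyticAt ℂ k 0 := hkd.analyticAt 0
    exact analyticAt_id.mul ((hka.clog hslit).div_const.cexp)
  have hψ0 : ψ 0 = 0 := by simp [ψ]
  have hs : Complex.exp (Complex.log (k 0) / 2) = (√(σ / 2) : ℝ) := by
    rw [hk0, ← Complex.ofReal_log (by positivity), Real.sqrt_eq_rpow,
      Real.rpow_def_of_pos (by positivity)]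
    push_cast
    ring_nf
  have hder : HasStrictDerivAt ψ ((√(σ / 2) : ℝ) : ℂ) 0 := by
    have h1 := hψa.hasStrictDerivAt
    have h2 : deriv ψ 0 = ((√(σ / 2) : ℝ) : ℂ) := by
      have hg : DifferentiableAt ℂ (fun l => Complex.exp (Complex.log (k l) / 2)) 0 :=
        ((hkd.analyticAt 0).clog hslit).div_const.cexp.differentiableAt
      have h3 := (hasDerivAt_id (0 : ℂ)).mul hg.hasDerivAt
      simp only [id, one_mul, zero_mul, add_zero, hs] at h3
      exact h3.deriv
    rwa [h2] at h1
  have hne : ((√(σ / 2) : ℝ) : ℂ) ≠ 0 := by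
    exact_mod_cast (Real.sqrt_pos.2 (by positivity)).ne'
  set η := hder.localInverse ψ _ 0 hne
  have hη0 : η 0 = 0 := by
    have := (hder.eventually_left_inverse hne).self_of_nhds
    rwa [hψ0] at this
  have hηd : HasDerivAt η (((√(σ / 2) : ℝ) : ℂ)⁻¹) 0 := by
    have := hder.to_localInverse hne
    rw [hψ0] at this
    exact this.hasDerivAt
  have hsq : ∀ᶠ w in 𝓝 (0 : ℂ), (η w) ^ 2 * k (η w) = w ^ 2 := by
    have h1 := hder.eventually_right_inverse hne
    rw [hψ0] at h1
    have h2 : ∀ᶠ w in 𝓝 (0 : ℂ), k (η w) ≠ 0 := by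
      have : ContinuousAt (fun w => k (η w)) 0 :=
        ContinuousAt.comp (g := k) (hkd.continuous.continuousAt) hηd.continuousAt
      refine this.eventually_ne ?_
      simp only [hη0]
      exact Complex.slitPlane_ne_zero hslit
    filter_upwards [h1, h2] with w hw hkw
    have h3 : Complex.exp (Complex.log (k (η w)) / 2) ^ 2 = k (η w) := by
      rw [← Complex.exp_nat_mul]
      rw [show ((2 : ℕ) : ℂ) * (Complex.log (k (η w)) / 2) = Complex.log (k (η w)) by
        push_cast; ring, Complex.exp_log hkw]
    rw [← h3, ← mul_pow]
    exact congrArg (· ^ 2) hw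
  let ρ : ℝ → ℂ := fun θ => (Complex.exp (-(θ * Complex.I)) - 1) / (-(θ * Complex.I))
  have hρ : Tendsto ρ (𝓝[>] 0) (𝓝 1) := by
    have h1 : Tendsto (fun θ : ℝ => (-(θ * Complex.I) : ℂ)) (𝓝[>] 0) (𝓝[≠] 0) := by
      refine tendsto_nhdsWithin_iff.2 ⟨?_, ?_⟩
      · have : Continuous fun θ : ℝ => (-(θ * Complex.I) : ℂ) := by fun_prop
        have h2 := this.tendsto 0
        simp only [Complex.ofReal_zero, zero_mul, neg_zero] at h2
        exact h2.mono_left nhdsWithin_le_nhds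
      · filter_upwards [self_mem_nhdsWithin] with θ hθ
        have : (θ : ℂ) ≠ 0 := by exact_mod_cast (Set.mem_Ioi.1 hθ).ne'
        simp [this]
    have h2 := (hasDerivAt_iff_tendsto_slope_zero.1 (Complex.hasDerivAt_exp 0)).comp h1
    simp only [Complex.exp_zero, zero_add] at h2
    refine h2.congr fun θ => ?_
    simp only [Function.comp_apply, smul_eq_mul, ρ]
    rw [div_eq_inv_mul]
  let s : ℝ → ℂ := fun θ => Complex.exp (Complex.log (ρ θ) / 2)
  have hs1 : Tendsto s (𝓝[>] 0) (𝓝 1) := by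
    have h1 : ContinuousAt (fun z => Complex.exp (Complex.log z / 2)) 1 := by
      have := continuousAt_clog (x := 1) (by simp)
      fun_prop
    have h2 := h1.tendsto.comp hρ
    simp only [Complex.log_one, zero_div, Complex.exp_zero] at h2
    exact h2
  -- Of the two square roots of `-i`, `(1 - i) / √2` is the one with positive real part. That choice
  -- makes `Re l > 0`, as required for `exp (l S_n)` to be bounded while the walk is bounded above.
  let w : ℝ → ℂ := fun θ => (√θ : ℂ) * (((1 / √2 : ℝ) : ℂ) * (1 - Complex.I) * s θ)
  have hr2 : (((1 / √2 : ℝ) : ℂ) * (1 - Complex.I)) ^ 2 = -Complex.I := by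
    have : ((1 / √2 : ℝ) : ℂ) ^ 2 = 1 / 2 := by
      rw [← Complex.ofReal_pow, div_pow, Real.sq_sqrt (by norm_num)]
      norm_num
    rw [mul_pow, this]
    linear_combination (1 / 2 : ℂ) * Complex.I_sq
  have hw2 : ∀ᶠ θ in 𝓝[>] (0 : ℝ), w θ ^ 2 = Complex.exp (-(θ * Complex.I)) - 1 := by
    filter_upwards [hρ.eventually_ne one_ne_zero, self_mem_nhdsWithin] with θ hρθ hθ
    have hθ : 0 < θ := hθ
    have h3 : s θ ^ 2 = ρ θ := by
      rw [← Complex.exp_nat_mul]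
      rw [show ((2 : ℕ) : ℂ) * (Complex.log (ρ θ) / 2) = Complex.log (ρ θ) by
        push_cast; ring, Complex.exp_log hρθ]
    have h4 : (√θ : ℂ) ^ 2 = θ := by
      rw [← Complex.ofReal_pow, Real.sq_sqrt hθ.le]
    have h5 : (-(θ * Complex.I) : ℂ) ≠ 0 := by
      have : (θ : ℂ) ≠ 0 := by exact_mod_cast hθ.ne'
      simp [this]
    simp only [w]
    rw [mul_pow, mul_pow, h3, h4, hr2]
    simp only [ρ]
    rw [← mul_assoc, show (θ : ℂ) * -Complex.I = -(θ * Complex.I) by ring,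
      mul_div_cancel₀ _ h5]
  have hwdiv : Tendsto (fun θ : ℝ => w θ / (√θ : ℂ)) (𝓝[>] 0)
      (𝓝 (((1 / √2 : ℝ) : ℂ) * (1 - Complex.I))) := by
    have := hs1.const_mul (((1 / √2 : ℝ) : ℂ) * (1 - Complex.I))
    rw [mul_one] at this
    refine this.congr' ?_
    filter_upwards [self_mem_nhdsWithin] with θ hθ
    have h6 : (√θ : ℂ) ≠ 0 := by exact_mod_cast (Real.sqrt_pos.2 (Set.mem_Ioi.1 hθ)).ne'
    simp only [w]
    rw [mul_div_cancel_left₀ _ h6]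
  have hsqrt : Tendsto (fun θ : ℝ => (√θ : ℂ)) (𝓝[>] 0) (𝓝 0) := by
    have : Continuous fun θ : ℝ => (√θ : ℂ) := by fun_prop
    have h2 := this.tendsto 0
    simp only [Real.sqrt_zero, Complex.ofReal_zero] at h2
    exact h2.mono_left nhdsWithin_le_nhds
  have hw0 : Tendsto w (𝓝[>] 0) (𝓝 0) := by
    have := hsqrt.mul (hs1.const_mul (((1 / √2 : ℝ) : ℂ) * (1 - Complex.I)))
    rwa [zero_mul] at this
  have hlim : Tendsto (fun θ : ℝ => η (w θ) / (√θ : ℂ)) (𝓝[>] 0)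
      (𝓝 ((1 / √σ : ℝ) * (1 - Complex.I))) := by
    have h1 : Tendsto (dslope η 0) (𝓝 0) (𝓝 (((√(σ / 2) : ℝ) : ℂ)⁻¹)) := by
      have := (continuousAt_dslope_same.2 hηd.differentiableAt).tendsto
      rwa [dslope_same, hηd.deriv] at this
    have h2 := (h1.comp hw0).mul hwdiv
    have h3 : (((√(σ / 2) : ℝ) : ℂ)⁻¹) * (((1 / √2 : ℝ) : ℂ) * (1 - Complex.I)) =
        (1 / √σ : ℝ) * (1 - Complex.I) := by
      rw [← mul_assoc, ← Complex.ofReal_inv, ← Complex.ofReal_mul]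
      congr 2
      rw [Real.sqrt_div hσ.le]
      have : √σ ≠ 0 := (Real.sqrt_pos.2 hσ).ne'
      field_simp
    rw [h3] at h2
    refine h2.congr fun θ => ?_
    have h4 := sub_smul_dslope η 0 (w θ)
    rw [sub_zero, hη0, sub_zero, smul_eq_mul] at h4
    simp only [Function.comp_apply]
    rw [← h4]
    ring
  refine ⟨fun θ => η (w θ), ?_, hlim⟩
  have hre : ∀ᶠ θ in 𝓝[>] (0 : ℝ), 0 < (η (w θ) / (√θ : ℂ)).re := by
    have h1 := (Complex.continuous_re.tendsto _).comp hlim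
    refine h1.eventually (lt_mem_nhds ?_)
    rw [Complex.re_ofReal_mul]
    simp [hσ]
  filter_upwards [hw0.eventually hsq, hw2, hre, self_mem_nhdsWithin] with θ h1 h2 h3 hθ
  refine ⟨?_, ?_⟩
  · rw [hp.laplace_eq, h1, h2]; ring
  · rw [Complex.div_ofReal_re] at h3
    exact (div_pos_iff_of_pos_right (Real.sqrt_pos.2 hθ)).1 h3

end Laplace

/-! ### The local limit theorem on a lattice. -/

/-- The subgroup generated by the differences of possible steps. -/
def diffGroup (p : AddMonoidAlgebra ℝ ℝ) : AddSubgroup ℝ :=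
  AddSubgroup.closure {z | ∃ x ∈ p.coeff.support, ∃ x' ∈ p.coeff.support, z = x - x'}

section LocalLimit

variable {p : AddMonoidAlgebra ℝ ℝ} {x₁ g : ℝ}

lemma supportedIn_self (hx₁ : x₁ ∈ p.coeff.support) :
    SupportedIn {z | z - x₁ ∈ diffGroup p} p := fun z hz => by
  by_contra h
  exact hz (AddSubgroup.subset_closure ⟨z, by simpa using h, x₁, hx₁, rfl⟩)

lemma SupportedIn.mul_step (hx₁ : x₁ ∈ p.coeff.support) {n : ℕ} {f : AddMonoidAlgebra ℝ ℝ}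
    (hf : SupportedIn {z | z - n * x₁ ∈ diffGroup p} f) :
    SupportedIn {z | z - ((n + 1 : ℕ) : ℝ) * x₁ ∈ diffGroup p} (f * p) := by
  refine hf.mul (supportedIn_self hx₁) fun x hx y hy => ?_
  have := (diffGroup p).add_mem hx hy
  simp only [Set.mem_ofPred_eq]
  convert this using 1
  push_cast
  ring

lemma supportedIn_pow (hx₁ : x₁ ∈ p.coeff.support) (n : ℕ) :
    SupportedIn {z | z - n * x₁ ∈ diffGroup p} (p ^ n) := by
  induction n with
  | zero => simpa using supportedIn_one (by simp [(diffGroup p).zero_mem])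
  | succ n ih => rw [pow_succ]; exact ih.mul_step hx₁

lemma laplace_mul_I_eq (p : AddMonoidAlgebra ℝ ℝ) (t : ℝ) :
    laplace (t * Complex.I) p = ((∑ x ∈ p.coeff.support, p.coeff x * Real.cos (t * x) : ℝ) : ℂ) +
      ((∑ x ∈ p.coeff.support, p.coeff x * Real.sin (t * x) : ℝ) : ℂ) * Complex.I := by
  rw [laplace_eq_sum]
  push_cast
  rw [Finset.sum_mul, ← Finset.sum_add_distrib]
  refine Finset.sum_congr rfl fun x _ => ?_
  rw [show (t : ℂ) * Complex.I * x = ((t * x : ℝ) : ℂ) * Complex.I by push_cast; ring,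
    Complex.exp_mul_I]
  push_cast
  ring

lemma continuous_laplace_mul_I (p : AddMonoidAlgebra ℝ ℝ) :
    Continuous fun t : ℝ => laplace (t * Complex.I) p := by
  simp_rw [laplace_eq_sum]
  fun_prop

lemma two_mul_sin_sq_eq (v : ℝ) : 1 - Real.cos v = v ^ 2 / 2 * Real.sinc (v / 2) ^ 2 := by
  have h1 : Real.cos v = 1 - 2 * Real.sin (v / 2) ^ 2 := by
    have := Real.cos_two_mul (v / 2)
    rw [show 2 * (v / 2) = v by ring] at this
    nlinarith [Real.sin_sq_add_cos_sq (v / 2)]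
  rcases eq_or_ne v 0 with rfl | hv
  · simp
  · rw [h1, Real.sinc_of_ne_zero (by positivity)]
    field_simp
    ring

/-- Symmetrisation: `|φ(t)|²` is the mean of `cos (t (X - X'))` for independent copies. Writing `1 -
cos` through `sinc` pulls out `t²` and leaves a factor that is continuous also at `t = 0`, so that
compactness gives a quadratic lower bound. -/
lemma IsStepMass.one_sub_norm_sq_laplace (hp : IsStepMass p) (t : ℝ) :
    1 - ‖laplace (t * Complex.I) p‖ ^ 2 = t ^ 2 * ∑ x ∈ p.coeff.support, ∑ x' ∈ p.coeff.support,
      p.coeff x * p.coeff x' * ((x - x') ^ 2 / 2) * Real.sinc (t * (x - x') / 2) ^ 2 := by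
  have h1 : ‖laplace (t * Complex.I) p‖ ^ 2 = ∑ x ∈ p.coeff.support, ∑ x' ∈ p.coeff.support,
      p.coeff x * p.coeff x' * Real.cos (t * (x - x')) := by
    rw [laplace_mul_I_eq, ← Complex.normSq_eq_norm_sq, Complex.normSq_add_mul_I, sq, sq,
      Finset.sum_mul_sum, Finset.sum_mul_sum, ← Finset.sum_add_distrib]
    refine Finset.sum_congr rfl fun x _ => ?_
    rw [← Finset.sum_add_distrib]
    refine Finset.sum_congr rfl fun x' _ => ?_
    rw [mul_sub, Real.cos_sub]
    ring
  have h2 : (1 : ℝ) = ∑ x ∈ p.coeff.support, ∑ x' ∈ p.coeff.support, p.coeff x * p.coeff x' := by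
    rw [← Finset.sum_mul_sum, hp.sum_eq_one, one_mul]
  rw [h1, h2, ← Finset.sum_sub_distrib, Finset.mul_sum]
  refine Finset.sum_congr rfl fun x _ => ?_
  rw [← Finset.sum_sub_distrib, Finset.mul_sum]
  refine Finset.sum_congr rfl fun x' _ => ?_
  have := two_mul_sin_sq_eq (t * (x - x'))
  linear_combination (p.coeff x * p.coeff x') * this

/-- The continuous factor `K` left after division by `t²` has no zero on `[-π/g, π/g]`. At a zero `t
≠ 0` every difference of steps, hence `g`, would be a multiple of `2π / t`, forcing `g |t| ≥ 2π`; at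
`t = 0` all steps would coincide. Its minimum therefore gives the constant, halved because the
estimate is for the square of the modulus. -/
lemma IsStepMass.exists_norm_laplace_le (hp : IsStepMass p) (hg : 0 < g)
    (hH : diffGroup p = AddSubgroup.zmultiples g) :
    ∃ c, 0 < c ∧ ∀ t : ℝ, |t| ≤ Real.pi / g →
      ‖laplace (t * Complex.I) p‖ ≤ Real.exp (-c * t ^ 2) := by
  let K : ℝ → ℝ := fun t => ∑ x ∈ p.coeff.support, ∑ x' ∈ p.coeff.support,
      p.coeff x * p.coeff x' * ((x - x') ^ 2 / 2) * Real.sinc (t * (x - x') / 2) ^ 2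
  have hKc : Continuous K := by
    have := Real.continuous_sinc
    refine continuous_finsetSum _ fun x _ => continuous_finsetSum _ fun x' _ => ?_
    exact continuous_const.mul ((this.comp (by fun_prop)).pow 2)
  have hterm : ∀ t x x', 0 ≤ p.coeff x * p.coeff x' * ((x - x') ^ 2 / 2) *
      Real.sinc (t * (x - x') / 2) ^ 2 := fun t x x' => by
    have := hp.nonneg x
    have := hp.nonneg x'
    positivity
  have hK0 : ∀ t, |t| ≤ Real.pi / g → 0 < K t := by
    intro t ht
    refine lt_of_le_of_ne (Finset.sum_nonneg fun x _ => Finset.sum_nonneg fun x' _ =>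
      hterm t x x') fun h0 => ?_
    have hall : ∀ x ∈ p.coeff.support, ∀ x' ∈ p.coeff.support,
        x = x' ∨ Real.sinc (t * (x - x') / 2) = 0 := by
      intro x hx x' hx'
      have h1 := (Finset.sum_eq_zero_iff_of_nonneg fun x _ => Finset.sum_nonneg fun x' _ =>
        hterm t x x').1 h0.symm x hx
      have h2 := (Finset.sum_eq_zero_iff_of_nonneg fun x' _ => hterm t x x').1 h1 x' hx'
      rcases mul_eq_zero.1 h2 with h3 | h3
      · left
        rcases mul_eq_zero.1 h3 with h4 | h4
        · exact absurd h4 (mul_ne_zero (by simpa using hx) (by simpa using hx'))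
        · have : (x - x') ^ 2 = 0 := by linarith
          exact sub_eq_zero.1 (pow_eq_zero_iff two_ne_zero |>.1 this)
      · right; exact pow_eq_zero_iff two_ne_zero |>.1 h3
    have hgm : g ∈ diffGroup p := by rw [hH]; exact AddSubgroup.mem_zmultiples g
    rcases eq_or_ne t 0 with rfl | ht0
    · have : diffGroup p ≤ ⊥ := by
        refine (AddSubgroup.closure_le _).2 ?_
        rintro z ⟨x, hx, x', hx', rfl⟩
        rcases hall x hx x' hx' with h | h
        · simp [h]
        · simp at h
      have := this hgm
      rw [AddSubgroup.mem_bot] at this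
      exact hg.ne' this
    · have : diffGroup p ≤ AddSubgroup.zmultiples (2 * Real.pi / t) := by
        refine (AddSubgroup.closure_le _).2 ?_
        rintro z ⟨x, hx, x', hx', rfl⟩
        rcases hall x hx x' hx' with h | h
        · simp [h]
        · by_cases hxx : x - x' = 0
          · rw [hxx]; exact (AddSubgroup.zmultiples _).zero_mem
          · have hne : t * (x - x') / 2 ≠ 0 := by
              have := mul_ne_zero ht0 hxx
              positivity
            rw [Real.sinc_of_ne_zero hne, div_eq_zero_iff, or_iff_left hne,
              Real.sin_eq_zero_iff] at h
            obtain ⟨m, hm⟩ := h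
            refine AddSubgroup.mem_zmultiples_iff.2 ⟨m, ?_⟩
            rw [zsmul_eq_mul]
            field_simp
            linarith
      obtain ⟨m, hm⟩ := AddSubgroup.mem_zmultiples_iff.1 (this hgm)
      rw [zsmul_eq_mul] at hm
      have hm0 : m ≠ 0 := by
        rintro rfl
        simp at hm
        exact hg.ne hm
      have h1 : g * |t| = |(m : ℝ)| * (2 * Real.pi) := by
        have : g * t = m * (2 * Real.pi) := by
          rw [← hm]; field_simp
        rw [← abs_of_pos hg, ← abs_mul, this, abs_mul, abs_of_pos Real.two_pi_pos]
      have h2 : (1 : ℝ) ≤ |(m : ℝ)| := by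
        exact_mod_cast Int.one_le_abs hm0
      have h3 : g * |t| ≤ Real.pi := by
        rw [le_div_iff₀ hg] at ht; linarith
      nlinarith [Real.pi_pos]
  have hcomp : IsCompact (Set.Icc (-(Real.pi / g)) (Real.pi / g)) := isCompact_Icc
  have hne : (Set.Icc (-(Real.pi / g)) (Real.pi / g)).Nonempty :=
    ⟨0, by have := Real.pi_pos; constructor <;> [(rw [neg_nonpos]; positivity); positivity]⟩
  obtain ⟨t₀, ht₀, hmin⟩ := hcomp.exists_isMinOn hne hKc.continuousOn
  refine ⟨K t₀ / 2, by have := hK0 t₀ (abs_le.2 ht₀); positivity, fun t ht => ?_⟩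
  have h1 : K t₀ ≤ K t := hmin (abs_le.1 ht)
  have h2 := hp.one_sub_norm_sq_laplace t
  change _ = t ^ 2 * K t at h2
  have h3 : ‖laplace (t * Complex.I) p‖ ^ 2 ≤ Real.exp (-(K t₀ / 2) * t ^ 2) ^ 2 := by
    rw [← Real.exp_nat_mul]
    have h4 := Real.add_one_le_exp (-(K t₀) * t ^ 2)
    have h5 := mul_le_mul_of_nonneg_left h1 (sq_nonneg t)
    rw [show ((2 : ℕ) : ℝ) * (-(K t₀ / 2) * t ^ 2) = -(K t₀) * t ^ 2 by push_cast; ring]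
    linarith
  exact le_of_sq_le_sq h3 (Real.exp_pos _).le

lemma integral_exp_lattice (hg : 0 < g) (m : ℤ) :
    ∫ t in (-(Real.pi / g))..(Real.pi / g), Complex.exp ((t : ℂ) * Complex.I * ((m * g : ℝ) : ℂ)) =
      if m = 0 then ((2 * Real.pi / g : ℝ) : ℂ) else 0 := by
  split_ifs with h
  · subst h
    simp
    ring
  · have hc : Complex.I * ((m * g : ℝ) : ℂ) ≠ 0 := by
      refine mul_ne_zero Complex.I_ne_zero ?_
      exact_mod_cast mul_ne_zero (Int.cast_ne_zero.2 h) hg.ne'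
    have h1 : ∀ t : ℝ, Complex.exp ((t : ℂ) * Complex.I * ((m * g : ℝ) : ℂ)) =
        Complex.exp (Complex.I * ((m * g : ℝ) : ℂ) * t) := fun t => by congr 1; ring
    simp_rw [h1]
    rw [integral_exp_mul_complex hc, div_eq_zero_iff]
    left
    have hg' : (g : ℂ) ≠ 0 := by exact_mod_cast hg.ne'
    have h2 : Complex.I * ((m * g : ℝ) : ℂ) * ((Real.pi / g : ℝ) : ℂ) =
        Complex.I * ((m * g : ℝ) : ℂ) * ((-(Real.pi / g) : ℝ) : ℂ) +
          m * (2 * Real.pi * Complex.I) := by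
      push_cast
      field_simp
      ring
    rw [h2, Complex.exp_add, Complex.exp_int_mul_two_pi_mul_I, mul_one, sub_self]

/-- Fourier inversion over one period. The support hypothesis confines the mass to the coset `x +
gℤ`, on which the characters are orthogonal. -/
lemma coeff_eq_integral (hg : 0 < g) {x : ℝ} {f : AddMonoidAlgebra ℝ ℝ}
    (hf : SupportedIn {z | z - x ∈ AddSubgroup.zmultiples g} f) :
    (f.coeff x : ℂ) = (g / (2 * Real.pi) : ℝ) * ∫ t in (-(Real.pi / g))..(Real.pi / g),
      laplace (t * Complex.I) f * Complex.exp (-(t * Complex.I * x)) := by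
  have h1 : ∀ t : ℝ, laplace (t * Complex.I) f * Complex.exp (-(t * Complex.I * x)) =
      ∑ z ∈ f.coeff.support, (f.coeff z : ℂ) * Complex.exp (t * Complex.I * ((z - x : ℝ) : ℂ)) := by
    intro t
    rw [laplace_eq_sum, Finset.sum_mul]
    refine Finset.sum_congr rfl fun z _ => ?_
    rw [mul_assoc, ← Complex.exp_add]
    push_cast
    ring_nf
  simp_rw [h1]
  rw [intervalIntegral.integral_finsetSum fun z _ => by
    apply Continuous.intervalIntegrable; fun_prop]
  have h2 : ∀ z ∈ f.coeff.support, ∫ t in (-(Real.pi / g))..(Real.pi / g),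
      (f.coeff z : ℂ) * Complex.exp ((t : ℂ) * Complex.I * ((z - x : ℝ) : ℂ)) =
      if z = x then (f.coeff x : ℂ) * ((2 * Real.pi / g : ℝ) : ℂ) else 0 := by
    intro z hz
    have hzx : z - x ∈ AddSubgroup.zmultiples g := by
      by_contra h; exact (Finsupp.mem_support_iff.1 hz) (hf z h)
    obtain ⟨m, hm⟩ := AddSubgroup.mem_zmultiples_iff.1 hzx
    rw [zsmul_eq_mul] at hm
    rw [intervalIntegral.integral_const_mul, ← hm, integral_exp_lattice hg]
    by_cases h : z = x
    · subst h
      have : m = 0 := by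
        rw [sub_self] at hm
        exact_mod_cast (mul_eq_zero.1 hm).resolve_right hg.ne'
      simp [this]
    · have : m ≠ 0 := by
        rintro rfl
        apply h
        rw [Int.cast_zero, zero_mul] at hm
        linarith
      simp [this, h]
  rw [Finset.sum_congr rfl h2, Finset.sum_ite_eq']
  have hg' : (g : ℂ) ≠ 0 := by exact_mod_cast hg.ne'
  have hpi : (Real.pi : ℂ) ≠ 0 := by exact_mod_cast Real.pi_ne_zero
  split_ifs with h
  · push_cast
    field_simp
  · rw [mul_zero, Finsupp.notMem_support_iff.1 h, Complex.ofReal_zero]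

lemma IsStepMass.tendsto_laplace_pow (hp : IsStepMass p) (u : ℝ) :
    Tendsto (fun n : ℕ => laplace ((u / √n : ℝ) * Complex.I) p ^ n) atTop
      (𝓝 (Complex.exp (-(secondMoment p / 2 * u ^ 2 : ℝ)))) := by
  have h0 : Tendsto (fun n : ℕ => ((u / √n : ℝ) * Complex.I : ℂ)) atTop (𝓝 0) := by
    have h1 : Tendsto (fun n : ℕ => u / √(n : ℝ)) atTop (𝓝 0) :=
      tendsto_const_nhds.div_atTop (Real.tendsto_sqrt_atTop.comp tendsto_natCast_atTop_atTop)
    have h2 := ((Complex.continuous_ofReal.tendsto 0).comp h1).mul_const Complex.I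
    simpa using h2
  have h1 := ((differentiable_laplaceRemainder p).continuous.tendsto 0).comp h0
  rw [laplaceRemainder_zero] at h1
  have h2 := h1.const_mul (-(u : ℂ) ^ 2)
  have h3 : -(u : ℂ) ^ 2 * ((secondMoment p / 2 : ℝ) : ℂ) =
      (-(secondMoment p / 2 * u ^ 2 : ℝ) : ℂ) := by push_cast; ring
  rw [h3] at h2
  have h4 : Tendsto (fun n : ℕ => (n : ℂ) * (((u / √n : ℝ) * Complex.I) ^ 2 *
      laplaceRemainder p ((u / √n : ℝ) * Complex.I))) atTop
      (𝓝 (-(secondMoment p / 2 * u ^ 2 : ℝ) : ℂ)) := by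
    refine h2.congr' ?_
    filter_upwards [eventually_gt_atTop 0] with n hn
    have hn' : (0 : ℝ) < n := by exact_mod_cast hn
    have h5 : (n : ℂ) * ((u / √n : ℝ) * Complex.I) ^ 2 = -(u : ℂ) ^ 2 := by
      rw [mul_pow, Complex.I_sq, ← Complex.ofReal_pow, div_pow, Real.sq_sqrt hn'.le]
      have : (n : ℂ) ≠ 0 := by exact_mod_cast hn.ne'
      push_cast
      field_simp
    rw [← mul_assoc, h5]
    rfl
  have h5 := Complex.tendsto_one_add_pow_exp_of_tendsto h4
  push_cast at h5 ⊢
  refine h5.congr fun n => ?_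
  rw [hp.laplace_eq]

/-- Substitute `t = u / √n`. The integrand, extended by zero, is dominated by a fixed Gaussian
thanks to `IsStepMass.exists_norm_laplace_le` and converges pointwise by the central limit theorem;
the factor carrying `x` tends to `1`, so the limit does not depend on `x`. -/
lemma tendsto_sqrt_mul_integral_laplace_pow (hp : IsStepMass p) (hg : 0 < g)
    (hH : diffGroup p = AddSubgroup.zmultiples g) (x : ℝ) :
    Tendsto (fun n : ℕ => (√(n : ℝ) : ℂ) * ∫ t in (-(Real.pi / g))..(Real.pi / g),
      laplace (t * Complex.I) p ^ n * Complex.exp (-(t * Complex.I * x))) atTop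
      (𝓝 ((√(Real.pi / (secondMoment p / 2)) : ℝ) : ℂ)) := by
  obtain ⟨c, hc, hbound⟩ := hp.exists_norm_laplace_le hg hH
  set A := Real.pi / g
  have hA : 0 < A := by have := Real.pi_pos; positivity
  have hcont := continuous_laplace_mul_I p
  let F : ℕ → ℝ → ℂ := fun n u => (Set.Ioc (-A * √(n : ℝ)) (A * √(n : ℝ))).indicator
    (fun u => laplace ((u / √n : ℝ) * Complex.I) p ^ n *
      Complex.exp (-((u / √n : ℝ) * Complex.I * x))) u
  have hF : ∀ᶠ n : ℕ in atTop, ∫ u, F n u = (√(n : ℝ) : ℂ) * ∫ t in (-A)..A,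
      laplace (t * Complex.I) p ^ n * Complex.exp (-(t * Complex.I * x)) := by
    filter_upwards [eventually_gt_atTop 0] with n hn
    have hr : 0 < √(n : ℝ) := Real.sqrt_pos.2 (by exact_mod_cast hn)
    rw [integral_indicator measurableSet_Ioc, ← intervalIntegral.integral_of_le (by nlinarith),
      intervalIntegral.integral_comp_div (f := fun t : ℝ => laplace (t * Complex.I) p ^ n *
        Complex.exp (-(t * Complex.I * x))) hr.ne', mul_div_cancel_right₀ _ hr.ne',
      mul_div_cancel_right₀ _ hr.ne', Complex.real_smul]
  have hmain : Tendsto (fun n => ∫ u, F n u) atTop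
      (𝓝 (∫ u : ℝ, ((Real.exp (-(secondMoment p / 2) * u ^ 2) : ℝ) : ℂ))) := by
    refine tendsto_integral_of_dominated_convergence (fun u => Real.exp (-c * u ^ 2)) ?_
      (integrable_exp_neg_mul_sq hc) ?_ ?_
    · intro n
      refine (Continuous.aestronglyMeasurable ?_).indicator measurableSet_Ioc
      exact ((hcont.comp (by fun_prop : Continuous fun u : ℝ => u / √(n : ℝ))).pow n).mul
        (by fun_prop)
    · intro n
      refine Eventually.of_forall fun u => ?_
      simp only [F]
      rw [Set.indicator_apply]
      split_ifs with hu
      · rcases Nat.eq_zero_or_pos n with rfl | hn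
        · simp at hu
        · have hn' : (0 : ℝ) < n := by exact_mod_cast hn
          have hr : 0 < √(n : ℝ) := Real.sqrt_pos.2 hn'
          have hut : |u / √(n : ℝ)| ≤ A := by
            rw [abs_div, abs_of_pos hr, div_le_iff₀ hr, abs_le]
            exact ⟨by linarith [hu.1], hu.2⟩
          have h1 := hbound _ hut
          have h2 : ‖Complex.exp (-((u / √n : ℝ) * Complex.I * x))‖ = 1 := by
            rw [Complex.norm_exp]; simp
          rw [norm_mul, h2, mul_one, norm_pow]
          refine (pow_le_pow_left₀ (norm_nonneg _) h1 n).trans_eq ?_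
          rw [← Real.exp_nat_mul, div_pow, Real.sq_sqrt hn'.le]
          congr 1
          field_simp
      · rw [norm_zero]; positivity
    · refine Eventually.of_forall fun u => ?_
      have h1 := hp.tendsto_laplace_pow u
      have h0 : Tendsto (fun n : ℕ => u / √(n : ℝ)) atTop (𝓝 0) :=
        tendsto_const_nhds.div_atTop (Real.tendsto_sqrt_atTop.comp tendsto_natCast_atTop_atTop)
      have h2 : Tendsto (fun n : ℕ => Complex.exp (-((u / √n : ℝ) * Complex.I * x))) atTop
          (𝓝 1) := by
        have : Continuous fun t : ℝ => Complex.exp (-(t * Complex.I * x)) := by fun_prop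
        have h3 := (this.tendsto 0).comp h0
        simp only [Complex.ofReal_zero, zero_mul, neg_zero, Complex.exp_zero] at h3
        exact h3
      have h3 := h1.mul h2
      rw [mul_one] at h3
      have h4 : ((Real.exp (-(secondMoment p / 2) * u ^ 2) : ℝ) : ℂ) =
          Complex.exp (-(secondMoment p / 2 * u ^ 2 : ℝ)) := by
        rw [Complex.ofReal_exp]; push_cast; ring_nf
      rw [h4]
      refine h3.congr' ?_
      have h5 : ∀ᶠ n : ℕ in atTop, |u| / A < √(n : ℝ) :=
        (Real.tendsto_sqrt_atTop.comp tendsto_natCast_atTop_atTop).eventually_gt_atTop _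
      filter_upwards [h5] with n hn
      simp only [F]
      rw [Set.indicator_of_mem]
      rw [div_lt_iff₀ hA] at hn
      have := abs_lt.1 hn
      constructor <;> nlinarith
  rw [integral_complex_ofReal, integral_gaussian] at hmain
  exact hmain.congr' hF

/-- After `n` steps the walk lies in `n x₁ + H` with `H` the difference group. Since `d x₁ ∈ H`,
this coset depends only on `n` modulo `d`. -/
lemma mem_diffGroup_iff_val {d : ℕ} [NeZero d] (hd : (d : ℝ) * x₁ ∈ diffGroup p) (x : ℝ) (n : ℕ) :
    x - ((n : ZMod d).val : ℝ) * x₁ ∈ diffGroup p ↔ x - n * x₁ ∈ diffGroup p := by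
  have h1 : (n : ℝ) = ((n : ZMod d).val : ℝ) + d * ((n / d : ℕ) : ℝ) := by
    rw [ZMod.val_natCast]
    exact_mod_cast (Nat.mod_add_div n d).symm
  have h2 : ((n / d : ℕ) : ℝ) * (d * x₁) ∈ diffGroup p := by
    have := (diffGroup p).nsmul_mem hd (n / d)
    rwa [nsmul_eq_mul] at this
  have h3 : x - ((n : ZMod d).val : ℝ) * x₁ = x - n * x₁ + ((n / d : ℕ) : ℝ) * (d * x₁) := by
    rw [h1]
    simp
    ring
  rw [h3]
  exact (diffGroup p).add_mem_cancel_right h2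

open Classical in
/-- The local limit theorem at a fixed point for a lattice walk. -/
lemma IsStepMass.exists_local_limit (hp : IsStepMass p) (hx₁ : x₁ ∈ p.coeff.support) (hg : 0 < g)
    (hH : diffGroup p = AddSubgroup.zmultiples g) {d : ℕ} [NeZero d]
    (hd : (d : ℝ) * x₁ ∈ diffGroup p) :
    ∃ κ : ℝ, 0 < κ ∧ ∀ x : ℝ, AsympPeriodic d (1 / 2) (fun n => (p ^ n).coeff x)
      (fun r => if x - (r.val : ℝ) * x₁ ∈ diffGroup p then κ else 0) := by
  have hσ : 0 < secondMoment p := hp.variance_pos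
  have hpi := Real.pi_pos
  -- This is `g / √(2π E X²)`, the Gaussian density at `0` times the lattice spacing.
  refine ⟨g / (2 * Real.pi) * √(Real.pi / (secondMoment p / 2)), by positivity, fun x => ?_⟩
  have h1 := (tendsto_sqrt_mul_integral_laplace_pow hp hg hH x).const_mul
    ((g / (2 * Real.pi) : ℝ) : ℂ)
  have h2 := (Complex.continuous_re.tendsto _).comp h1
  rw [← Complex.ofReal_mul, Complex.ofReal_re] at h2
  set κ := g / (2 * Real.pi) * √(Real.pi / (secondMoment p / 2))
  have h3 := (h2.sub_const κ).norm
  rw [sub_self, norm_zero] at h3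
  refine squeeze_zero_norm (fun n => ?_) h3
  beta_reduce
  rw [← Real.sqrt_eq_rpow]
  by_cases hn : x - n * x₁ ∈ diffGroup p
  · rw [if_pos ((mem_diffGroup_iff_val hd x n).2 hn)]
    refine le_of_eq ?_
    congr 2
    have h4 := coeff_eq_integral hg (x := x) (f := p ^ n)
      ((supportedIn_pow hx₁ n).mono fun z hz => by
        have := (diffGroup p).sub_mem hz hn
        rw [hH] at this
        simpa using this)
    simp_rw [map_pow] at h4
    simp only [Function.comp_apply]
    rw [mul_left_comm, ← h4, ← Complex.ofReal_mul, Complex.ofReal_re]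
  · rw [if_neg (fun h => hn ((mem_diffGroup_iff_val hd x n).1 h)), supportedIn_pow hx₁ n x hn]
    simp

end LocalLimit

/-! ### Closure properties of sequences with a nontrivial periodic limit. -/

/-- The real Laplace transform of a finitely supported mass function. -/
noncomputable def realLaplace (l : ℝ) : AddMonoidAlgebra ℝ ℝ →ₐ[ℝ] ℝ :=
  AddMonoidAlgebra.lift ℝ ℝ ℝ
    { toFun := fun x => Real.exp (l * Multiplicative.toAdd x)
      map_one' := by simp
      map_mul' := fun x y => by
        rw [← Real.exp_add, toAdd_mul]
        ring_nf }

/-- `a` is a nonnegative sequence with `n ^ (3/2) * a n` asymptotically `d`-periodic, with a limit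
that is not identically zero unless `a` is. -/
structure HasPeriodicLimit (d : ℕ) (a : ℕ → ℝ) : Prop where
  nonneg : ∀ n, 0 ≤ a n
  exists_limit : ∃ c : ZMod d → ℝ, AsympPeriodic d (3 / 2) a c ∧ ((∃ m, a m ≠ 0) → ∃ r, 0 < c r)

/-- The positive multiples of `h` that are at most `y`. -/
noncomputable def latticePoints (h y : ℝ) : Finset ℝ :=
  (Finset.range ⌊y / h⌋₊).image fun k : ℕ => ((k : ℝ) + 1) * h

section HasPeriodicLimit

variable {d : ℕ} {a b : ℕ → ℝ}

lemma hasPeriodicLimit_zero (d : ℕ) : HasPeriodicLimit d fun _ => 0 :=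
  ⟨fun _ => le_rfl, fun _ => 0, asympPeriodic_zero, fun ⟨_, h⟩ => absurd rfl h⟩

lemma HasPeriodicLimit.add [NeZero d] (ha : HasPeriodicLimit d a) (hb : HasPeriodicLimit d b) :
    HasPeriodicLimit d fun n => a n + b n := by
  obtain ⟨ca, hca, hca'⟩ := ha.exists_limit
  obtain ⟨cb, hcb, hcb'⟩ := hb.exists_limit
  refine ⟨fun n => add_nonneg (ha.nonneg n) (hb.nonneg n), _, hca.add hcb, ?_⟩
  rintro ⟨m, hm⟩
  have hm' : a m ≠ 0 ∨ b m ≠ 0 := by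
    by_contra! h
    exact hm (by rw [h.1, h.2, add_zero])
  rcases hm' with h | h
  · obtain ⟨r, hr⟩ := hca' ⟨m, h⟩
    exact ⟨r, add_pos_of_pos_of_nonneg hr (hcb.nonneg hb.nonneg r)⟩
  · obtain ⟨r, hr⟩ := hcb' ⟨m, h⟩
    exact ⟨r, add_pos_of_nonneg_of_pos (hca.nonneg ha.nonneg r) hr⟩

lemma HasPeriodicLimit.const_mul [NeZero d] {k : ℝ} (hk : 0 ≤ k) (ha : HasPeriodicLimit d a) :
    HasPeriodicLimit d fun n => k * a n := by
  obtain ⟨ca, hca, hca'⟩ := ha.exists_limit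
  refine ⟨fun n => mul_nonneg hk (ha.nonneg n), _, hca.const_mul k, ?_⟩
  rintro ⟨m, hm⟩
  obtain ⟨r, hr⟩ := hca' ⟨m, right_ne_zero_of_mul hm⟩
  exact ⟨r, mul_pos (lt_of_le_of_ne hk (left_ne_zero_of_mul hm).symm) hr⟩

lemma HasPeriodicLimit.sum [NeZero d] {ι : Type*} {I : Finset ι} {a : ι → ℕ → ℝ}
    (h : ∀ i ∈ I, HasPeriodicLimit d (a i)) : HasPeriodicLimit d fun n => ∑ i ∈ I, a i n := by
  classical
  induction I using Finset.induction_on with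
  | empty => simpa using hasPeriodicLimit_zero d
  | insert i I hi ih =>
    simp_rw [Finset.sum_insert hi]
    exact (h i (Finset.mem_insert_self i I)).add
      (ih fun j hj => h j (Finset.mem_insert_of_mem hj))

lemma HasPeriodicLimit.summable [NeZero d] (ha : HasPeriodicLimit d a) : Summable a := by
  obtain ⟨ca, hca, -⟩ := ha.exists_limit
  obtain ⟨K, -, hK⟩ := hca.exists_bound
  exact (summable_of_rpow_bound hK).of_abs

lemma HasPeriodicLimit.convolution [NeZero d] (ha : HasPeriodicLimit d a)
    (hb : HasPeriodicLimit d b) : HasPeriodicLimit d fun n =>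
      ∑ ij ∈ Finset.HasAntidiagonal.antidiagonal n, a ij.1 * b ij.2 := by
  obtain ⟨ca, hca, -⟩ := ha.exists_limit
  obtain ⟨cb, hcb, hcb'⟩ := hb.exists_limit
  refine ⟨fun n => Finset.sum_nonneg fun ij _ => mul_nonneg (ha.nonneg _) (hb.nonneg _), _,
    hca.convolution hcb, ?_⟩
  rintro ⟨m, hm⟩
  obtain ⟨⟨i, j⟩, -, hij⟩ := Finset.exists_ne_zero_of_sum_ne_zero hm
  obtain ⟨s, hs⟩ := hcb' ⟨j, right_ne_zero_of_mul hij⟩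
  have hai : 0 < a i := lt_of_le_of_ne (ha.nonneg i) (left_ne_zero_of_mul hij).symm
  -- If `a i > 0` and the limit of `b` is positive in class `s`, then holding the first index at `i`
  -- already contributes `a i * cb s` to class `s + i`.
  refine ⟨s + i, add_pos_of_pos_of_nonneg ?_ (tsum_nonneg fun k =>
    mul_nonneg (hb.nonneg k) (hca.nonneg ha.nonneg _))⟩
  have hsum : Summable fun k => a k * cb (s + i - k) := by
    obtain ⟨K, hK, hKc⟩ := exists_bound_zmod cb
    refine Summable.of_norm_bounded (ha.summable.mul_right K) fun k => ?_
    rw [norm_mul, Real.norm_of_nonneg (ha.nonneg k)]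
    exact mul_le_mul_of_nonneg_left (hKc _) (ha.nonneg k)
  refine lt_of_lt_of_le ?_ (hsum.le_tsum i fun k _ =>
    mul_nonneg (ha.nonneg k) (hcb.nonneg hb.nonneg _))
  simpa using mul_pos hai hs

end HasPeriodicLimit

/-! ### Asymptotics of first passage masses on a lattice. -/

section Passage

variable {p : AddMonoidAlgebra ℝ ℝ} {x₁ g h : ℝ}

lemma realLaplace_eq_sum (l : ℝ) (f : AddMonoidAlgebra ℝ ℝ) :
    realLaplace l f = ∑ x ∈ f.coeff.support, f.coeff x * Real.exp (l * x) := by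
  rw [realLaplace, AddMonoidAlgebra.lift_apply, Finsupp.sum]
  simp

lemma realLaplace_zero_eq_sum (f : AddMonoidAlgebra ℝ ℝ) :
    realLaplace 0 f = ∑ x ∈ f.coeff.support, f.coeff x := by
  simp [realLaplace_eq_sum]

lemma sum_le_realLaplace_zero {f : AddMonoidAlgebra ℝ ℝ} (hf : ∀ x, 0 ≤ f.coeff x) (I : Finset ℝ) :
    ∑ x ∈ I, f.coeff x ≤ realLaplace 0 f := by
  classical
  rw [realLaplace_zero_eq_sum, ← Finset.sum_filter_ne_zero]
  refine Finset.sum_le_sum_of_subset_of_nonneg (fun x hx => ?_) fun x _ _ => hf x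
  simpa using (Finset.mem_filter.1 hx).2

lemma realLaplace_nonneg {f : AddMonoidAlgebra ℝ ℝ} (hf : ∀ x, 0 ≤ f.coeff x) (l : ℝ) :
    0 ≤ realLaplace l f := by
  rw [realLaplace_eq_sum]
  exact Finset.sum_nonneg fun x _ => mul_nonneg (hf x) (Real.exp_pos _).le

lemma IsStepMass.realLaplace_zero (hp : IsStepMass p) : realLaplace 0 p = 1 := by
  rw [realLaplace_zero_eq_sum, hp.sum_eq_one]

/-- Conservation of mass; it bounds the total passage mass by `1` before recurrence is known. -/
lemma IsStepMass.sum_passMass_add_stayMass (hp : IsStepMass p) (y : ℝ) (N : ℕ) :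
    ∑ n ∈ Finset.range (N + 1), realLaplace 0 (passMass p y n) +
      realLaplace 0 (stayMass p y N) = 1 := by
  induction N with
  | zero => simp [passMass, stayMass]
  | succ N ih =>
    have h1 := congrArg (realLaplace 0) (stayMass_succ_add_passMass_succ p y N)
    rw [map_add, map_mul, hp.realLaplace_zero, mul_one] at h1
    rw [Finset.sum_range_succ]
    linarith

lemma IsStepMass.sum_range_passMass_le (hp : IsStepMass p) (y : ℝ) (N : ℕ) :
    ∑ n ∈ Finset.range N, realLaplace 0 (passMass p y n) ≤ 1 := by
  have h1 := hp.sum_passMass_add_stayMass y N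
  have h2 := realLaplace_nonneg (stayMass_nonneg hp.nonneg y N) 0
  have h3 := realLaplace_nonneg (passMass_nonneg hp.nonneg y N) 0
  rw [Finset.sum_range_succ] at h1
  linarith

lemma IsStepMass.summable_passMass (hp : IsStepMass p) (y : ℝ) :
    Summable fun n => realLaplace 0 (passMass p y n) :=
  summable_of_sum_range_le (fun n => realLaplace_nonneg (passMass_nonneg hp.nonneg y n) 0)
    (hp.sum_range_passMass_le y)

lemma IsStepMass.summable_coeff_passMass (hp : IsStepMass p) (y z : ℝ) :
    Summable fun n => (passMass p y n).coeff z :=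
  Summable.of_nonneg_of_le (fun n => passMass_nonneg hp.nonneg y n z)
    (fun n => by simpa using sum_le_realLaplace_zero (passMass_nonneg hp.nonneg y n) {z})
    (hp.summable_passMass y)

lemma IsStepMass.sum_tsum_coeff_passMass_le (hp : IsStepMass p) (y : ℝ) (I : Finset ℝ) :
    ∑ z ∈ I, ∑' n, (passMass p y n).coeff z ≤ 1 := by
  rw [← Summable.tsum_finsetSum fun z _ => hp.summable_coeff_passMass y z]
  refine Real.tsum_le_of_sum_range_le (fun n => Finset.sum_nonneg fun z _ =>
    passMass_nonneg hp.nonneg y n z) fun N => ?_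
  exact (Finset.sum_le_sum fun n _ => sum_le_realLaplace_zero (passMass_nonneg hp.nonneg y n) I).trans
    (hp.sum_range_passMass_le y N)

lemma SupportedIn.restrictMass {s t : Set ℝ} {f : AddMonoidAlgebra ℝ ℝ} (hf : SupportedIn t f) :
    SupportedIn t (restrictMass s f) := fun x hx => by
  classical
  rw [coeff_restrictMass, hf x hx, ite_self]

lemma supportedIn_stayMass_diffGroup (hx₁ : x₁ ∈ p.coeff.support) (y : ℝ) (n : ℕ) :
    SupportedIn {z | z - n * x₁ ∈ diffGroup p} (stayMass p y n) := by
  induction n with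
  | zero => simpa [stayMass] using supportedIn_one (by simp [(diffGroup p).zero_mem])
  | succ n ih => exact (ih.mul_step hx₁).restrictMass

lemma supportedIn_passMass_diffGroup (hx₁ : x₁ ∈ p.coeff.support) (y : ℝ) (n : ℕ) :
    SupportedIn {z | z - n * x₁ ∈ diffGroup p} (passMass p y n) := by
  cases n with
  | zero => exact supportedIn_zero _
  | succ n => exact ((supportedIn_stayMass_diffGroup hx₁ y n).mul_step hx₁).restrictMass

lemma supportedIn_passMass_Ioc {B y : ℝ} (hy : 0 ≤ y) (hB : ∀ x ∈ p.coeff.support, x ≤ B) (n : ℕ) :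
    SupportedIn (Set.Ioc y (y + B)) (passMass p y n) := by
  intro z hz
  by_cases hyz : z ∈ Set.Ioi y
  · cases n with
    | zero => simp [passMass]
    | succ n =>
      refine SupportedIn.restrictMass (s := Set.Ioi y) (t := Set.Iic (y + B)) ?_ z
        fun h => hz ⟨hyz, h⟩
      refine (supportedIn_stayMass hy n).mul (t := Set.Iic B) (fun x hx => ?_) fun u hu v hv => ?_
      · by_contra hne
        exact hx (hB x (Finsupp.mem_support_iff.2 hne))
      · simp only [Set.mem_Iic] at *; linarith
  · exact supportedIn_passMass y n z hyz

lemma supportedIn_stayMass_lattice (hlat : ∀ x ∈ p.coeff.support, x ∈ AddSubgroup.zmultiples h)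
    (y : ℝ) (n : ℕ) : SupportedIn (AddSubgroup.zmultiples h) (stayMass p y n) := by
  induction n with
  | zero => exact supportedIn_one (AddSubgroup.zmultiples h).zero_mem
  | succ n ih =>
    refine SupportedIn.restrictMass (ih.mul (t := (AddSubgroup.zmultiples h)) (fun x hx => ?_)
      fun x hx y hy => (AddSubgroup.zmultiples h).add_mem hx hy)
    by_contra hne
    exact hx (hlat x (Finsupp.mem_support_iff.2 hne))

lemma supportedIn_passMass_lattice (hlat : ∀ x ∈ p.coeff.support, x ∈ AddSubgroup.zmultiples h)
    (y : ℝ) (n : ℕ) : SupportedIn (AddSubgroup.zmultiples h) (passMass p y n) := by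
  cases n with
  | zero => exact supportedIn_zero _
  | succ n =>
    refine SupportedIn.restrictMass ((supportedIn_stayMass_lattice hlat y n).mul
      (t := (AddSubgroup.zmultiples h)) (fun x hx => ?_)
      fun x hx y hy => (AddSubgroup.zmultiples h).add_mem hx hy)
    by_contra hne
    exact hx (hlat x (Finsupp.mem_support_iff.2 hne))

lemma mem_latticePoints (hh : 0 < h) {x y : ℝ} :
    x ∈ latticePoints h y ↔ 0 < x ∧ x ≤ y ∧ x ∈ AddSubgroup.zmultiples h := by
  simp only [latticePoints, Finset.mem_image, Finset.mem_range]
  constructor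
  · rintro ⟨k, hk, rfl⟩
    refine ⟨by positivity, ?_, AddSubgroup.mem_zmultiples_iff.2 ⟨k + 1, by simp⟩⟩
    have h1 : ((k + 1 : ℕ) : ℝ) ≤ y / h := by
      have hpos : 0 ≤ y / h := by
        by_contra hneg
        rw [Nat.floor_of_nonpos (by linarith)] at hk
        omega
      exact (Nat.le_floor_iff hpos).1 hk
    rw [le_div_iff₀ hh] at h1
    exact_mod_cast h1
  · rintro ⟨hx, hxy, hxl⟩
    obtain ⟨m, hm⟩ := AddSubgroup.mem_zmultiples_iff.1 hxl
    rw [zsmul_eq_mul] at hm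
    have hm0 : 0 < m := by
      rw [← hm] at hx
      exact_mod_cast pos_of_mul_pos_left hx hh.le
    obtain ⟨k, rfl⟩ : ∃ k : ℕ, m = (k : ℤ) + 1 := ⟨(m - 1).toNat, by omega⟩
    refine ⟨k, ?_, by rw [← hm]; push_cast; ring⟩
    rw [← Nat.succ_le_iff]
    apply Nat.le_floor
    rw [le_div_iff₀ hh]
    push_cast at hm ⊢
    linarith

/-- Baxter's recursion trades the factor `n` for one power of decay: the right-hand side is a
combination of `n^(-1/2)` sequences given by the local limit theorem, finite because only lattice
points `0 < x < z` occur. -/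
lemma IsStepMass.hasPeriodicLimit_passMass_zero (hp : IsStepMass p) (hx₁ : x₁ ∈ p.coeff.support)
    (hg : 0 < g) (hH : diffGroup p = AddSubgroup.zmultiples g) (hh : 0 < h)
    (hlat : ∀ x ∈ p.coeff.support, x ∈ AddSubgroup.zmultiples h) {d : ℕ} [NeZero d]
    (hd : (d : ℝ) * x₁ ∈ diffGroup p) {z : ℝ} (hz : 0 < z) :
    HasPeriodicLimit d fun n => (passMass p 0 n).coeff z := by
  classical
  obtain ⟨κ, hκ, hloc⟩ := hp.exists_local_limit hx₁ hg hH hd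
  have hnn := fun n x => passMass_nonneg hp.nonneg 0 n x
  have hpn : ∀ n x, 0 ≤ (p ^ n).coeff x := by
    intro n
    induction n with
    | zero =>
      intro x
      rw [pow_zero, AddMonoidAlgebra.one_def, AddMonoidAlgebra.coeff_single, Finsupp.single_apply]
      split_ifs <;> norm_num
    | succ n ih => rw [pow_succ]; exact coeff_mul_nonneg ih hp.nonneg
  let I : ℝ → Finset ℝ := fun z => (latticePoints h z).filter (· < z)
  have hrec : ∀ z, 0 < z → ∀ n : ℕ, (n : ℝ) * (passMass p 0 n).coeff z = (p ^ n).coeff z -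
      ∑ x ∈ I z, ∑ ij ∈ Finset.HasAntidiagonal.antidiagonal n,
        (passMass p 0 ij.1).coeff x * (p ^ ij.2).coeff (z - x) := by
    intro z hz n
    refine natCast_mul_coeff_passMass p n hz (fun i x hx hxz => ?_) fun x hx =>
      (Finset.mem_filter.1 hx).2
    refine Finset.mem_filter.2 ⟨(mem_latticePoints hh).2 ⟨?_, hxz.le, ?_⟩, hxz⟩
    · by_contra hn; exact hx (supportedIn_passMass 0 i x hn)
    · by_contra hn; exact hx (supportedIn_passMass_lattice hlat 0 i x hn)
  have hpow : ∀ n : ℕ, 0 < n → (n : ℝ) ^ (3 / 2 : ℝ) = (n : ℝ) ^ (1 / 2 : ℝ) * n := by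
    intro n hn
    have hn' : (0 : ℝ) < n := by exact_mod_cast hn
    nth_rewrite 3 [← Real.rpow_one (n : ℝ)]
    rw [← Real.rpow_add hn']
    norm_num
  -- The subtracted sum is nonnegative, so `n P(T = n, S_T = z) ≤ P(S_n = z)`. This a priori bound
  -- holds at every `z`, so no induction on `z` is needed.
  have hbd : ∀ z, 0 < z → ∃ K, ∀ n : ℕ, (n : ℝ) ^ (3 / 2 : ℝ) * |(passMass p 0 n).coeff z| ≤ K := by
    intro z hz
    obtain ⟨K, hK, hKb⟩ := (hloc z).exists_bound
    refine ⟨K, fun n => ?_⟩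
    rcases Nat.eq_zero_or_pos n with rfl | hn
    · simpa [passMass] using hK
    · rw [hpow n hn, mul_assoc, abs_of_nonneg (hnn n z), hrec z hz n]
      refine le_trans (mul_le_mul_of_nonneg_left ?_ (by positivity)) (hKb n)
      refine (sub_le_self _ (Finset.sum_nonneg fun x _ => Finset.sum_nonneg fun ij _ =>
        mul_nonneg (hnn _ _) (hpn _ _))).trans (le_abs_self _)
  let β : ℝ → ZMod d → ℝ := fun x r => if x - (r.val : ℝ) * x₁ ∈ diffGroup p then κ else 0
  have hlocβ : ∀ x, AsympPeriodic d (1 / 2) (fun n => (p ^ n).coeff x) (β x) := by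
    intro x
    convert! hloc x
  have hβ : ∀ x r, β x r ≤ κ := fun x r => by
    simp only [β]; split_ifs; exacts [le_rfl, hκ.le]
  have hβ0 : ∀ x r, 0 ≤ β x r := fun x r => by
    simp only [β]; split_ifs; exacts [hκ.le, le_rfl]
  have hconv : ∀ x ∈ I z, AsympPeriodic d (1 / 2)
      (fun n => ∑ ij ∈ Finset.HasAntidiagonal.antidiagonal n,
        (passMass p 0 ij.1).coeff x * (p ^ ij.2).coeff (z - x))
      (fun r => ∑' i : ℕ, (passMass p 0 i).coeff x * β (z - x) (r - i)) := by
    intro x hx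
    obtain ⟨K, hK⟩ := hbd x ((mem_latticePoints hh).1 (Finset.mem_filter.1 hx).1).1
    exact AsympPeriodic.convolution_of_bound (a := fun n => (passMass p 0 n).coeff x)
      (b := fun n => (p ^ n).coeff (z - x)) (c := β (z - x)) hK (hlocβ (z - x))
  have hmain := (hlocβ z).sub (AsympPeriodic.sum hconv)
  set c : ZMod d → ℝ := fun r => β z r - ∑ x ∈ I z,
    ∑' i : ℕ, (passMass p 0 i).coeff x * β (z - x) (r - i)
  have hasymp : AsympPeriodic d (3 / 2) (fun n => (passMass p 0 n).coeff z) c := by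
    refine Tendsto.congr' ?_ hmain
    filter_upwards [eventually_gt_atTop 0] with n hn
    rw [hpow n hn, mul_assoc, hrec z hz n]
  refine ⟨fun n => hnn n z, c, hasymp, ?_⟩
  rintro ⟨m, hm⟩
  -- The class of a time `m` with positive mass works: there `P(S_n = z)` has its full constant `κ`,
  -- while each subtracted convolution contributes at most `κ` times the ladder mass at `x`.
  refine ⟨(m : ZMod d), ?_⟩
  have hzm : z - m * x₁ ∈ diffGroup p := by
    by_contra hn; exact hm (supportedIn_passMass_diffGroup hx₁ 0 m z hn)
  have hβz : β z m = κ := by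
    simp only [β]
    rw [if_pos ((mem_diffGroup_iff_val hd z m).2 hzm)]
  have hsumm := fun x => hp.summable_coeff_passMass 0 x
  have h1 : ∑ x ∈ I z, ∑' i : ℕ, (passMass p 0 i).coeff x * β (z - x) ((m : ZMod d) - i) ≤
      (∑ x ∈ I z, ∑' i : ℕ, (passMass p 0 i).coeff x) * κ := by
    rw [Finset.sum_mul]
    refine Finset.sum_le_sum fun x _ => ?_
    rw [← tsum_mul_right]
    refine Summable.tsum_le_tsum (fun i => mul_le_mul_of_nonneg_left (hβ _ _) (hnn i x)) ?_
      ((hsumm x).mul_right κ)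
    exact Summable.of_nonneg_of_le (fun i => mul_nonneg (hnn i x) (hβ0 _ _))
      (fun i => mul_le_mul_of_nonneg_left (hβ _ _) (hnn i x)) ((hsumm x).mul_right κ)
  -- Total ladder mass at most `1`, with `z` included, leaves at least the mass at `z` after the
  -- points below `z` are removed; hence the limit is at least `κ P(S_T = z) > 0`.
  have h2 := hp.sum_tsum_coeff_passMass_le 0 (insert z (I z))
  rw [Finset.sum_insert (by simp [I])] at h2
  have h3 : 0 < ∑' n, (passMass p 0 n).coeff z :=
    (lt_of_le_of_ne (hnn m z) hm.symm).trans_le ((hsumm z).le_tsum m fun i _ => hnn i z)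
  have h4 : c m = κ - ∑ x ∈ I z, ∑' i : ℕ, (passMass p 0 i).coeff x *
      β (z - x) ((m : ZMod d) - i) := by rw [← hβz]
  rw [h4]
  nlinarith

/-- Each ladder point is at least `h`, so the renewal decomposition lowers the level by at least
`h`. Induction on the number of multiples of `h` needed to exceed `y` reduces everything to level
`0`. -/
lemma IsStepMass.hasPeriodicLimit_passMass (hp : IsStepMass p) (hx₁ : x₁ ∈ p.coeff.support)
    (hg : 0 < g) (hH : diffGroup p = AddSubgroup.zmultiples g) (hh : 0 < h)
    (hlat : ∀ x ∈ p.coeff.support, x ∈ AddSubgroup.zmultiples h) {d : ℕ} [NeZero d]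
    (hd : (d : ℝ) * x₁ ∈ diffGroup p) {y z : ℝ} (hy : 0 ≤ y) (hz : y < z) :
    HasPeriodicLimit d fun n => (passMass p y n).coeff z := by
  have key : ∀ (N : ℕ) (y z : ℝ), 0 ≤ y → y < z → y < N * h →
      HasPeriodicLimit d fun n => (passMass p y n).coeff z := by
    intro N
    induction N with
    | zero => intro y z hy _ hyN; simp at hyN; linarith
    | succ N ih =>
      intro y z hy hz hyN
      have hrec := coeff_passMass_renewal p hy hz (I := latticePoints h y)
        (fun i x hx hxy => (mem_latticePoints hh).2 ⟨by
          by_contra hn; exact hx (supportedIn_passMass 0 i x hn), hxy, by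
          by_contra hn; exact hx (supportedIn_passMass_lattice hlat 0 i x hn)⟩)
        fun x hx => ((mem_latticePoints hh).1 hx).2.1
      simp_rw [hrec]
      refine (hp.hasPeriodicLimit_passMass_zero hx₁ hg hH hh hlat hd (by linarith)).add
        (HasPeriodicLimit.sum fun x hx => ?_)
      obtain ⟨hx0, hxy, hxl⟩ := (mem_latticePoints hh).1 hx
      have hhx : h ≤ x := by
        obtain ⟨m, rfl⟩ := AddSubgroup.mem_zmultiples_iff.1 hxl
        rw [zsmul_eq_mul] at hx0 ⊢
        have : 0 < m := by exact_mod_cast pos_of_mul_pos_left hx0 hh.le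
        have : (1 : ℝ) ≤ m := by exact_mod_cast this
        nlinarith
      refine (hp.hasPeriodicLimit_passMass_zero hx₁ hg hH hh hlat hd hx0).convolution
        (ih (y - x) (z - x) (by linarith) (by linarith) ?_)
      push_cast at hyN
      linarith
  obtain ⟨N, hN⟩ := exists_nat_gt (y / h)
  exact key N y z hy hz ((div_lt_iff₀ hh).1 hN)

lemma IsStepMass.hasPeriodicLimit_realLaplace_passMass (hp : IsStepMass p)
    (hx₁ : x₁ ∈ p.coeff.support)
    (hg : 0 < g) (hH : diffGroup p = AddSubgroup.zmultiples g) (hh : 0 < h)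
    (hlat : ∀ x ∈ p.coeff.support, x ∈ AddSubgroup.zmultiples h) {d : ℕ} [NeZero d]
    (hd : (d : ℝ) * x₁ ∈ diffGroup p) {y : ℝ} (hy : 0 ≤ y) :
    HasPeriodicLimit d fun n => realLaplace 0 (passMass p y n) := by
  classical
  obtain ⟨B, hB⟩ := p.coeff.support.bddAbove
  set Z := (latticePoints h (y + B)).filter (y < ·)
  have hsum : ∀ n, realLaplace 0 (passMass p y n) = ∑ z ∈ Z, (passMass p y n).coeff z := by
    intro n
    rw [realLaplace_zero_eq_sum]
    refine Finset.sum_subset (fun z hz => ?_) fun z _ hz => by simpa using hz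
    have hz' := Finsupp.mem_support_iff.1 hz
    have h1 : z ∈ Set.Ioc y (y + B) := by
      by_contra hn
      exact hz' (supportedIn_passMass_Ioc hy (fun x hx => hB hx) n z hn)
    refine Finset.mem_filter.2 ⟨(mem_latticePoints hh).2 ⟨by linarith [h1.1], h1.2, ?_⟩, h1.1⟩
    by_contra hn; exact hz' (supportedIn_passMass_lattice hlat y n z hn)
  simp_rw [hsum]
  exact HasPeriodicLimit.sum fun z hz => hp.hasPeriodicLimit_passMass hx₁ hg hH hh hlat hd hy
    (Finset.mem_filter.1 hz).2

end Passage

/-! ### Optional stopping for the exponential martingale at first passage. -/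

section OptionalStopping

variable {p : AddMonoidAlgebra ℝ ℝ}

lemma IsStepMass.one_lt_realLaplace (hp : IsStepMass p) {l : ℝ} (hl : 0 < l) :
    1 < realLaplace l p := by
  have hx : ∃ x ∈ p.coeff.support, x ≠ 0 := by
    by_contra! h
    refine hp.variance_pos.ne' (Finset.sum_eq_zero fun x hx => by simp [h x hx])
  have h1 : ∑ x ∈ p.coeff.support, p.coeff x * (l * x + 1) = 1 := by
    have : ∀ x, p.coeff x * (l * x + 1) = l * (p.coeff x * x) + p.coeff x := fun x => by ring
    simp_rw [this]
    rw [Finset.sum_add_distrib, ← Finset.mul_sum, hp.mean_eq_zero, hp.sum_eq_one]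
    simp
  rw [realLaplace_eq_sum]
  nth_rewrite 1 [← h1]
  obtain ⟨x, hx, hx0⟩ := hx
  refine Finset.sum_lt_sum (fun x _ => mul_le_mul_of_nonneg_left (Real.add_one_le_exp _)
    (hp.nonneg x)) ⟨x, hx, mul_lt_mul_of_pos_left (Real.add_one_lt_exp (mul_ne_zero hl.ne' hx0)) ?_⟩
  exact lt_of_le_of_ne (hp.nonneg x) (by simpa using Ne.symm (Finsupp.mem_support_iff.1 hx))

/-- Optional stopping at the minimum of `N` and the passage time. An arbitrary algebra homomorphism
is allowed because both the real transform, for recurrence, and the complex one, for the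
asymptotics, are needed. -/
lemma sum_pow_mul_map_passMass {A : Type*} [CommRing A] [Algebra ℝ A]
    (φ : AddMonoidAlgebra ℝ ℝ →ₐ[ℝ] A) {s : A} (hs : s * φ p = 1) (y : ℝ) (N : ℕ) :
    ∑ n ∈ Finset.range (N + 1), s ^ n * φ (passMass p y n) + s ^ N * φ (stayMass p y N) = 1 := by
  induction N with
  | zero => simp [passMass, stayMass]
  | succ N ih =>
    have h1 := congrArg φ (stayMass_succ_add_passMass_succ p y N)
    rw [map_add, map_mul] at h1
    rw [Finset.sum_range_succ]
    linear_combination ih + s ^ (N + 1) * h1 + s ^ N * φ (stayMass p y N) * hs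

lemma realLaplace_le_of_supportedIn {f : AddMonoidAlgebra ℝ ℝ} (hf : ∀ x, 0 ≤ f.coeff x) {b l : ℝ}
    (hl : 0 ≤ l) (h : SupportedIn (Set.Iic b) f) :
    realLaplace l f ≤ Real.exp (l * b) * realLaplace 0 f := by
  rw [realLaplace_eq_sum, realLaplace_zero_eq_sum, Finset.mul_sum]
  refine Finset.sum_le_sum fun x hx => ?_
  have hxb : x ≤ b := by
    by_contra hn; exact Finsupp.mem_support_iff.1 hx (h x hn)
  rw [mul_comm]
  refine mul_le_mul_of_nonneg_right (Real.exp_le_exp.2 ?_) (hf x)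
  exact mul_le_mul_of_nonneg_left hxb hl

lemma norm_laplace_le_of_supportedIn {f : AddMonoidAlgebra ℝ ℝ} (hf : ∀ x, 0 ≤ f.coeff x) {b : ℝ}
    {l : ℂ} (hl : 0 ≤ l.re) (h : SupportedIn (Set.Iic b) f) :
    ‖laplace l f‖ ≤ Real.exp (l.re * b) * realLaplace 0 f := by
  refine le_trans ?_ (realLaplace_le_of_supportedIn hf hl h)
  rw [laplace_eq_sum, realLaplace_eq_sum]
  refine (norm_sum_le _ _).trans (Finset.sum_le_sum fun x _ => ?_)
  rw [norm_mul, Complex.norm_real, Real.norm_of_nonneg (hf x), Complex.norm_exp]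
  simp

/-- For real `l > 0` the discount `s = 1 / E exp (lX)` is less than `1` while `exp (l S_n)` is
bounded on survival, so the survival term dies out and `1 ≤ exp (l (y + B)) P(T < ∞)`. Letting `l ↓
0` gives almost sure passage. -/
lemma IsStepMass.tsum_passMass (hp : IsStepMass p) {y : ℝ} (hy : 0 ≤ y) :
    ∑' n, realLaplace 0 (passMass p y n) = 1 := by
  refine le_antisymm (Real.tsum_le_of_sum_range_le
    (fun n => realLaplace_nonneg (passMass_nonneg hp.nonneg y n) 0)
    (hp.sum_range_passMass_le y)) ?_
  set T := ∑' n, realLaplace 0 (passMass p y n)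
  obtain ⟨B, hB⟩ := p.coeff.support.bddAbove
  have hlow : ∀ l : ℝ, 0 < l → 1 ≤ Real.exp (l * (y + B)) * T := by
    intro l hl
    have hM := hp.one_lt_realLaplace hl
    set s := (realLaplace l p)⁻¹
    have hs0 : 0 ≤ s := inv_nonneg.2 (by linarith)
    have hs1 : s < 1 := inv_lt_one_of_one_lt₀ hM
    have hs : s * realLaplace l p = 1 := inv_mul_cancel₀ (by linarith)
    have hN : ∀ N : ℕ, 1 ≤ Real.exp (l * (y + B)) * T + s ^ N * Real.exp (l * y) := by
      intro N
      rw [← sum_pow_mul_map_passMass (realLaplace l) hs y N]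
      refine add_le_add ?_ (mul_le_mul_of_nonneg_left ?_ (pow_nonneg hs0 N))
      · calc _ ≤ ∑ n ∈ Finset.range (N + 1), Real.exp (l * (y + B)) *
              realLaplace 0 (passMass p y n) := by
              refine Finset.sum_le_sum fun n _ => ?_
              refine (mul_le_of_le_one_left (realLaplace_nonneg
                (passMass_nonneg hp.nonneg y n) l) (pow_le_one₀ hs0 hs1.le)).trans ?_
              exact realLaplace_le_of_supportedIn (passMass_nonneg hp.nonneg y n) hl.le
                ((supportedIn_passMass_Ioc hy (fun x hx => hB hx) n).mono fun z hz => hz.2)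
          _ ≤ _ := by
              rw [← Finset.mul_sum]
              exact mul_le_mul_of_nonneg_left ((hp.summable_passMass y).sum_le_tsum _ fun n _ =>
                realLaplace_nonneg (passMass_nonneg hp.nonneg y n) 0) (Real.exp_pos _).le
      · refine (realLaplace_le_of_supportedIn (stayMass_nonneg hp.nonneg y N) hl.le
          (supportedIn_stayMass hy N)).trans ?_
        refine mul_le_of_le_one_right (Real.exp_pos _).le ?_
        have h1 := hp.sum_passMass_add_stayMass y N
        have h2 : 0 ≤ ∑ n ∈ Finset.range (N + 1), realLaplace 0 (passMass p y n) :=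
          Finset.sum_nonneg fun n _ => realLaplace_nonneg (passMass_nonneg hp.nonneg y n) 0
        linarith
    have hlim := ((tendsto_pow_atTop_nhds_zero_of_lt_one hs0 hs1).mul_const
      (Real.exp (l * y))).const_add (Real.exp (l * (y + B)) * T)
    rw [zero_mul, add_zero] at hlim
    exact ge_of_tendsto' hlim hN
  have hcont : Tendsto (fun l : ℝ => Real.exp (l * (y + B)) * T) (𝓝[>] 0) (𝓝 T) := by
    have : Continuous fun l : ℝ => Real.exp (l * (y + B)) * T := by fun_prop
    have h1 := this.tendsto 0
    simp only [zero_mul, Real.exp_zero, one_mul] at h1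
    exact h1.mono_left nhdsWithin_le_nhds
  exact ge_of_tendsto hcont (by filter_upwards [self_mem_nhdsWithin] with l hl using hlow l hl)

lemma IsStepMass.tendsto_stayMass (hp : IsStepMass p) {y : ℝ} (hy : 0 ≤ y) :
    Tendsto (fun N => realLaplace 0 (stayMass p y N)) atTop (𝓝 0) := by
  have h1 := ((hp.summable_passMass y).hasSum.tendsto_sum_nat.comp (tendsto_add_atTop_nat 1))
  rw [hp.tsum_passMass hy] at h1
  have h2 := h1.const_sub 1
  rw [sub_self] at h2
  refine h2.congr fun N => ?_
  have := hp.sum_passMass_add_stayMass y N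
  simp only [Function.comp_apply]
  linarith

/-- Now the discount has modulus `1` and helps no longer; the survival term vanishes because the
survival probability itself does. -/
lemma IsStepMass.tsum_exp_mul_laplace_passMass (hp : IsStepMass p) {y : ℝ} (hy : 0 ≤ y) {θ : ℝ}
    {l : ℂ} (hl : laplace l p = Complex.exp (-(θ * Complex.I))) (hre : 0 ≤ l.re) :
    (Summable fun n : ℕ => Complex.exp ((θ * n : ℝ) * Complex.I) * laplace l (passMass p y n)) ∧
    ∑' n : ℕ, Complex.exp ((θ * n : ℝ) * Complex.I) * laplace l (passMass p y n) = 1 := by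
  obtain ⟨B, hB⟩ := p.coeff.support.bddAbove
  have hs : Summable fun n : ℕ =>
      Complex.exp ((θ * n : ℝ) * Complex.I) * laplace l (passMass p y n) := by
    refine Summable.of_norm_bounded ((hp.summable_passMass y).mul_left
      (Real.exp (l.re * (y + B)))) fun n => ?_
    rw [norm_mul, Complex.norm_exp_ofReal_mul_I, one_mul]
    exact norm_laplace_le_of_supportedIn (passMass_nonneg hp.nonneg y n) hre
      ((supportedIn_passMass_Ioc hy (fun x hx => hB hx) n).mono fun z hz => hz.2)
  refine ⟨hs, ?_⟩
  have hmul : Complex.exp (θ * Complex.I) * laplace l p = 1 := by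
    rw [hl, ← Complex.exp_add, add_neg_cancel, Complex.exp_zero]
  have hpow : ∀ n : ℕ, Complex.exp (θ * Complex.I) ^ n = Complex.exp ((θ * n : ℝ) * Complex.I) := by
    intro n
    rw [← Complex.exp_nat_mul]
    congr 1
    push_cast
    ring
  have h1 := sum_pow_mul_map_passMass (laplace l) hmul y
  simp_rw [hpow] at h1
  have h2 := hs.hasSum.tendsto_sum_nat.comp (tendsto_add_atTop_nat 1)
  have h3 : Tendsto (fun N : ℕ => Complex.exp ((θ * N : ℝ) * Complex.I) *
      laplace l (stayMass p y N)) atTop (𝓝 0) := by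
    have h4 := (hp.tendsto_stayMass hy).const_mul (Real.exp (l.re * y))
    rw [mul_zero] at h4
    refine squeeze_zero_norm (fun N => ?_) h4
    rw [norm_mul, Complex.norm_exp_ofReal_mul_I, one_mul]
    exact norm_laplace_le_of_supportedIn (stayMass_nonneg hp.nonneg y N) hre
      (supportedIn_stayMass hy N)
  have h4 := h2.add h3
  rw [add_zero] at h4
  refine tendsto_nhds_unique h4 (tendsto_const_nhds.congr fun N => ?_)
  rw [← h1 N]
  rfl

/-- Mean position at the first passage above `y`. -/
noncomputable def meanPassage (p : AddMonoidAlgebra ℝ ℝ) (y : ℝ) : ℝ :=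
  ∑' n, ∑ x ∈ (passMass p y n).coeff.support, (passMass p y n).coeff x * x

lemma laplace_sub_realLaplace_zero (l : ℂ) (f : AddMonoidAlgebra ℝ ℝ) :
    laplace l f - realLaplace 0 f =
      ∑ x ∈ f.coeff.support, (f.coeff x : ℂ) * (Complex.exp (l * x) - 1) := by
  rw [laplace_eq_sum, realLaplace_zero_eq_sum]
  push_cast
  rw [← Finset.sum_sub_distrib]
  exact Finset.sum_congr rfl fun x _ => by ring

lemma norm_laplace_sub_realLaplace_zero_le {f : AddMonoidAlgebra ℝ ℝ} (hf : ∀ x, 0 ≤ f.coeff x)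
    {b : ℝ} (l : ℂ) (h : SupportedIn (Set.Ioc 0 b) f) :
    ‖laplace l f - realLaplace 0 f‖ ≤ ‖l‖ * b * Real.exp (‖l‖ * b) * realLaplace 0 f := by
  rw [laplace_sub_realLaplace_zero, realLaplace_zero_eq_sum, Finset.mul_sum]
  refine (norm_sum_le _ _).trans (Finset.sum_le_sum fun x hx => ?_)
  have hx' : x ∈ Set.Ioc 0 b := by
    by_contra hn; exact Finsupp.mem_support_iff.1 hx (h x hn)
  rw [norm_mul, Complex.norm_real, Real.norm_of_nonneg (hf x), mul_comm]
  refine mul_le_mul_of_nonneg_right ?_ (hf x)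
  have h1 := Complex.norm_exp_sub_sum_le_norm_mul_exp (l * x) 1
  simp only [Finset.sum_range_one, pow_zero, Nat.factorial_zero, Nat.cast_one, div_one, pow_one]
    at h1
  have h2 : ‖l * (x : ℂ)‖ ≤ ‖l‖ * b := by
    rw [norm_mul, Complex.norm_real, Real.norm_of_nonneg hx'.1.le]
    exact mul_le_mul_of_nonneg_left hx'.2 (norm_nonneg _)
  refine h1.trans (mul_le_mul h2 (Real.exp_le_exp.2 h2) (Real.exp_pos _).le ?_)
  exact (norm_nonneg _).trans h2

/-- Both `E exp (iθT + l S_T)` and `P(T < ∞)` equal `1`, so subtracting `E exp (iθT)` from either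
gives the same value. The right-hand side is small because `l` is, not because of any knowledge of
the tail of `T`. -/
lemma IsStepMass.tsum_oscillation_eq (hp : IsStepMass p) {y : ℝ} (hy : 0 ≤ y) {θ : ℝ}
    {l : ℂ} (hl : laplace l p = Complex.exp (-(θ * Complex.I))) (hre : 0 ≤ l.re) :
    ∑' n : ℕ, (realLaplace 0 (passMass p y n) : ℂ) * (1 - Complex.exp ((θ * n : ℝ) * Complex.I)) =
      ∑' n : ℕ, Complex.exp ((θ * n : ℝ) * Complex.I) *
        (laplace l (passMass p y n) - realLaplace 0 (passMass p y n)) := by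
  obtain ⟨h1, h2⟩ := hp.tsum_exp_mul_laplace_passMass hy hl hre
  have h3 : Summable fun n => (realLaplace 0 (passMass p y n) : ℂ) := by
    have := (hp.summable_passMass y).map (Complex.ofRealHom) Complex.continuous_ofReal
    exact this
  have h4 : ∑' n, (realLaplace 0 (passMass p y n) : ℂ) = 1 := by
    rw [← Complex.ofReal_tsum, hp.tsum_passMass hy, Complex.ofReal_one]
  have h5 : Summable fun n : ℕ => Complex.exp ((θ * n : ℝ) * Complex.I) *
      (realLaplace 0 (passMass p y n) : ℂ) :=
    Summable.of_norm_bounded (hp.summable_passMass y) fun n => by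
      rw [norm_mul, Complex.norm_exp_ofReal_mul_I, one_mul, Complex.norm_real,
        Real.norm_of_nonneg (realLaplace_nonneg (passMass_nonneg hp.nonneg y n) 0)]
  simp_rw [mul_sub, mul_one]
  rw [h1.tsum_sub h5, h2, ← h4, ← h3.tsum_sub (by simpa only [mul_comm] using h5)]
  exact tsum_congr fun n => by ring

/-- Uniformity in the level `y` is what later permits dominated convergence over the landing points
of a crossing. -/
lemma IsStepMass.exists_oscillation_bound (hp : IsStepMass p) (Y : ℝ) :
    ∃ K : ℝ, ∀ᶠ θ in 𝓝[>] (0 : ℝ), ∀ y : ℝ, 0 ≤ y → y ≤ Y →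
      ‖(∑' n : ℕ, (realLaplace 0 (passMass p y n) : ℂ) *
        (1 - Complex.exp ((θ * n : ℝ) * Complex.I))) / (√θ : ℂ)‖ ≤ K := by
  obtain ⟨B, hB⟩ := p.coeff.support.bddAbove
  obtain ⟨l, hl, hlim⟩ := hp.exists_laplace_root
  set L : ℝ := ‖((1 / √(secondMoment p) : ℝ) * (1 - Complex.I) : ℂ)‖ + 1
  have hL : ∀ᶠ θ in 𝓝[>] (0 : ℝ), ‖l θ / (√θ : ℂ)‖ < L :=
    hlim.norm.eventually (gt_mem_nhds (lt_add_one _))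
  have hsq : ∀ᶠ θ in 𝓝[>] (0 : ℝ), √θ ≤ 1 := by
    have h1 : ∀ᶠ θ in 𝓝[>] (0 : ℝ), θ < 1 :=
      (gt_mem_nhds one_pos).filter_mono nhdsWithin_le_nhds
    filter_upwards [h1] with θ hθ
    exact Real.sqrt_le_one.2 hθ.le
  refine ⟨L * (|Y| + |B|) * Real.exp (L * (|Y| + |B|)), ?_⟩
  filter_upwards [hl, hL, hsq, self_mem_nhdsWithin] with θ h1 h2 h3 hθ y hy hyY
  have hr : 0 < √θ := Real.sqrt_pos.2 hθ
  set b := |Y| + |B|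
  have hb : 0 ≤ b := by positivity
  rw [norm_div, Complex.norm_real, Real.norm_of_nonneg hr.le, div_lt_iff₀ hr] at h2
  have hL0 : 0 ≤ L := by positivity
  have hlL : ‖l θ‖ ≤ L := h2.le.trans (mul_le_of_le_one_right hL0 h3)
  rw [hp.tsum_oscillation_eq hy h1.1 h1.2.le, norm_div, Complex.norm_real,
    Real.norm_of_nonneg hr.le, div_le_iff₀ hr]
  have hbound : ∀ n : ℕ, ‖Complex.exp ((θ * n : ℝ) * Complex.I) *
      (laplace (l θ) (passMass p y n) - realLaplace 0 (passMass p y n))‖ ≤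
      L * b * Real.exp (L * b) * √θ * realLaplace 0 (passMass p y n) := by
    intro n
    rw [norm_mul, Complex.norm_exp_ofReal_mul_I, one_mul]
    have hnn := realLaplace_nonneg (passMass_nonneg hp.nonneg y n) 0
    refine (norm_laplace_sub_realLaplace_zero_le (b := b) (passMass_nonneg hp.nonneg y n) (l θ)
      ((supportedIn_passMass_Ioc hy (fun x hx => hB hx) n).mono fun z hz => ?_)).trans ?_
    · refine ⟨hy.trans_lt hz.1, hz.2.trans (add_le_add (hyY.trans (le_abs_self _)) (le_abs_self _))⟩
    · refine mul_le_mul_of_nonneg_right ?_ hnn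
      calc ‖l θ‖ * b * Real.exp (‖l θ‖ * b) ≤ L * √θ * b * Real.exp (L * b) := by gcongr
        _ = _ := by ring
  refine (tsum_of_norm_bounded ((hp.summable_passMass y).mul_left _).hasSum hbound).trans_eq ?_
  rw [tsum_mul_left, hp.tsum_passMass hy, mul_one]

lemma IsStepMass.summable_meanPassage (hp : IsStepMass p) {y : ℝ} (hy : 0 ≤ y) :
    Summable fun n => ∑ x ∈ (passMass p y n).coeff.support, (passMass p y n).coeff x * x := by
  obtain ⟨B, hB⟩ := p.coeff.support.bddAbove
  have hx : ∀ n, ∀ x ∈ (passMass p y n).coeff.support, x ∈ Set.Ioc y (y + B) := by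
    intro n x hx
    by_contra hn
    exact Finsupp.mem_support_iff.1 hx (supportedIn_passMass_Ioc hy (fun x hx => hB hx) n x hn)
  refine Summable.of_nonneg_of_le (fun n => Finset.sum_nonneg fun x h => ?_) (fun n => ?_)
    ((hp.summable_passMass y).mul_right (y + B))
  · exact mul_nonneg (passMass_nonneg hp.nonneg y n x) (hy.trans (hx n x h).1.le)
  · rw [realLaplace_zero_eq_sum, Finset.sum_mul]
    exact Finset.sum_le_sum fun x h => mul_le_mul_of_nonneg_left (hx n x h).2
      (passMass_nonneg hp.nonneg y n x)

lemma IsStepMass.meanPassage_pos (hp : IsStepMass p) {y : ℝ} (hy : 0 ≤ y) :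
    0 < meanPassage p y := by
  have hx : ∀ n, ∀ x ∈ (passMass p y n).coeff.support, y < x := by
    intro n x hx
    by_contra hn
    exact Finsupp.mem_support_iff.1 hx (supportedIn_passMass y n x hn)
  have hex : ∃ n, realLaplace 0 (passMass p y n) ≠ 0 := by
    by_contra! h
    have := hp.tsum_passMass hy
    simp [h] at this
  obtain ⟨n, hn⟩ := hex
  rw [realLaplace_zero_eq_sum] at hn
  obtain ⟨x, hxs, hx0⟩ := Finset.exists_ne_zero_of_sum_ne_zero hn
  have hterm : ∀ n, ∀ x ∈ (passMass p y n).coeff.support, 0 ≤ (passMass p y n).coeff x * x :=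
    fun n x h => mul_nonneg (passMass_nonneg hp.nonneg y n x) (hy.trans (hx n x h).le)
  refine (hp.summable_meanPassage hy).tsum_pos (fun n => Finset.sum_nonneg (hterm n)) n ?_
  refine Finset.sum_pos' (hterm n) ⟨x, hxs, mul_pos ?_ (hy.trans_lt (hx n x hxs))⟩
  exact lt_of_le_of_ne (passMass_nonneg hp.nonneg y n x) hx0.symm

lemma tendsto_exp_mul_sub_one_div {l : ℝ → ℂ} {L : ℂ}
    (hlim : Tendsto (fun θ : ℝ => l θ / (√θ : ℂ)) (𝓝[>] 0) (𝓝 L)) (x : ℂ) :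
    Tendsto (fun θ : ℝ => (Complex.exp (l θ * x) - 1) / (√θ : ℂ)) (𝓝[>] 0) (𝓝 (L * x)) := by
  have hsqrt : Tendsto (fun θ : ℝ => (√θ : ℂ)) (𝓝[>] 0) (𝓝 0) := by
    have : Continuous fun θ : ℝ => (√θ : ℂ) := by fun_prop
    have h2 := this.tendsto 0
    simp only [Real.sqrt_zero, Complex.ofReal_zero] at h2
    exact h2.mono_left nhdsWithin_le_nhds
  have hl0 : Tendsto (fun θ => l θ * x) (𝓝[>] 0) (𝓝 0) := by
    have := ((hlim.mul hsqrt).mul_const x)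
    rw [mul_zero, zero_mul] at this
    refine this.congr' ?_
    filter_upwards [self_mem_nhdsWithin] with θ hθ
    have : (√θ : ℂ) ≠ 0 := by exact_mod_cast (Real.sqrt_pos.2 (Set.mem_Ioi.1 hθ)).ne'
    rw [div_mul_cancel₀ _ this]
  have h1 : Tendsto (dslope Complex.exp 0) (𝓝 0) (𝓝 1) := by
    have := (continuousAt_dslope_same.2 (Complex.hasDerivAt_exp 0).differentiableAt).tendsto
    rwa [dslope_same, (Complex.hasDerivAt_exp 0).deriv, Complex.exp_zero] at this
  have h2 := (h1.comp hl0).mul (hlim.mul_const x)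
  rw [one_mul] at h2
  refine h2.congr fun θ => ?_
  have h4 := sub_smul_dslope Complex.exp 0 (l θ * x)
  rw [sub_zero, Complex.exp_zero, smul_eq_mul] at h4
  simp only [Function.comp_apply]
  rw [← h4]
  ring

/-- Termwise `exp (lx) - 1 ~ lx` and `exp (iθn) → 1`; the bounded overshoot dominates the sum over
`n`. The constant is thus the mean position at passage times the constant of the root. -/
lemma IsStepMass.tendsto_oscillation_passMass (hp : IsStepMass p) {y : ℝ} (hy : 0 ≤ y) :
    Tendsto (fun θ : ℝ => (∑' n : ℕ, (realLaplace 0 (passMass p y n) : ℂ) *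
        (1 - Complex.exp ((θ * n : ℝ) * Complex.I))) / (√θ : ℂ)) (𝓝[>] 0)
      (𝓝 ((meanPassage p y / √(secondMoment p) : ℝ) * (1 - Complex.I))) := by
  obtain ⟨B, hB⟩ := p.coeff.support.bddAbove
  obtain ⟨l, hl, hlim⟩ := hp.exists_laplace_root
  set L : ℂ := (1 / √(secondMoment p) : ℝ) * (1 - Complex.I)
  have hLb : ∀ᶠ θ in 𝓝[>] (0 : ℝ), ‖l θ / (√θ : ℂ)‖ < ‖L‖ + 1 :=
    hlim.norm.eventually (gt_mem_nhds (lt_add_one _))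
  have hsq : ∀ᶠ θ in 𝓝[>] (0 : ℝ), √θ ≤ 1 := by
    have h1 : ∀ᶠ θ in 𝓝[>] (0 : ℝ), θ < 1 :=
      (gt_mem_nhds one_pos).filter_mono nhdsWithin_le_nhds
    filter_upwards [h1] with θ hθ
    exact Real.sqrt_le_one.2 hθ.le
  set b := y + |B|
  have hb : 0 ≤ b := by positivity
  set M := ‖L‖ + 1
  have hterm : ∀ n : ℕ, Tendsto (fun θ : ℝ => Complex.exp ((θ * n : ℝ) * Complex.I) *
      (laplace (l θ) (passMass p y n) - realLaplace 0 (passMass p y n)) / (√θ : ℂ)) (𝓝[>] 0)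
      (𝓝 (((∑ x ∈ (passMass p y n).coeff.support, (passMass p y n).coeff x * x : ℝ) : ℂ) * L)) := by
    intro n
    have h1 : Tendsto (fun θ : ℝ => Complex.exp ((θ * n : ℝ) * Complex.I)) (𝓝[>] 0) (𝓝 1) := by
      have : Continuous fun θ : ℝ => Complex.exp ((θ * n : ℝ) * Complex.I) := by fun_prop
      have h2 := this.tendsto 0
      simp only [zero_mul, Complex.ofReal_zero, Complex.exp_zero] at h2
      exact h2.mono_left nhdsWithin_le_nhds
    have h2 := h1.mul (tendsto_finsetSum (passMass p y n).coeff.support fun x _ =>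
      (tendsto_exp_mul_sub_one_div hlim (x : ℂ)).const_mul ((passMass p y n).coeff x : ℂ))
    rw [one_mul] at h2
    have h3 : ((∑ x ∈ (passMass p y n).coeff.support, (passMass p y n).coeff x * x : ℝ) : ℂ) * L =
        ∑ x ∈ (passMass p y n).coeff.support, ((passMass p y n).coeff x : ℂ) * (L * x) := by
      push_cast
      rw [Finset.sum_mul]
      exact Finset.sum_congr rfl fun x _ => by ring
    rw [h3]
    refine h2.congr fun θ => ?_
    rw [laplace_sub_realLaplace_zero, mul_div_assoc, Finset.sum_div]
    congr 1
    exact Finset.sum_congr rfl fun x _ => by ring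
  have hmain := tendsto_tsum_of_dominated_convergence (𝓕 := 𝓝[>] (0 : ℝ))
    (bound := fun n => M * b * Real.exp (M * b) * realLaplace 0 (passMass p y n))
    ((hp.summable_passMass y).mul_left _) hterm ?_
  · have h1 : (∑' n, ((∑ x ∈ (passMass p y n).coeff.support,
        (passMass p y n).coeff x * x : ℝ) : ℂ) * L) =
        (meanPassage p y / √(secondMoment p) : ℝ) * (1 - Complex.I) := by
      rw [tsum_mul_right, ← Complex.ofReal_tsum]
      simp only [L, meanPassage]
      push_cast
      ring
    rw [h1] at hmain
    refine hmain.congr' ?_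
    filter_upwards [hl] with θ hlθ
    rw [hp.tsum_oscillation_eq hy hlθ.1 hlθ.2.le, tsum_div_const]
  · filter_upwards [hLb, hsq, self_mem_nhdsWithin] with θ h2 h3 hθ n
    have hr : 0 < √θ := Real.sqrt_pos.2 hθ
    rw [norm_div, Complex.norm_real, Real.norm_of_nonneg hr.le, div_lt_iff₀ hr] at h2
    have hM0 : 0 ≤ M := by positivity
    have hlL : ‖l θ‖ ≤ M := h2.le.trans (mul_le_of_le_one_right hM0 h3)
    rw [norm_div, Complex.norm_real, Real.norm_of_nonneg hr.le, div_le_iff₀ hr, norm_mul,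
      Complex.norm_exp_ofReal_mul_I, one_mul]
    have hnn := realLaplace_nonneg (passMass_nonneg hp.nonneg y n) 0
    refine (norm_laplace_sub_realLaplace_zero_le (b := b) (passMass_nonneg hp.nonneg y n) (l θ)
      ((supportedIn_passMass_Ioc hy (fun x hx => hB hx) n).mono fun z hz => ?_)).trans ?_
    · exact ⟨hy.trans_lt hz.1, hz.2.trans (add_le_add le_rfl (le_abs_self _))⟩
    · rw [mul_right_comm _ _ (√θ)]
      refine mul_le_mul_of_nonneg_right ?_ hnn
      calc ‖l θ‖ * b * Real.exp (‖l θ‖ * b) ≤ M * √θ * b * Real.exp (M * b) := by gcongr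
        _ = _ := by ring

end OptionalStopping

/-! ### Reflection, which turns passages below into passages above. -/

/-- The mass function of the negative of a random variable with mass function `p`. -/
noncomputable def reflectMass (p : AddMonoidAlgebra ℝ ℝ) : AddMonoidAlgebra ℝ ℝ :=
  .ofCoeff (p.coeff.equivMapDomain (Equiv.neg ℝ))

section Reflect

variable {p : AddMonoidAlgebra ℝ ℝ}

lemma coeff_reflectMass (p : AddMonoidAlgebra ℝ ℝ) (x : ℝ) :
    (reflectMass p).coeff x = p.coeff (-x) := by
  simp [reflectMass, Finsupp.equivMapDomain_apply]

lemma mem_support_reflectMass {x : ℝ} :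
    x ∈ (reflectMass p).coeff.support ↔ -x ∈ p.coeff.support := by
  rw [Finsupp.mem_support_iff, Finsupp.mem_support_iff, coeff_reflectMass]

lemma sum_reflectMass (f : ℝ → ℝ) :
    ∑ x ∈ (reflectMass p).coeff.support, (reflectMass p).coeff x * f x =
      ∑ x ∈ p.coeff.support, p.coeff x * f (-x) := by
  refine Finset.sum_bij' (fun x _ => -x) (fun x _ => -x) ?_ ?_ ?_ ?_ ?_
  · intro x hx; exact mem_support_reflectMass.1 hx
  · intro x hx; rw [mem_support_reflectMass, neg_neg]; exact hx
  · simp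
  · simp
  · intro x _; rw [coeff_reflectMass, neg_neg]

lemma secondMoment_reflectMass (p : AddMonoidAlgebra ℝ ℝ) :
    secondMoment (reflectMass p) = secondMoment p := by
  rw [secondMoment, sum_reflectMass fun x => x ^ 2]
  simp [secondMoment]

lemma IsStepMass.reflect (hp : IsStepMass p) : IsStepMass (reflectMass p) where
  nonneg x := by rw [coeff_reflectMass]; exact hp.nonneg _
  sum_eq_one := by
    have := sum_reflectMass (p := p) fun _ => 1
    simpa [hp.sum_eq_one] using this
  mean_eq_zero := by
    rw [sum_reflectMass fun x => x]
    simpa using hp.mean_eq_zero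
  variance_pos := by
    have := secondMoment_reflectMass p
    unfold secondMoment at this
    rw [this]; exact hp.variance_pos

lemma diffGroup_reflectMass (p : AddMonoidAlgebra ℝ ℝ) :
    diffGroup (reflectMass p) = diffGroup p := by
  unfold diffGroup
  congr 1
  ext z
  constructor
  · rintro ⟨x, hx, x', hx', rfl⟩
    exact ⟨-x', mem_support_reflectMass.1 hx', -x, mem_support_reflectMass.1 hx, by ring⟩
  · rintro ⟨x, hx, x', hx', rfl⟩
    exact ⟨-x', by rwa [mem_support_reflectMass, neg_neg], -x,
      by rwa [mem_support_reflectMass, neg_neg], by ring⟩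

end Reflect

/-! ### From random steps to mass functions. -/

/-- `Y n` is an `𝓕 (n + 1)`-measurable step, independent of `𝓕 n` and with mass function `q`. -/
structure IsStepSequence {Ω : Type*} [mΩ : MeasurableSpace Ω] (P : Measure Ω)
    (𝓕 : ℕ → MeasurableSpace Ω) (Y : ℕ → Ω → ℝ) (q : AddMonoidAlgebra ℝ ℝ) : Prop where
  le : ∀ n, 𝓕 n ≤ mΩ
  mono : Monotone 𝓕
  measurable : ∀ n, Measurable[𝓕 (n + 1)] (Y n)
  indep : ∀ n E, MeasurableSet[𝓕 n] E → ∀ x, P.real (E ∩ {ω | Y n ω = x}) = P.real E * q.coeff x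
  mem_support : ∀ n, ∀ᵐ ω ∂P, Y n ω ∈ q.coeff.support

/-- Sum of the `n` steps from time `m` on. -/
def shiftSum {Ω : Type*} (Y : ℕ → Ω → ℝ) (m n : ℕ) (ω : Ω) : ℝ :=
  ∑ k ∈ Finset.range n, Y (m + k) ω

/-- The event that the walk of steps from time `m` on stays at most `y` at the times
`1, …, n`. -/
def stayEvent {Ω : Type*} (Y : ℕ → Ω → ℝ) (m : ℕ) (y : ℝ) (n : ℕ) : Set Ω :=
  {ω | ∀ j, 1 ≤ j → j ≤ n → shiftSum Y m j ω ≤ y}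

section Link

variable {Ω : Type*} [mΩ : MeasurableSpace Ω] {P : Measure Ω}
  {𝓕 : ℕ → MeasurableSpace Ω} {Y : ℕ → Ω → ℝ} {q : AddMonoidAlgebra ℝ ℝ}

lemma measureReal_eq_sum_fiber [IsFiniteMeasure P] {E : Set Ω} (hE : MeasurableSet E) {f : Ω → ℝ} (hf : Measurable f)
    {I : Finset ℝ} (hI : ∀ᵐ ω ∂P, f ω ∈ I) :
    P.real E = ∑ x ∈ I, P.real (E ∩ {ω | f ω = x}) := by
  rw [← measureReal_biUnion_finset]
  · refine measureReal_congr ?_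
    filter_upwards [hI] with ω hω
    refine propext ⟨fun h => ?_, fun h => ?_⟩
    · exact Set.mem_biUnion hω ⟨h, rfl⟩
    · obtain ⟨x, -, h'⟩ := Set.mem_iUnion₂.1 h
      exact h'.1
  · intro x _ x' _ hxx'
    refine Set.disjoint_left.2 fun ω h h' => hxx' ?_
    rw [← h.2, ← h'.2]
  · exact fun x _ => hE.inter (hf (measurableSet_singleton x))

lemma measurable_shiftSum (h : IsStepSequence P 𝓕 Y q) (m n : ℕ) :
    Measurable[𝓕 (m + n)] (shiftSum Y m n) := by
  unfold shiftSum
  refine @Finset.measurable_fun_sum _ _ _ _ _ _ (𝓕 (m + n)) _ _ fun k hk => ?_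
  exact (h.measurable (m + k)).mono (h.mono (by simp at hk; omega)) le_rfl

lemma measurableSet_stayEvent (h : IsStepSequence P 𝓕 Y q) (m : ℕ) (y : ℝ) (n : ℕ) :
    MeasurableSet[𝓕 (m + n)] (stayEvent Y m y n) := by
  have : stayEvent Y m y n = ⋂ j : ℕ, ⋂ _ : 1 ≤ j, ⋂ _ : j ≤ n,
      {ω | shiftSum Y m j ω ≤ y} := by
    ext ω; simp [stayEvent]
  rw [this]
  refine @MeasurableSet.iInter _ _ (𝓕 (m + n)) _ _ fun j => ?_
  refine @MeasurableSet.iInter _ _ (𝓕 (m + n)) _ _ fun _ => ?_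
  refine @MeasurableSet.iInter _ _ (𝓕 (m + n)) _ _ fun hj => ?_
  exact ((measurable_shiftSum h m j).mono (h.mono (by omega)) le_rfl) measurableSet_Iic

lemma measurableSet_fiber (h : IsStepSequence P 𝓕 Y q) (m n : ℕ) (z : ℝ) :
    MeasurableSet[𝓕 (m + n)] {ω | shiftSum Y m n ω = z} :=
  (measurable_shiftSum h m n) (measurableSet_singleton z)

lemma exists_finset_shiftSum_mem (h : IsStepSequence P 𝓕 Y q) (m n : ℕ) :
    ∃ J : Finset ℝ, ∀ᵐ ω ∂P, shiftSum Y m n ω ∈ J := by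
  classical
  induction n with
  | zero => exact ⟨{0}, by simp [shiftSum]⟩
  | succ n ih =>
    obtain ⟨J, hJ⟩ := ih
    refine ⟨Finset.image₂ (· + ·) J q.coeff.support, ?_⟩
    filter_upwards [hJ, h.mem_support (m + n)] with ω h1 h2
    rw [shiftSum, Finset.sum_range_succ]
    exact Finset.mem_image₂_of_mem h1 h2

lemma IsStepSequence.neg (h : IsStepSequence P 𝓕 Y q) :
    IsStepSequence P 𝓕 (fun n ω => -Y n ω) (reflectMass q) where
  le := h.le
  mono := h.mono
  measurable n := (h.measurable n).neg
  indep n E hE x := by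
    rw [coeff_reflectMass, ← h.indep n E hE (-x)]
    congr 2
    ext ω
    simp only [Set.mem_ofPred_eq]
    exact neg_eq_iff_eq_neg
  mem_support n := by
    filter_upwards [h.mem_support n] with ω hω
    rwa [mem_support_reflectMass, neg_neg]

variable [IsProbabilityMeasure P]

lemma measureReal_inter_shiftSum_succ (h : IsStepSequence P 𝓕 Y q) {m n : ℕ} {E : Set Ω}
    (hE : MeasurableSet[𝓕 (m + n)] E) (z : ℝ) :
    P.real (E ∩ {ω | shiftSum Y m (n + 1) ω = z}) =
      ∑ x ∈ q.coeff.support, q.coeff x * P.real (E ∩ {ω | shiftSum Y m n ω = z - x}) := by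
  have hY : Measurable (Y (m + n)) := (h.measurable (m + n)).mono (h.le _) le_rfl
  have hE' : MeasurableSet (E ∩ {ω | shiftSum Y m (n + 1) ω = z}) :=
    (h.le _ _ hE).inter (h.le _ _ (measurableSet_fiber h m (n + 1) z))
  rw [measureReal_eq_sum_fiber hE' hY (h.mem_support (m + n))]
  refine Finset.sum_congr rfl fun x _ => ?_
  have hset : E ∩ {ω | shiftSum Y m (n + 1) ω = z} ∩ {ω | Y (m + n) ω = x} =
      E ∩ {ω | shiftSum Y m n ω = z - x} ∩ {ω | Y (m + n) ω = x} := by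
    ext ω
    simp only [Set.mem_inter_iff, Set.mem_ofPred_eq, shiftSum, Finset.sum_range_succ]
    constructor
    · rintro ⟨⟨h1, h2⟩, h3⟩
      exact ⟨⟨h1, by rw [← h2, h3]; ring⟩, h3⟩
    · rintro ⟨⟨h1, h2⟩, h3⟩
      exact ⟨⟨h1, by rw [h2, h3]; ring⟩, h3⟩
  have hE'' : MeasurableSet[𝓕 (m + n)] (E ∩ {ω | shiftSum Y m n ω = z - x}) :=
    @MeasurableSet.inter _ (𝓕 (m + n)) _ _ hE (measurableSet_fiber h m n (z - x))
  rw [hset, h.indep (m + n) _ hE'', mul_comm]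

/-- Induction on `n`, conditioning on the last step. Carrying an event `E` known at time `m` through
the induction yields the Markov property at time `m` in the same stroke. -/
lemma measureReal_stayEvent (h : IsStepSequence P 𝓕 Y q) {m : ℕ} {E : Set Ω}
    (hE : MeasurableSet[𝓕 m] E) (y : ℝ) (n : ℕ) (z : ℝ) :
    P.real (E ∩ stayEvent Y m y n ∩ {ω | shiftSum Y m n ω = z}) =
      P.real E * (stayMass q y n).coeff z := by
  classical
  induction n generalizing z with
  | zero =>
    rw [stayMass, AddMonoidAlgebra.one_def, AddMonoidAlgebra.coeff_single, Finsupp.single_apply]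
    have hstay : stayEvent Y m y 0 = Set.univ := by
      ext ω; simp only [stayEvent, Set.mem_ofPred_eq, Set.mem_univ, iff_true]; intros; omega
    rw [hstay, Set.inter_univ]
    by_cases hz : 0 = z
    · rw [if_pos hz]
      simp [shiftSum, hz]
    · rw [if_neg hz]
      simp [shiftSum, hz]
  | succ n ih =>
    rw [stayMass, coeff_restrictMass]
    by_cases hz : z ∈ Set.Iic y
    · rw [if_pos hz, mul_comm (stayMass q y n) q, coeff_mul_eq_sum]
      have hset : E ∩ stayEvent Y m y (n + 1) ∩ {ω | shiftSum Y m (n + 1) ω = z} =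
          E ∩ stayEvent Y m y n ∩ {ω | shiftSum Y m (n + 1) ω = z} := by
        ext ω
        simp only [Set.mem_inter_iff, Set.mem_ofPred_eq, stayEvent]
        constructor
        · rintro ⟨⟨h1, h2⟩, h3⟩
          exact ⟨⟨h1, fun j hj hjn => h2 j hj (by omega)⟩, h3⟩
        · rintro ⟨⟨h1, h2⟩, h3⟩
          refine ⟨⟨h1, fun j hj hjn => ?_⟩, h3⟩
          rcases Nat.lt_or_ge j (n + 1) with hlt | hge
          · exact h2 j hj (by omega)
          · have : j = n + 1 := by omega
            rw [this, h3]; exact hz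
      rw [hset, measureReal_inter_shiftSum_succ h (@MeasurableSet.inter _ (𝓕 (m + n)) _ _
        (h.mono (by omega) _ hE) (measurableSet_stayEvent h m y n)), Finset.mul_sum]
      refine Finset.sum_congr rfl fun x _ => ?_
      rw [ih]
      ring
    · rw [if_neg hz, mul_zero]
      have : E ∩ stayEvent Y m y (n + 1) ∩ {ω | shiftSum Y m (n + 1) ω = z} = ∅ := by
        ext ω
        simp only [Set.mem_inter_iff, Set.mem_ofPred_eq, stayEvent, Set.mem_empty_iff_false,
          iff_false]
        rintro ⟨⟨-, h2⟩, h3⟩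
        exact hz (h3 ▸ h2 (n + 1) (by omega) le_rfl)
      rw [this]
      simp

lemma measureReal_passage (h : IsStepSequence P 𝓕 Y q) {m : ℕ} {E : Set Ω}
    (hE : MeasurableSet[𝓕 m] E) {y : ℝ} (n : ℕ) {z : ℝ} (hz : y < z) :
    P.real (E ∩ stayEvent Y m y n ∩ {ω | shiftSum Y m (n + 1) ω = z}) =
      P.real E * (passMass q y (n + 1)).coeff z := by
  classical
  rw [passMass, coeff_restrictMass, if_pos (Set.mem_Ioi.2 hz), mul_comm (stayMass q y n) q,
    coeff_mul_eq_sum, measureReal_inter_shiftSum_succ h (@MeasurableSet.inter _ (𝓕 (m + n)) _ _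
      (h.mono (by omega) _ hE) (measurableSet_stayEvent h m y n)), Finset.mul_sum]
  refine Finset.sum_congr rfl fun x _ => ?_
  rw [measureReal_stayEvent h hE]
  ring

lemma measureReal_passage_total (h : IsStepSequence P 𝓕 Y q) {m : ℕ} {E : Set Ω}
    (hE : MeasurableSet[𝓕 m] E) (y : ℝ) (n : ℕ) :
    P.real (E ∩ stayEvent Y m y n ∩ {ω | y < shiftSum Y m (n + 1) ω}) =
      P.real E * realLaplace 0 (passMass q y (n + 1)) := by
  classical
  obtain ⟨J, hJ⟩ := exists_finset_shiftSum_mem h m (n + 1)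
  set I := J ∪ (passMass q y (n + 1)).coeff.support
  have hI : ∀ᵐ ω ∂P, shiftSum Y m (n + 1) ω ∈ I := by
    filter_upwards [hJ] with ω hω using Finset.mem_union_left _ hω
  have hf : Measurable (shiftSum Y m (n + 1)) := (measurable_shiftSum h m (n + 1)).mono (h.le _) le_rfl
  have hmeas : MeasurableSet (E ∩ stayEvent Y m y n ∩ {ω | y < shiftSum Y m (n + 1) ω}) :=
    ((h.le _ _ hE).inter (h.le _ _ (measurableSet_stayEvent h m y n))).inter (hf measurableSet_Ioi)
  have h1 : realLaplace 0 (passMass q y (n + 1)) =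
      ∑ z ∈ I, (passMass q y (n + 1)).coeff z := by
    rw [realLaplace_zero_eq_sum]
    exact Finset.sum_subset Finset.subset_union_right fun z _ hz => by simpa using hz
  rw [measureReal_eq_sum_fiber hmeas hf hI, h1, Finset.mul_sum]
  refine Finset.sum_congr rfl fun z _ => ?_
  by_cases hz : y < z
  · rw [← measureReal_passage h hE n hz]
    congr 1
    ext ω
    simp only [Set.mem_inter_iff, Set.mem_ofPred_eq]
    constructor
    · rintro ⟨⟨h1, -⟩, h3⟩; exact ⟨h1, h3⟩
    · rintro ⟨h1, h3⟩; exact ⟨⟨h1, h3 ▸ hz⟩, h3⟩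
  · rw [supportedIn_passMass y (n + 1) z (by simpa using hz), mul_zero]
    have : E ∩ stayEvent Y m y n ∩ {ω | y < shiftSum Y m (n + 1) ω} ∩
        {ω | shiftSum Y m (n + 1) ω = z} = ∅ := by
      ext ω
      simp only [Set.mem_inter_iff, Set.mem_ofPred_eq, Set.mem_empty_iff_false, iff_false]
      rintro ⟨⟨-, h2⟩, h3⟩
      exact hz (h3 ▸ h2)
    rw [this]
    simp

end Link

/-! ### The step mass function and the filtration of an i.i.d. sequence. -/

section Construction

variable {Ω : Type*} [mΩ : MeasurableSpace Ω] {P : Measure Ω}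
  {X : ℕ → Ω → ℝ}

/-- The σ-algebra generated by the first `n` steps. -/
@[reducible]
def pastAlgebra (X : ℕ → Ω → ℝ) (n : ℕ) : MeasurableSpace Ω :=
  ⨆ k ∈ Set.Iio n, MeasurableSpace.comap (X k) inferInstance

lemma exists_isStepMass [IsProbabilityMeasure P] {Z : Ω → ℝ} (hZ : Measurable Z) (hfin : ∃ F : Finset ℝ, ∀ᵐ ω ∂P, Z ω ∈ F)
    (hmean : ∫ ω, Z ω ∂P = 0) (hnondeg : ¬ ∀ᵐ ω ∂P, Z ω = 0) :
    ∃ p : AddMonoidAlgebra ℝ ℝ, IsStepMass p ∧ (∀ x, p.coeff x = P.real {ω | Z ω = x}) ∧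
      ∀ᵐ ω ∂P, Z ω ∈ p.coeff.support := by
  classical
  obtain ⟨F, hF⟩ := hfin
  have hout : ∀ x, x ∉ F → P.real {ω | Z ω = x} = 0 := by
    intro x hx
    rw [measureReal_eq_zero_iff]
    refine measure_mono_null (fun ω hω => ?_) hF
    rw [Set.mem_ofPred_eq] at hω
    simpa [hω] using hx
  let p : AddMonoidAlgebra ℝ ℝ := .ofCoeff (Finsupp.onFinset F (fun x => P.real {ω | Z ω = x})
    fun x hx => by_contra fun h => hx (hout x h))
  have hp : ∀ x, p.coeff x = P.real {ω | Z ω = x} := fun x => rfl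
  have hexp : ∀ f : ℝ → ℝ, ∫ ω, f (Z ω) ∂P = ∑ x ∈ p.coeff.support, p.coeff x * f x := by
    intro f
    have h1 : ∑ x ∈ p.coeff.support, p.coeff x * f x = ∑ x ∈ F, p.coeff x * f x := by
      refine Finset.sum_subset (fun x hx => ?_) fun x _ hx => ?_
      · by_contra h; exact Finsupp.mem_support_iff.1 hx (hout x h)
      · rw [Finsupp.notMem_support_iff.1 hx, zero_mul]
    have h2 : ∀ᵐ ω ∂P, f (Z ω) = ∑ x ∈ F, ({ω | Z ω = x} : Set Ω).indicator (fun _ => f x) ω := by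
      filter_upwards [hF] with ω hω
      rw [Finset.sum_eq_single_of_mem (Z ω) hω]
      · simp
      · intro x _ hx
        rw [Set.indicator_of_notMem]
        exact fun h => hx h.symm
    rw [h1, integral_congr_ae h2, integral_finsetSum]
    · refine Finset.sum_congr rfl fun x _ => ?_
      have hmx : MeasurableSet {ω | Z ω = x} := hZ (measurableSet_singleton x)
      rw [integral_indicator_const _ hmx, smul_eq_mul, hp]
    · exact fun x _ => (integrable_const _).indicator (hZ (measurableSet_singleton x))
  have hsupp : ∀ᵐ ω ∂P, Z ω ∈ p.coeff.support := by
    have h1 : ∀ x ∈ F, ∀ᵐ ω ∂P, x ∉ p.coeff.support → Z ω ≠ x := by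
      intro x _
      by_cases hx : x ∈ p.coeff.support
      · exact Eventually.of_forall fun ω h => absurd hx h
      · rw [Finsupp.notMem_support_iff, hp, measureReal_eq_zero_iff] at hx
        have : ∀ᵐ ω ∂P, ¬ Z ω = x := by
          rw [ae_iff]; simpa using hx
        filter_upwards [this] with ω hω _ using hω
    filter_upwards [(Finset.eventually_all F).2 h1, hF] with ω h2 h3
    by_contra h
    exact h2 (Z ω) h3 h rfl
  refine ⟨p, ⟨fun x => measureReal_nonneg, ?_, ?_, ?_⟩, hp, hsupp⟩
  · have := hexp fun _ => 1
    simpa using this.symm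
  · rw [← hexp fun x => x, hmean]
  · rw [← hexp fun x => x ^ 2]
    refine lt_of_le_of_ne (integral_nonneg fun ω => sq_nonneg _) fun h0 => hnondeg ?_
    rw [hexp fun x => x ^ 2] at h0
    have hz := (Finset.sum_eq_zero_iff_of_nonneg fun x _ =>
      mul_nonneg (measureReal_nonneg (μ := P) (s := {ω | Z ω = x})) (sq_nonneg x)).1 h0.symm
    filter_upwards [hsupp] with ω hω
    rcases mul_eq_zero.1 (hz _ hω) with h | h
    · exact absurd h (Finsupp.mem_support_iff.1 hω)
    · exact pow_eq_zero_iff two_ne_zero |>.1 h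

lemma isStepSequence_pastAlgebra (hmeas : ∀ n, Measurable (X n)) (hindep : iIndepFun X P)
    (hident : ∀ n, IdentDistrib (X n) (X 0) P P) {p : AddMonoidAlgebra ℝ ℝ}
    (hp : ∀ x, p.coeff x = P.real {ω | X 0 ω = x}) (hsupp : ∀ᵐ ω ∂P, X 0 ω ∈ p.coeff.support) :
    IsStepSequence P (pastAlgebra X) X p where
  le n := iSup₂_le fun k _ => (hmeas k).comap_le
  mono m n hmn := iSup₂_le fun k hk =>
    le_iSup₂_of_le (f := fun k (_ : k ∈ Set.Iio n) => MeasurableSpace.comap (X k) inferInstance)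
      k (lt_of_lt_of_le hk hmn) le_rfl
  measurable n := by
    rw [measurable_iff_comap_le]
    exact le_iSup₂_of_le (f := fun k (_ : k ∈ Set.Iio (n + 1)) =>
      MeasurableSpace.comap (X k) inferInstance) n (Nat.lt_succ_self n) le_rfl
  indep n E hE x := by
    have h1 := indep_iSup_of_disjoint (fun k => (hmeas k).comap_le) hindep
      (S := Set.Iio n) (T := {n}) (by simp)
    have h2 := (Indep_iff _ _ P).1 h1 E {ω | X n ω = x} hE (by
      rw [iSup_singleton]
      exact ⟨{x}, measurableSet_singleton x, rfl⟩)
    rw [measureReal_def, h2, ENNReal.toReal_mul, hp]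
    congr 1
    have h3 := (hident n).measure_mem_eq (measurableSet_singleton x)
    exact congrArg ENNReal.toReal h3
  mem_support n := by
    exact (hident n).symm.ae_mem_snd (Finset.measurableSet p.coeff.support) hsupp

end Construction

/-! ### First times as infima in `ℕ∞`. -/

section FirstTime

variable {Q : ℕ → Prop}

lemma sInf_natCast_eq_iff {n : ℕ} :
    sInf {s : ℕ∞ | ∃ t : ℕ, s = (t : ℕ∞) ∧ Q t} = (n : ℕ∞) ↔ Q n ∧ ∀ k < n, ¬ Q k := by
  constructor
  · intro h
    have hne : {s : ℕ∞ | ∃ t : ℕ, s = (t : ℕ∞) ∧ Q t}.Nonempty := by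
      by_contra h'
      rw [Set.not_nonempty_iff_eq_empty] at h'
      rw [h', sInf_empty] at h
      exact ENat.natCast_ne_top n h.symm
    have hmem := csInf_mem hne
    rw [h] at hmem
    obtain ⟨t, ht, hQ⟩ := hmem
    rw [Nat.cast_inj] at ht
    subst ht
    refine ⟨hQ, fun k hk hQk => ?_⟩
    have : sInf {s : ℕ∞ | ∃ t : ℕ, s = (t : ℕ∞) ∧ Q t} ≤ k := sInf_le ⟨k, rfl, hQk⟩
    rw [h, Nat.cast_le] at this
    omega
  · rintro ⟨h1, h2⟩
    refine le_antisymm (sInf_le ⟨n, rfl, h1⟩) (le_sInf ?_)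
    rintro s ⟨t, rfl, ht⟩
    rw [Nat.cast_le]
    by_contra hlt
    exact h2 t (by omega) ht

end FirstTime

/-! ### Crossings of a deterministic path. -/

section Path

variable {S : ℕ → ℝ}

/-- The path changes sign between times `n` and `n + 1`. -/
def IsCrossing (S : ℕ → ℝ) (n : ℕ) : Prop := pathSign S n * pathSign S (n + 1) = -1

lemma pathSign_eq_one_or (S : ℕ → ℝ) (n : ℕ) : pathSign S n = 1 ∨ pathSign S n = -1 := by
  induction n with
  | zero => exact Or.inl rfl
  | succ n ih =>
    rw [pathSign]
    split_ifs
    · exact Or.inl rfl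
    · exact Or.inr rfl
    · exact ih

lemma pathSign_succ_eq_iff (S : ℕ → ℝ) (n : ℕ) :
    pathSign S (n + 1) = pathSign S n ↔ 0 ≤ (pathSign S n : ℝ) * S (n + 1) := by
  rw [pathSign]
  rcases pathSign_eq_one_or S n with h | h <;> rw [h] <;> split_ifs with h1 h2 <;>
    simp <;> linarith

lemma isCrossing_iff (S : ℕ → ℝ) (n : ℕ) :
    IsCrossing S n ↔ (pathSign S n : ℝ) * S (n + 1) < 0 := by
  rw [← not_le, ← pathSign_succ_eq_iff, IsCrossing]
  rcases pathSign_eq_one_or S n with h | h <;> rcases pathSign_eq_one_or S (n + 1) with h' | h' <;>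
    rw [h, h'] <;> decide

lemma pathSign_mul_nonneg (h0 : S 0 = 0) (n : ℕ) : 0 ≤ (pathSign S n : ℝ) * S n := by
  cases n with
  | zero => simp [h0]
  | succ n =>
    rw [pathSign]
    split_ifs with h1 h2
    · simpa using h1.le
    · simpa using h2.le
    · rw [le_antisymm (not_lt.1 h1) (not_lt.1 h2), mul_zero]

/-- Until its next crossing the path keeps its sign. -/
lemma forall_not_isCrossing_iff (S : ℕ → ℝ) (a k : ℕ) :
    ((∀ j < k, ¬ IsCrossing S (a + j)) ↔
      ∀ j < k, 0 ≤ (pathSign S a : ℝ) * S (a + j + 1)) ∧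
    ((∀ j < k, ¬ IsCrossing S (a + j)) → pathSign S (a + k) = pathSign S a) := by
  induction k with
  | zero => simp
  | succ k ih =>
    have key : (∀ j < k, ¬ IsCrossing S (a + j)) →
        (¬ IsCrossing S (a + k) ↔ 0 ≤ (pathSign S a : ℝ) * S (a + k + 1)) := fun h => by
      rw [isCrossing_iff, not_lt, ih.2 h]
    constructor
    · rw [Nat.forall_lt_succ_right, Nat.forall_lt_succ_right, ← ih.1]
      exact and_congr_right key
    · rw [Nat.forall_lt_succ_right]
      rintro ⟨h1, h2⟩
      have h3 := (key h1).1 h2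
      rw [← ih.2 h1, ← pathSign_succ_eq_iff, ih.2 h1] at h3
      exact h3

lemma isCrossing_first_iff (S : ℕ → ℝ) (a k : ℕ) :
    (IsCrossing S (a + k) ∧ ∀ j < k, ¬ IsCrossing S (a + j)) ↔
      (pathSign S a : ℝ) * S (a + k + 1) < 0 ∧
        ∀ j < k, 0 ≤ (pathSign S a : ℝ) * S (a + j + 1) := by
  obtain ⟨h1, h2⟩ := forall_not_isCrossing_iff S a k
  rw [← h1]
  refine and_congr_left fun h => ?_
  rw [isCrossing_iff, h2 h]

lemma crossingTime_succ_eq_iff {i m n : ℕ} (hm : crossingTime S i = m) :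
    crossingTime S (i + 1) = n ↔ (m < n ∧ IsCrossing S n) ∧ ∀ k < n, ¬ (m < k ∧ IsCrossing S k) := by
  rw [← sInf_natCast_eq_iff (Q := fun k => m < k ∧ IsCrossing S k), crossingTime, hm]
  have : {s : ℕ∞ | ∃ n : ℕ, s = (n : ℕ∞) ∧ (m : ℕ∞) < s ∧
      pathSign S n * pathSign S (n + 1) = -1} =
      {s : ℕ∞ | ∃ t : ℕ, s = (t : ℕ∞) ∧ m < t ∧ IsCrossing S t} := by
    ext s
    refine exists_congr fun t => and_congr_right fun h => ?_
    rw [h, Nat.cast_lt]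
    rfl
  rw [this]

lemma crossingTime_succ_of_eq_top {i : ℕ} (h : crossingTime S i = ⊤) :
    crossingTime S (i + 1) = ⊤ := by
  rw [crossingTime, sInf_eq_top, h]
  rintro s ⟨n, rfl, hn, -⟩
  exact absurd hn (by simp)

lemma crossingTime_lt_succ {i m : ℕ} (hm : crossingTime S i = m) :
    (m : ℕ∞) < crossingTime S (i + 1) := by
  rcases eq_or_ne (crossingTime S (i + 1)) ⊤ with h | h
  · rw [h]; exact ENat.natCast_lt_top m
  · obtain ⟨n, h⟩ := ENat.ne_top_iff_exists.1 h
    rw [← h]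
    exact Nat.cast_lt.2 ((crossingTime_succ_eq_iff hm).1 h.symm).1.1

lemma crossingTime_eq_succ_iff {i n : ℕ} :
    crossingTime S (i + 1) = n ↔ ∃ m < n, crossingTime S i = m ∧ IsCrossing S n ∧
      ∀ k < n, m < k → ¬ IsCrossing S k := by
  constructor
  · intro h
    rcases eq_or_ne (crossingTime S i) ⊤ with hm | hm
    · rw [crossingTime_succ_of_eq_top hm] at h
      exact absurd h.symm (ENat.natCast_ne_top n)
    · obtain ⟨m, hm⟩ := ENat.ne_top_iff_exists.1 hm
      replace hm := hm.symm
      obtain ⟨⟨h1, h2⟩, h3⟩ := (crossingTime_succ_eq_iff hm).1 h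
      exact ⟨m, h1, hm, h2, fun k hk hmk hC => h3 k hk ⟨hmk, hC⟩⟩
  · rintro ⟨m, h1, hm, h2, h3⟩
    exact (crossingTime_succ_eq_iff hm).2 ⟨⟨h1, h2⟩, fun k hk h => h3 k hk h.1 h.2⟩

lemma interTime_ne_zero {i m : ℕ} (hm : crossingTime S i = m) : interTime S i ≠ 0 := by
  rw [interTime, hm, Ne, tsub_eq_zero_iff_le, not_le]
  exact crossingTime_lt_succ hm

/-- After a crossing time `m`, the next crossing happens when the path first leaves the half-line
on which it is at time `m + 1`. -/
lemma interTime_eq_succ_iff {i m : ℕ} (hm : crossingTime S i = m) (k : ℕ) :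
    interTime S i = ((k + 1 : ℕ) : ℕ∞) ↔ (pathSign S (m + 1) : ℝ) * S (m + 1 + k + 1) < 0 ∧
      ∀ j < k, 0 ≤ (pathSign S (m + 1) : ℝ) * S (m + 1 + j + 1) := by
  rw [← isCrossing_first_iff]
  -- A crossing time is the last time before the change of sign, and the landing is one step later.
  -- The differences agree: `k + 1` is also the number of steps from the landing at `m + 1` to the
  -- next landing.
  have h1 : interTime S i = ((k + 1 : ℕ) : ℕ∞) ↔
      crossingTime S (i + 1) = ((m + 1 + k : ℕ) : ℕ∞) := by
    rw [interTime, hm]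
    rcases eq_or_ne (crossingTime S (i + 1)) ⊤ with hn | hn
    · rw [hn, ENat.top_sub_natCast]
      exact iff_of_false (ENat.natCast_ne_top _).symm (ENat.natCast_ne_top _).symm
    · obtain ⟨n, hn⟩ := ENat.ne_top_iff_exists.1 hn
      rw [← hn, ← ENat.natCast_sub, Nat.cast_inj, Nat.cast_inj]
      omega
  rw [h1, crossingTime_succ_eq_iff hm]
  constructor
  · rintro ⟨⟨-, h2⟩, h3⟩
    exact ⟨h2, fun j hj h => h3 (m + 1 + j) (by omega) ⟨by omega, h⟩⟩
  · rintro ⟨h2, h3⟩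
    refine ⟨⟨by omega, h2⟩, fun j hj h => ?_⟩
    have h4 := h3 (j - (m + 1)) (by omega)
    rw [show m + 1 + (j - (m + 1)) = j by omega] at h4
    exact h4 h.2

lemma interTime_eq_top_iff {i m : ℕ} (hm : crossingTime S i = m) :
    interTime S i = ⊤ ↔ crossingTime S (i + 1) = ⊤ := by
  rw [interTime, hm]
  simp [ENat.sub_eq_top_iff]

lemma eq_zero_or_isCrossing {i m : ℕ} (hm : crossingTime S i = m) : m = 0 ∨ IsCrossing S m := by
  cases i with
  | zero =>
    left
    rw [crossingTime] at hm
    exact_mod_cast hm.symm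
  | succ i =>
    obtain ⟨-, -, -, h, -⟩ := crossingTime_eq_succ_iff.1 hm
    exact Or.inr h

/-- After a genuine crossing the landing value is nonzero. A zero at time `m + 1` is possible only
for `m = 0`, where the sign `+1` of the start persists; so the sign depends on the landing value
alone, with zero counted as positive. -/
lemma pathSign_crossingTime {i m : ℕ} (hm : crossingTime S i = m) :
    pathSign S (m + 1) = if 0 ≤ S (m + 1) then 1 else -1 := by
  rcases lt_trichotomy (S (m + 1)) 0 with h | h | h
  · rw [if_neg (not_le.2 h), pathSign, if_neg (not_lt.2 h.le), if_pos h]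
  · rcases eq_zero_or_isCrossing hm with h' | h'
    · subst h'
      rw [if_pos h.ge, pathSign, if_neg h.not_gt, if_neg h.not_lt, pathSign]
    · rw [isCrossing_iff, h, mul_zero] at h'
      exact absurd h' (lt_irrefl 0)
  · rw [if_pos h.le, pathSign, if_pos h]

/-- The crossing step joins the two sides of zero, or starts at zero, so the landing point is no
farther from zero than the length of that step. -/
lemma abs_le_abs_sub_of_crossingTime (h0 : S 0 = 0) {i m : ℕ} (hm : crossingTime S i = m) :
    |S (m + 1)| ≤ |S (m + 1) - S m| := by
  rcases eq_zero_or_isCrossing hm with h | h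
  · subst h; rw [h0, sub_zero]
  · rw [isCrossing_iff] at h
    have h1 := pathSign_mul_nonneg h0 m
    rcases pathSign_eq_one_or S m with h2 | h2 <;> rw [h2] at h h1 <;> push_cast at h h1
    · rw [abs_of_neg (by linarith), abs_of_neg (by linarith)]; linarith
    · rw [abs_of_pos (by linarith), abs_of_pos (by linarith)]; linarith

end Path

/-! ### Measurability of crossing times. -/

section Measurability

variable {Ω : Type*} [MeasurableSpace Ω] {S : Ω → ℕ → ℝ} {n : ℕ}

lemma measurable_pathSign (hS : ∀ k ≤ n, Measurable fun ω => S ω k) :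
    Measurable fun ω => pathSign (S ω) n := by
  induction n with
  | zero => exact measurable_const
  | succ n ih =>
    simp only [pathSign]
    have h := hS (n + 1) le_rfl
    exact Measurable.ite (h measurableSet_Ioi) measurable_const
      (Measurable.ite (h measurableSet_Iio) measurable_const (ih fun k hk => hS k (by omega)))

lemma measurableSet_isCrossing (hS : ∀ k ≤ n + 1, Measurable fun ω => S ω k) :
    MeasurableSet {ω | IsCrossing (S ω) n} :=
  ((measurable_pathSign fun k hk => hS k (by omega)).mul (measurable_pathSign hS))
    (measurableSet_singleton (-1 : ℤ))

/-- A crossing at `n` is recognised only at time `n + 1`, so it is `t_i + 1`, not `t_i`, that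
behaves as a stopping time. -/
lemma measurableSet_crossingTime_eq (i : ℕ) (hS : ∀ k ≤ n + 1, Measurable fun ω => S ω k) :
    MeasurableSet {ω | crossingTime (S ω) i = n} := by
  induction i generalizing n with
  | zero => simp only [crossingTime]; exact MeasurableSet.const _
  | succ i ih =>
    simp only [crossingTime_eq_succ_iff]
    have : {ω | ∃ m < n, crossingTime (S ω) i = m ∧ IsCrossing (S ω) n ∧
        ∀ k < n, m < k → ¬ IsCrossing (S ω) k} =
        ⋃ m ∈ Set.Iio n, ({ω | crossingTime (S ω) i = m} ∩ {ω | IsCrossing (S ω) n} ∩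
          ⋂ k ∈ Set.Ioo m n, {ω | IsCrossing (S ω) k}ᶜ) := by
      ext ω
      simp only [Set.mem_ofPred_eq, Set.mem_iUnion, Set.mem_Iio, Set.mem_inter_iff, Set.mem_iInter,
        Set.mem_Ioo, Set.mem_compl_iff, exists_prop]
      refine exists_congr fun m => and_congr_right fun _ => ?_
      rw [and_assoc]
      refine and_congr_right fun _ => and_congr_right fun _ => ?_
      exact ⟨fun h k hk => h k hk.2 hk.1, fun h k h1 h2 => h k ⟨h2, h1⟩⟩
    rw [this]
    refine MeasurableSet.biUnion (Set.to_countable _) fun m hm => ?_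
    rw [Set.mem_Iio] at hm
    refine ((ih fun k hk => hS k (by omega)).inter (measurableSet_isCrossing hS)).inter ?_
    refine MeasurableSet.biInter (Set.to_countable _) fun k hk => ?_
    exact (measurableSet_isCrossing fun j hj => hS j (by have := hk.2; omega)).compl

lemma measurable_of_measurableSet_eq_natCast {T : Ω → ℕ∞}
    (hn : ∀ n : ℕ, MeasurableSet {ω | T ω = n}) : Measurable T := by
  refine measurable_to_countable' fun t => ?_
  rcases eq_or_ne t ⊤ with rfl | ht
  · have : T ⁻¹' {⊤} = (⋃ n : ℕ, {ω | T ω = n})ᶜ := by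
      ext ω
      simp only [Set.mem_preimage, Set.mem_singleton_iff, Set.mem_compl_iff, Set.mem_iUnion,
        Set.mem_ofPred_eq]
      constructor
      · rintro h ⟨n, hn⟩
        rw [h] at hn; exact ENat.natCast_ne_top n hn.symm
      · intro h
        by_contra h'
        exact h ⟨_, (ENat.natCast_toNat h').symm⟩
    rw [this]
    exact (MeasurableSet.iUnion hn).compl
  · obtain ⟨n, rfl⟩ := ENat.ne_top_iff_exists.1 ht
    exact hn n

lemma measurable_crossingTime (i : ℕ) (hS : ∀ k, Measurable fun ω => S ω k) :
    Measurable fun ω => crossingTime (S ω) i :=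
  measurable_of_measurableSet_eq_natCast fun _ => measurableSet_crossingTime_eq i fun k _ => hS k

end Measurability

/-! ### Laws at landing points and sums over countable fibres. -/

/-- Mass function of the time after which a walk, which has just crossed zero and landed at `x`,
crosses zero again. -/
noncomputable def crossMass (p : AddMonoidAlgebra ℝ ℝ) (x : ℝ) (n : ℕ) : ℝ :=
  realLaplace 0 (passMass (if 0 ≤ x then reflectMass p else p) |x| n)

/-- Position of the path right after its `i`-th crossing time. -/
noncomputable def crossingValue (S : ℕ → ℝ) (i : ℕ) : ℝ := S ((crossingTime S i).toNat + 1)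

lemma IsStepMass.ite_reflect {p : AddMonoidAlgebra ℝ ℝ} (hp : IsStepMass p) (x : ℝ) :
    IsStepMass (if 0 ≤ x then reflectMass p else p) := by
  split_ifs
  exacts [hp.reflect, hp]

lemma IsStepMass.hasSum_crossMass {p : AddMonoidAlgebra ℝ ℝ} (hp : IsStepMass p) (x : ℝ) :
    HasSum (crossMass p x) 1 := by
  have h := (hp.ite_reflect x).summable_passMass |x|
  have h2 := h.hasSum
  rw [(hp.ite_reflect x).tsum_passMass (abs_nonneg x)] at h2
  exact h2

lemma hasSum_measureReal_fiber {Ω α : Type*} [MeasurableSpace Ω] {P : Measure Ω}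
    [IsFiniteMeasure P] [MeasurableSpace α] [MeasurableSingletonClass α] {E : Set Ω}
    (hE : MeasurableSet E) {f : Ω → α} (hf : Measurable f) {D : Set α} (hD : D.Countable)
    (hfD : ∀ᵐ ω ∂P, ω ∈ E → f ω ∈ D) :
    HasSum (fun x : D => P.real (E ∩ {ω | f ω = x})) (P.real E) := by
  have : Countable D := hD
  have h1 : P E = ∑' x : D, P (E ∩ {ω | f ω = x}) := by
    rw [← measure_iUnion]
    · refine measure_congr ?_
      filter_upwards [hfD] with ω hω
      refine propext ⟨fun h => ?_, fun h => ?_⟩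
      · exact Set.mem_iUnion.2 ⟨⟨f ω, hω h⟩, h, rfl⟩
      · obtain ⟨x, h'⟩ := Set.mem_iUnion.1 h
        exact h'.1
    · intro x x' hxx'
      refine Set.disjoint_left.2 fun ω h h' => hxx' (Subtype.ext ?_)
      rw [← h.2, ← h'.2]
    · exact fun x => hE.inter (hf (measurableSet_singleton _))
  have h2 : ∑' x : D, P (E ∩ {ω | f ω = x}) ≠ ⊤ := h1 ▸ measure_ne_top P E
  rw [measureReal_def, h1, ENNReal.tsum_toReal_eq (fun x => measure_ne_top _ _)]
  exact (ENNReal.summable_toReal h2).hasSum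

/-! ### Crossing and jump times of the random walk. -/

section Walk

section Pointwise

variable {Ω : Type*} {X : ℕ → Ω → ℝ}

lemma walkFrom_eq_shiftSum (a : ℝ) (ω : Ω) (n : ℕ) :
    walkFrom a (fun n => X n ω) n = a + shiftSum X 0 n ω := by
  simp [walkFrom, shiftSum]

lemma walkFrom_zero_add (ω : Ω) (m n : ℕ) :
    walkFrom 0 (fun n => X n ω) (m + n) = walkFrom 0 (fun n => X n ω) m + shiftSum X m n ω := by
  simp [walkFrom, shiftSum, Finset.sum_range_add]

lemma shiftSum_neg (m n : ℕ) (ω : Ω) :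
    shiftSum (fun n ω => -X n ω) m n ω = -shiftSum X m n ω := by
  simp [shiftSum]

end Pointwise

variable {Ω : Type*} [mΩ : MeasurableSpace Ω] {P : Measure Ω}
  {𝓕 : ℕ → MeasurableSpace Ω} {X : ℕ → Ω → ℝ} {p : AddMonoidAlgebra ℝ ℝ}

namespace IsStepSequence

lemma measurable_walkFrom (h : IsStepSequence P 𝓕 X p) (n : ℕ) :
    Measurable[𝓕 n] fun ω => walkFrom 0 (fun n => X n ω) n := by
  have := measurable_shiftSum h 0 n
  rw [zero_add] at this
  convert! this using 2 with ω
  rw [walkFrom_eq_shiftSum, zero_add]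

lemma measurable_walkFrom' (h : IsStepSequence P 𝓕 X p) (n : ℕ) :
    Measurable fun ω => walkFrom 0 (fun n => X n ω) n :=
  (h.measurable_walkFrom n).mono (h.le n) le_rfl

lemma measurable_interTime (h : IsStepSequence P 𝓕 X p) (i : ℕ) :
    Measurable fun ω => interTime (walkFrom 0 fun n => X n ω) i := by
  have h1 := measurable_crossingTime i h.measurable_walkFrom'
  have h2 := measurable_crossingTime (i + 1) h.measurable_walkFrom'
  have h3 : Measurable fun q : ℕ∞ × ℕ∞ => q.1 - q.2 := Measurable.of_discrete
  exact h3.comp (h2.prodMk h1)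

lemma measurable_crossingValue (h : IsStepSequence P 𝓕 X p) (i : ℕ) :
    Measurable fun ω => crossingValue (walkFrom 0 fun n => X n ω) i := by
  have h1 := measurable_crossingTime i h.measurable_walkFrom'
  have h2 : Measurable fun t : ℕ∞ => t.toNat + 1 := Measurable.of_discrete
  have h3 : Measurable fun q : Ω × ℕ => walkFrom 0 (fun n => X n q.1) q.2 :=
    measurable_from_prod_countable_left h.measurable_walkFrom'
  exact h3.comp (measurable_id.prodMk (h2.comp h1))

lemma exists_countable_walkFrom_mem (h : IsStepSequence P 𝓕 X p) :
    ∃ D : Set ℝ, D.Countable ∧ ∀ᵐ ω ∂P, ∀ n, walkFrom 0 (fun n => X n ω) n ∈ D := by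
  choose J hJ using fun n => exists_finset_shiftSum_mem h 0 n
  refine ⟨⋃ n, J n, Set.countable_iUnion fun n => (J n).countable_toSet, ?_⟩
  filter_upwards [ae_all_iff.2 hJ] with ω hω n
  rw [walkFrom_eq_shiftSum, zero_add]
  exact Set.mem_iUnion.2 ⟨n, hω n⟩

variable [IsProbabilityMeasure P]

/-- Markov property at the landing time `m + 1`. The event that `t_i = m` and the walk lands at `x`
is known at that time, and on it the next inter-crossing time is the first passage above `|x|` of
the subsequent steps, negated when `x ≥ 0`. Touching zero is not a crossing, in agreement with the
strict passage above `|x|`. -/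
lemma measureReal_interTime_at (h : IsStepSequence P 𝓕 X p) (i m : ℕ) (x : ℝ) (n : ℕ) :
    P.real ({ω | crossingValue (walkFrom 0 fun n => X n ω) i = x} ∩
        {ω | interTime (walkFrom 0 fun n => X n ω) i = n} ∩
        {ω | crossingTime (walkFrom 0 fun n => X n ω) i = m}) =
      P.real ({ω | crossingValue (walkFrom 0 fun n => X n ω) i = x} ∩
        {ω | crossingTime (walkFrom 0 fun n => X n ω) i = m}) * crossMass p x n := by
  cases n with
  | zero =>
    have : {ω | crossingValue (walkFrom 0 fun n => X n ω) i = x} ∩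
        {ω | interTime (walkFrom 0 fun n => X n ω) i = (0 : ℕ)} ∩
        {ω | crossingTime (walkFrom 0 fun n => X n ω) i = m} = ∅ := by
      ext ω
      simp only [Set.mem_inter_iff, Set.mem_ofPred_eq, Set.mem_empty_iff_false, iff_false]
      rintro ⟨⟨-, h1⟩, h2⟩
      exact interTime_ne_zero h2 h1
    rw [this]
    simp [crossMass, passMass]
  | succ k =>
    set E := {ω | crossingTime (walkFrom 0 fun n => X n ω) i = m} ∩
      {ω | walkFrom 0 (fun n => X n ω) (m + 1) = x} with hEdef
    have hEm : MeasurableSet[𝓕 (m + 1)] E := by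
      refine @MeasurableSet.inter _ (𝓕 (m + 1)) _ _ ?_ ?_
      · exact @measurableSet_crossingTime_eq _ (𝓕 (m + 1)) _ m i fun k hk =>
          (h.measurable_walkFrom k).mono (h.mono hk) le_rfl
      · exact h.measurable_walkFrom (m + 1) (measurableSet_singleton x)
    have hE : {ω | crossingValue (walkFrom 0 fun n => X n ω) i = x} ∩
        {ω | crossingTime (walkFrom 0 fun n => X n ω) i = m} = E := by
      ext ω
      simp only [hEdef, Set.mem_inter_iff, Set.mem_ofPred_eq, crossingValue]
      constructor
      · rintro ⟨h1, h2⟩; rw [h2] at h1; exact ⟨h2, h1⟩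
      · rintro ⟨h2, h1⟩; rw [h2]; exact ⟨h1, rfl⟩
    have hfirst : ∀ ω ∈ E, (interTime (walkFrom 0 fun n => X n ω) i = ((k + 1 : ℕ) : ℕ∞) ↔
        ((if 0 ≤ x then 1 else -1 : ℤ) : ℝ) * (x + shiftSum X (m + 1) (k + 1) ω) < 0 ∧
          ∀ j < k, 0 ≤ ((if 0 ≤ x then 1 else -1 : ℤ) : ℝ) *
            (x + shiftSum X (m + 1) (j + 1) ω)) := by
      rintro ω ⟨h1, h2⟩
      rw [Set.mem_ofPred_eq] at h2
      rw [interTime_eq_succ_iff h1, pathSign_crossingTime h1]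
      simp only [add_assoc (m + 1) _ 1, walkFrom_zero_add ω (m + 1)]
      rw [h2]
    rw [Set.inter_right_comm, hE, crossMass]
    split_ifs with hx
    · rw [← measureReal_passage_total h.neg hEm |x| k]
      congr 1
      ext ω
      rw [Set.inter_assoc E (stayEvent _ _ _ _), Set.mem_inter_iff, Set.mem_inter_iff]
      refine and_congr_right fun hω => ?_
      rw [Set.mem_ofPred_eq, hfirst ω hω, if_pos hx, abs_of_nonneg hx]
      simp only [stayEvent, Set.mem_inter_iff, Set.mem_ofPred_eq, shiftSum_neg]
      rw [and_comm]
      refine and_congr ⟨fun h1 j hj hjk => ?_, fun h1 j hj => ?_⟩ ?_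
      · have := h1 (j - 1) (by omega)
        rw [show j - 1 + 1 = j by omega] at this
        push_cast at this; linarith
      · have := h1 (j + 1) (by omega) (by omega)
        push_cast; linarith
      · push_cast; constructor <;> intro <;> linarith
    · rw [← measureReal_passage_total h hEm |x| k]
      congr 1
      ext ω
      rw [Set.inter_assoc E (stayEvent _ _ _ _), Set.mem_inter_iff, Set.mem_inter_iff]
      refine and_congr_right fun hω => ?_
      rw [Set.mem_ofPred_eq, hfirst ω hω, if_neg hx, abs_of_neg (not_le.1 hx)]
      simp only [stayEvent, Set.mem_inter_iff, Set.mem_ofPred_eq]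
      rw [and_comm]
      refine and_congr ⟨fun h1 j hj hjk => ?_, fun h1 j hj => ?_⟩ ?_
      · have := h1 (j - 1) (by omega)
        rw [show j - 1 + 1 = j by omega] at this
        push_cast at this; linarith
      · have := h1 (j + 1) (by omega) (by omega)
        push_cast; linarith
      · push_cast; constructor <;> intro <;> linarith

lemma measureReal_interTime_of_value (h : IsStepSequence P 𝓕 X p) {i : ℕ}
    (hi : ∀ᵐ ω ∂P, crossingTime (walkFrom 0 fun n => X n ω) i ≠ ⊤) (x : ℝ) (n : ℕ) :
    P.real ({ω | crossingValue (walkFrom 0 fun n => X n ω) i = x} ∩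
        {ω | interTime (walkFrom 0 fun n => X n ω) i = n}) =
      P.real {ω | crossingValue (walkFrom 0 fun n => X n ω) i = x} * crossMass p x n := by
  have hv : MeasurableSet {ω | crossingValue (walkFrom 0 fun n => X n ω) i = x} :=
    h.measurable_crossingValue i (measurableSet_singleton x)
  have hn : MeasurableSet {ω | interTime (walkFrom 0 fun n => X n ω) i = n} :=
    h.measurable_interTime i (measurableSet_singleton _)
  have hmem : ∀ᵐ ω ∂P, crossingTime (walkFrom 0 fun n => X n ω) i ∈
      Set.range (Nat.cast : ℕ → ℕ∞) := by
    filter_upwards [hi] with ω hω using ⟨_, ENat.natCast_toNat hω⟩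
  have ht := measurable_crossingTime i h.measurable_walkFrom'
  have h1 := hasSum_measureReal_fiber (hv.inter hn) ht (Set.countable_range _)
    (hmem.mono fun ω hω _ => hω)
  have h2 := (hasSum_measureReal_fiber hv ht (Set.countable_range _)
    (hmem.mono fun ω hω _ => hω)).mul_right (crossMass p x n)
  refine h1.unique (h2.congr_fun ?_)
  rintro ⟨_, m, rfl⟩
  exact h.measureReal_interTime_at i m x n

/-- Given the landing point, the masses of the next inter-crossing time add up to `1` because first
passage is almost sure. A countable set of landing points allows summing over them. -/
lemma ae_crossingTime_succ_ne_top (h : IsStepSequence P 𝓕 X p) (hp : IsStepMass p) {i : ℕ}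
    (hi : ∀ᵐ ω ∂P, crossingTime (walkFrom 0 fun n => X n ω) i ≠ ⊤) {D : Set ℝ} (hD : D.Countable)
    (hiD : ∀ᵐ ω ∂P, crossingValue (walkFrom 0 fun n => X n ω) i ∈ D) :
    ∀ᵐ ω ∂P, crossingTime (walkFrom 0 fun n => X n ω) (i + 1) ≠ ⊤ := by
  have hT := h.measurable_interTime i
  have hV := h.measurable_crossingValue i
  have hfin : MeasurableSet {ω | interTime (walkFrom 0 fun n => X n ω) i ≠ ⊤} :=
    (hT (measurableSet_singleton ⊤)).compl
  have h1 := hasSum_measureReal_fiber hfin hV hD (hiD.mono fun ω hω _ => hω)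
  have h2 := hasSum_measureReal_fiber (P := P) MeasurableSet.univ hV hD (hiD.mono fun ω hω _ => hω)
  have h3 : ∀ x : D, P.real ({ω | interTime (walkFrom 0 fun n => X n ω) i ≠ ⊤} ∩
      {ω | crossingValue (walkFrom 0 fun n => X n ω) i = x}) =
      P.real (Set.univ ∩ {ω | crossingValue (walkFrom 0 fun n => X n ω) i = x}) := by
    intro x
    have hx : MeasurableSet {ω | crossingValue (walkFrom 0 fun n => X n ω) i = x} :=
      hV (measurableSet_singleton _)
    have h4 := hasSum_measureReal_fiber (P := P) (hfin.inter hx) hT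
      (Set.countable_range (Nat.cast : ℕ → ℕ∞)) (Eventually.of_forall fun ω hω =>
        ⟨_, ENat.natCast_toNat hω.1⟩)
    have h5 := (hp.hasSum_crossMass x).mul_left
      (P.real {ω | crossingValue (walkFrom 0 fun n => X n ω) i = x})
    rw [mul_one] at h5
    rw [Set.univ_inter]
    refine HasSum.unique ?_ h5
    have h6 := (Equiv.ofInjective (Nat.cast : ℕ → ℕ∞) Nat.cast_injective).hasSum_iff.2 h4
    refine h6.congr_fun fun n => ?_
    rw [← h.measureReal_interTime_of_value hi]
    simp only [Function.comp_apply, Equiv.ofInjective_apply]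
    congr 1
    ext ω
    simp only [Set.mem_inter_iff, Set.mem_ofPred_eq]
    constructor
    · rintro ⟨h1, h2⟩; exact ⟨⟨by rw [h2]; exact ENat.natCast_ne_top n, h1⟩, h2⟩
    · rintro ⟨⟨-, h1⟩, h2⟩; exact ⟨h1, h2⟩
  simp only [h3] at h1
  have h4 := h1.unique h2
  rw [probReal_univ, measureReal_def, ENNReal.toReal_eq_one_iff, ← mem_ae_iff_prob_eq_one hfin] at h4
  filter_upwards [hi, h4] with ω h5 h6 h7
  obtain ⟨m, hm⟩ := ENat.ne_top_iff_exists.1 h5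
  exact h6 ((interTime_eq_top_iff hm.symm).2 h7)

lemma ae_crossingTime_ne_top (h : IsStepSequence P 𝓕 X p) (hp : IsStepMass p) (i : ℕ) :
    ∀ᵐ ω ∂P, crossingTime (walkFrom 0 fun n => X n ω) i ≠ ⊤ := by
  obtain ⟨D, hD, hDmem⟩ := h.exists_countable_walkFrom_mem
  induction i with
  | zero => exact Eventually.of_forall fun ω => by simp [crossingTime]
  | succ i ih =>
    exact h.ae_crossingTime_succ_ne_top hp ih hD (hDmem.mono fun ω hω => hω _)

lemma ae_abs_crossingValue_le (h : IsStepSequence P 𝓕 X p) (hp : IsStepMass p) {B : ℝ}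
    (hB : ∀ x ∈ p.coeff.support, |x| ≤ B) (i : ℕ) :
    ∀ᵐ ω ∂P, |crossingValue (walkFrom 0 fun n => X n ω) i| ≤ B := by
  filter_upwards [h.ae_crossingTime_ne_top hp i, ae_all_iff.2 h.mem_support] with ω h1 h2
  obtain ⟨m, hm⟩ := ENat.ne_top_iff_exists.1 h1
  have h3 := abs_le_abs_sub_of_crossingTime (S := walkFrom 0 fun n => X n ω) (by simp [walkFrom])
    hm.symm
  rw [crossingValue, ← hm, ENat.toNat_natCast]
  refine h3.trans (le_trans (le_of_eq ?_) (hB _ (h2 m)))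
  rw [walkFrom_zero_add ω m 1]
  simp [shiftSum]

lemma hasSum_interTime (h : IsStepSequence P 𝓕 X p) (hp : IsStepMass p) {i : ℕ} {D : Set ℝ}
    (hD : D.Countable) (hiD : ∀ᵐ ω ∂P, crossingValue (walkFrom 0 fun n => X n ω) i ∈ D) (n : ℕ) :
    HasSum (fun x : D => P.real {ω | crossingValue (walkFrom 0 fun n => X n ω) i = x} *
      crossMass p x n) (P.real {ω | interTime (walkFrom 0 fun n => X n ω) i = n}) := by
  have hn : MeasurableSet {ω | interTime (walkFrom 0 fun n => X n ω) i = n} :=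
    h.measurable_interTime i (measurableSet_singleton _)
  refine (hasSum_measureReal_fiber hn (h.measurable_crossingValue i) hD
    (hiD.mono fun ω hω _ => hω)).congr_fun fun x => ?_
  rw [Set.inter_comm, h.measureReal_interTime_of_value (h.ae_crossingTime_ne_top hp i)]

lemma hasSum_crossingValue (h : IsStepSequence P 𝓕 X p) {i : ℕ} {D : Set ℝ}
    (hD : D.Countable) (hiD : ∀ᵐ ω ∂P, crossingValue (walkFrom 0 fun n => X n ω) i ∈ D) :
    HasSum (fun x : D => P.real {ω | crossingValue (walkFrom 0 fun n => X n ω) i = x}) 1 := by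
  have := hasSum_measureReal_fiber (P := P) MeasurableSet.univ (h.measurable_crossingValue i) hD
    (hiD.mono fun ω hω _ => hω)
  simpa using this

/-- Shifted by `y`, the path must stay at most `y` and then be at `y + l > y`. An earlier visit to
`l` is impossible, since the values in between are at most `0 < l` and the start is `-y`; so the
infimum imposes no extra condition. -/
lemma measureReal_jumpTime (h : IsStepSequence P 𝓕 X p) {y l : ℝ} (hy : 0 < y) (hl : 0 < l)
    (n : ℕ) :
    P.real {ω | jumpTime y l (fun n => X n ω) = n} = (passMass p y n).coeff (y + l) := by
  simp only [jumpTime, sInf_natCast_eq_iff]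
  cases n with
  | zero =>
    have : {ω | (walkFrom (-y) (fun n => X n ω) 0 = l ∧
        ∀ t, 1 ≤ t → t < 0 → walkFrom (-y) (fun n => X n ω) t ≤ 0) ∧
        ∀ k < 0, ¬ (walkFrom (-y) (fun n => X n ω) k = l ∧
          ∀ t, 1 ≤ t → t < k → walkFrom (-y) (fun n => X n ω) t ≤ 0)} = ∅ := by
      ext ω
      simp only [Set.mem_ofPred_eq, Set.mem_empty_iff_false, iff_false]
      rintro ⟨⟨h1, -⟩, -⟩
      simp only [walkFrom, Finset.range_zero, Finset.sum_empty, add_zero] at h1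
      linarith
    rw [this]
    simp [passMass]
  | succ n =>
    have := measureReal_passage h (@MeasurableSet.univ _ (𝓕 0)) n (lt_add_of_pos_right y hl)
    rw [probReal_univ, one_mul] at this
    rw [← this]
    congr 1
    ext ω
    simp only [Set.mem_ofPred_eq, Set.mem_inter_iff, Set.mem_univ, true_and, stayEvent,
      walkFrom_eq_shiftSum]
    constructor
    · rintro ⟨⟨h1, h2⟩, -⟩
      exact ⟨fun j hj hjn => by linarith [h2 j hj (by omega)], by linarith⟩
    · rintro ⟨h1, h2⟩
      refine ⟨⟨by linarith, fun j hj hjn => by linarith [h1 j hj (by omega)]⟩, ?_⟩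
      rintro k hk ⟨h3, -⟩
      rcases Nat.eq_zero_or_pos k with rfl | hk0
      · simp [shiftSum] at h3; linarith
      · linarith [h1 k hk0 (by omega)]

end IsStepSequence

end Walk

/-! ### From oscillation sums to the Lévy type of a random time. -/

section FiniteTime

variable {Ω : Type*} [MeasurableSpace Ω] {P : Measure Ω} [IsProbabilityMeasure P] {T : Ω → ℕ∞}

lemma hasSum_measureReal_finite (hT : Measurable T) :
    HasSum (fun n : ℕ => P.real {ω | T ω = n}) (P.real {ω | T ω ≠ ⊤}) := by
  have hfin : MeasurableSet {ω | T ω ≠ ⊤} := (hT (measurableSet_singleton ⊤)).compl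
  have h1 := hasSum_measureReal_fiber (P := P) hfin hT
    (Set.countable_range (Nat.cast : ℕ → ℕ∞)) (Eventually.of_forall fun ω hω =>
      ⟨_, ENat.natCast_toNat hω⟩)
  have h2 := (Equiv.ofInjective (Nat.cast : ℕ → ℕ∞) Nat.cast_injective).hasSum_iff.2 h1
  refine h2.congr_fun fun n => ?_
  simp only [Function.comp_apply, Equiv.ofInjective_apply]
  congr 1
  ext ω
  simp only [Set.mem_inter_iff, Set.mem_ofPred_eq]
  exact ⟨fun h => ⟨by rw [h]; exact ENat.natCast_ne_top n, h⟩, fun h => h.2⟩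

lemma isProbabilityMeasure_finiteTimeLaw (hT : Measurable T) (h0 : P {ω | T ω ≠ ⊤} ≠ 0) :
    IsProbabilityMeasure (finiteTimeLaw P T) := by
  have := cond_isProbabilityMeasure h0
  have hm : Measurable fun ω => ((T ω).toNat : ℝ) :=
    (Measurable.of_discrete (f := fun t : ℕ∞ => (t.toNat : ℝ))).comp hT
  exact Measure.isProbabilityMeasure_map hm.aemeasurable

lemma one_sub_charFun_finiteTimeLaw (hT : Measurable T) (h0 : P {ω | T ω ≠ ⊤} ≠ 0) (θ : ℝ) :
    1 - charFun (finiteTimeLaw P T) θ = ((P.real {ω | T ω ≠ ⊤})⁻¹ : ℝ) *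
      ∑' n : ℕ, (P.real {ω | T ω = n} : ℂ) * (1 - Complex.exp ((θ * n : ℝ) * Complex.I)) := by
  have hfin : MeasurableSet {ω | T ω ≠ ⊤} := (hT (measurableSet_singleton ⊤)).compl
  have hmN : Measurable fun ω => (T ω).toNat :=
    (Measurable.of_discrete (f := fun t : ℕ∞ => t.toNat)).comp hT
  have hm : Measurable fun ω => ((T ω).toNat : ℝ) :=
    (Measurable.of_discrete (f := fun t : ℕ∞ => (t.toNat : ℝ))).comp hT
  have hsum := hasSum_measureReal_finite (P := P) hT
  set A := P.real {ω | T ω ≠ ⊤} with hA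
  have hA0 : A ≠ 0 := by
    rw [hA, measureReal_def, ENNReal.toReal_ne_zero]
    exact ⟨h0, measure_ne_top _ _⟩
  let ρ : Measure ℕ := (P.restrict {ω | T ω ≠ ⊤}).map fun ω => (T ω).toNat
  have hρ : ∀ n, ρ.real {n} = P.real {ω | T ω = n} := by
    intro n
    rw [measureReal_def, Measure.map_apply hmN (measurableSet_singleton n),
      Measure.restrict_apply (hmN (measurableSet_singleton n)), measureReal_def]
    congr 2
    ext ω
    simp only [Set.mem_inter_iff, Set.mem_preimage, Set.mem_singleton_iff, Set.mem_ofPred_eq]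
    constructor
    · rintro ⟨h1, h2⟩; rw [← h1, ENat.natCast_toNat h2]
    · intro h; rw [h]; exact ⟨ENat.toNat_natCast n, ENat.natCast_ne_top n⟩
  have h1 : charFun (finiteTimeLaw P T) θ = (A⁻¹ : ℝ) *
      ∑' n : ℕ, (P.real {ω | T ω = n} : ℂ) * Complex.exp ((θ * n : ℝ) * Complex.I) := by
    have hint : Integrable (fun n : ℕ => Complex.exp ((θ * n : ℝ) * Complex.I)) ρ :=
      Integrable.of_bound (C := 1) (Measurable.of_discrete.aestronglyMeasurable)
        (Eventually.of_forall fun n => (Complex.norm_exp_ofReal_mul_I _).le)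
    have h2 := integral_countable hint
    rw [integral_map hmN.aemeasurable Measurable.of_discrete.aestronglyMeasurable] at h2
    rw [charFun_apply_real, finiteTimeLaw, integral_map hm.aemeasurable
      (by fun_prop), ProbabilityTheory.cond, integral_smul_measure]
    simp only [hρ, Complex.real_smul] at h2
    rw [← h2, ENNReal.toReal_inv, ← measureReal_def, ← hA, Complex.real_smul]
    simp
  have hs : Summable fun n : ℕ => (P.real {ω | T ω = n} : ℂ) :=
    (Complex.hasSum_ofReal.2 hsum).summable
  have hse : Summable fun n : ℕ =>
      (P.real {ω | T ω = n} : ℂ) * Complex.exp ((θ * n : ℝ) * Complex.I) := by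
    refine Summable.of_norm_bounded hsum.summable fun n => ?_
    rw [norm_mul, Complex.norm_exp_ofReal_mul_I, mul_one, Complex.norm_real,
      Real.norm_of_nonneg measureReal_nonneg]
  simp only [mul_sub, mul_one]
  rw [h1, hs.tsum_sub hse, (Complex.hasSum_ofReal.2 hsum).tsum_eq, mul_sub, ← Complex.ofReal_mul,
    inv_mul_cancel₀ hA0, Complex.ofReal_one]

/-- Conditioning on `T < ∞` divides the masses, hence the scale, by `P(T < ∞)`. -/
lemma isLevyHalfType_of_tendsto (hT : Measurable T) (h0 : P {ω | T ω ≠ ⊤} ≠ 0) {c : ℝ}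
    (h : Tendsto (fun θ : ℝ => (∑' n : ℕ, (P.real {ω | T ω = n} : ℂ) *
      (1 - Complex.exp ((θ * n : ℝ) * Complex.I))) / (√θ : ℂ)) (𝓝[>] 0)
      (𝓝 (c * (1 - Complex.I)))) :
    IsLevyHalfType P T ((P.real {ω | T ω ≠ ⊤})⁻¹ * c) := by
  have := isProbabilityMeasure_finiteTimeLaw hT h0
  refine exists_isHalfStable_inHalfDomainOf ?_
  have h2 := h.const_mul (((P.real {ω | T ω ≠ ⊤})⁻¹ : ℝ) : ℂ)
  rw [← mul_assoc, ← Complex.ofReal_mul] at h2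
  refine h2.congr fun θ => ?_
  rw [one_sub_charFun_finiteTimeLaw hT h0, mul_div_assoc]

end FiniteTime

/-! ### Mixtures of passage times over landing points. -/

section CrossMass

variable {p : AddMonoidAlgebra ℝ ℝ}

/-- Scale constant governing the crossing time of a walk that has just landed at `x`. -/
noncomputable def crossScale (p : AddMonoidAlgebra ℝ ℝ) (x : ℝ) : ℝ :=
  meanPassage (if 0 ≤ x then reflectMass p else p) |x| / √(secondMoment p)

lemma IsStepMass.secondMoment_pos (hp : IsStepMass p) : 0 < secondMoment p := hp.variance_pos

lemma secondMoment_ite_reflect (p : AddMonoidAlgebra ℝ ℝ) (x : ℝ) :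
    secondMoment (if 0 ≤ x then reflectMass p else p) = secondMoment p := by
  split_ifs
  exacts [secondMoment_reflectMass p, rfl]

lemma IsStepMass.crossScale_pos (hp : IsStepMass p) (x : ℝ) : 0 < crossScale p x :=
  div_pos ((hp.ite_reflect x).meanPassage_pos (abs_nonneg x)) (Real.sqrt_pos.2 hp.secondMoment_pos)

lemma IsStepMass.crossMass_nonneg (hp : IsStepMass p) (x : ℝ) (n : ℕ) : 0 ≤ crossMass p x n :=
  realLaplace_nonneg (passMass_nonneg (hp.ite_reflect x).nonneg _ n) 0

lemma IsStepMass.tendsto_oscillation_crossMass (hp : IsStepMass p) (x : ℝ) :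
    Tendsto (fun θ : ℝ => (∑' n : ℕ, (crossMass p x n : ℂ) *
        (1 - Complex.exp ((θ * n : ℝ) * Complex.I))) / (√θ : ℂ)) (𝓝[>] 0)
      (𝓝 (crossScale p x * (1 - Complex.I))) := by
  have := (hp.ite_reflect x).tendsto_oscillation_passMass (abs_nonneg x)
  rw [secondMoment_ite_reflect] at this
  exact this

lemma IsStepMass.exists_crossMass_oscillation_bound (hp : IsStepMass p) (B : ℝ) :
    ∃ K : ℝ, ∀ᶠ θ in 𝓝[>] (0 : ℝ), ∀ x : ℝ, |x| ≤ B →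
      ‖(∑' n : ℕ, (crossMass p x n : ℂ) *
        (1 - Complex.exp ((θ * n : ℝ) * Complex.I))) / (√θ : ℂ)‖ ≤ K := by
  obtain ⟨K, hK⟩ := hp.exists_oscillation_bound B
  obtain ⟨K', hK'⟩ := hp.reflect.exists_oscillation_bound B
  refine ⟨max K K', ?_⟩
  filter_upwards [hK, hK'] with θ h1 h2 x hx
  unfold crossMass
  split_ifs
  · exact (h2 |x| (abs_nonneg x) hx).trans (le_max_right _ _)
  · exact (h1 |x| (abs_nonneg x) hx).trans (le_max_left _ _)

/-- Fubini: the joint masses sum to `1` and the oscillating factor is at most `2` in modulus. -/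
lemma IsStepMass.oscillation_mixture (hp : IsStepMass p) {D : Set ℝ} {w : D → ℝ}
    (hw0 : ∀ x, 0 ≤ w x) (hw : HasSum w 1) {a : ℕ → ℝ}
    (ha : ∀ n, HasSum (fun x : D => w x * crossMass p x n) (a n)) (θ : ℝ) :
    ∑' n : ℕ, (a n : ℂ) * (1 - Complex.exp ((θ * n : ℝ) * Complex.I)) =
      ∑' x : D, (w x : ℂ) * ∑' n : ℕ, (crossMass p x n : ℂ) *
        (1 - Complex.exp ((θ * n : ℝ) * Complex.I)) := by
  have hnn : ∀ q : D × ℕ, 0 ≤ w q.1 * crossMass p q.1 q.2 := fun q =>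
    mul_nonneg (hw0 q.1) (hp.crossMass_nonneg q.1 q.2)
  have hprod : Summable fun q : D × ℕ => w q.1 * crossMass p q.1 q.2 := by
    have hcol : ∀ x : D, HasSum (fun n => w x * crossMass p x n) (w x) := fun x => by
      simpa using (hp.hasSum_crossMass (x : ℝ)).mul_left (w x)
    rw [summable_prod_of_nonneg hnn]
    refine ⟨fun x => (hcol x).summable, ?_⟩
    simp only [fun x => (hcol x).tsum_eq]
    exact hw.summable
  let e : ℕ → ℂ := fun n => 1 - Complex.exp ((θ * n : ℝ) * Complex.I)
  have he : ∀ n, ‖e n‖ ≤ 2 := norm_one_sub_exp_le_two θ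
  change ∑' n : ℕ, (a n : ℂ) * e n = ∑' x : D, (w x : ℂ) * ∑' n : ℕ, (crossMass p x n : ℂ) * e n
  clear_value e
  let f : D → ℕ → ℂ := fun x n => ((w x * crossMass p x n : ℝ) : ℂ) * e n
  have hsum : Summable (Function.uncurry f) := by
    refine Summable.of_norm_bounded (hprod.mul_right 2) fun q => ?_
    simp only [Function.uncurry, f]
    rw [norm_mul, Complex.norm_real, Real.norm_of_nonneg (hnn q)]
    exact mul_le_mul_of_nonneg_left (he _) (hnn q)
  have h1 : ∀ n : ℕ, (a n : ℂ) * e n = ∑' x : D, f x n := by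
    intro n
    simp only [f]
    rw [tsum_mul_right, ← Complex.ofReal_tsum, (ha n).tsum_eq]
  have h2 : ∀ x : D, (w x : ℂ) * ∑' n : ℕ, (crossMass p x n : ℂ) * e n = ∑' n, f x n := by
    intro x
    rw [← tsum_mul_left]
    refine tsum_congr fun n => ?_
    simp only [f]
    push_cast
    ring
  simp only [h1, h2]
  exact hsum.tsum_comm

/-- Mixtures of crossing times over a bounded landing position. -/
lemma IsStepMass.exists_tendsto_oscillation_mixture (hp : IsStepMass p) {D : Set ℝ} {B : ℝ}
    (hB : ∀ x ∈ D, |x| ≤ B) {w : D → ℝ} (hw0 : ∀ x, 0 ≤ w x) (hw : HasSum w 1) {a : ℕ → ℝ}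
    (ha : ∀ n, HasSum (fun x : D => w x * crossMass p x n) (a n)) :
    ∃ c : ℝ, 0 < c ∧ Tendsto (fun θ : ℝ => (∑' n : ℕ, (a n : ℂ) *
        (1 - Complex.exp ((θ * n : ℝ) * Complex.I))) / (√θ : ℂ)) (𝓝[>] 0)
      (𝓝 (c * (1 - Complex.I))) := by
  obtain ⟨K, hK⟩ := hp.exists_crossMass_oscillation_bound B
  have hlim : ∀ x : D, Tendsto (fun θ : ℝ => (w x : ℂ) * ((∑' n : ℕ, (crossMass p x n : ℂ) *
        (1 - Complex.exp ((θ * n : ℝ) * Complex.I))) / (√θ : ℂ))) (𝓝[>] 0)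
      (𝓝 (w x * (crossScale p x * (1 - Complex.I)))) := fun x =>
    (hp.tendsto_oscillation_crossMass x).const_mul _
  have hbd : ∀ᶠ θ in 𝓝[>] (0 : ℝ), ∀ x : D, ‖(w x : ℂ) * ((∑' n : ℕ, (crossMass p x n : ℂ) *
        (1 - Complex.exp ((θ * n : ℝ) * Complex.I))) / (√θ : ℂ))‖ ≤ w x * K := by
    filter_upwards [hK] with θ hθ x
    rw [norm_mul, Complex.norm_real, Real.norm_of_nonneg (hw0 x)]
    exact mul_le_mul_of_nonneg_left (hθ x (hB x x.2)) (hw0 x)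
  have hmain := tendsto_tsum_of_dominated_convergence (hw.summable.mul_right K) hlim hbd
  -- The uniform bound passes to the limit, and the real part of `c (1 - i)` is `c`. This makes the
  -- averaged scale a convergent sum.
  have hscale : ∀ x : D, w x * crossScale p x ≤ w x * K := by
    intro x
    have h1 : ‖(crossScale p x : ℂ) * (1 - Complex.I)‖ ≤ K :=
      le_of_tendsto (hp.tendsto_oscillation_crossMass x).norm
        (hK.mono fun θ hθ => hθ x (hB x x.2))
    have h2 : crossScale p x ≤ ‖(crossScale p x : ℂ) * (1 - Complex.I)‖ := by
      refine le_trans ?_ (Complex.re_le_norm _)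
      simp
    exact mul_le_mul_of_nonneg_left (h2.trans h1) (hw0 x)
  have hsc : Summable fun x : D => w x * crossScale p x :=
    Summable.of_nonneg_of_le (fun x => mul_nonneg (hw0 x) (hp.crossScale_pos x).le) hscale
      (hw.summable.mul_right K)
  have hex : ∃ x : D, w x ≠ 0 := by
    by_contra! h
    have : w = fun _ => 0 := funext h
    rw [this] at hw
    exact zero_ne_one (hasSum_zero.unique hw)
  obtain ⟨x₀, hx₀⟩ := hex
  refine ⟨∑' x : D, w x * crossScale p x, hsc.tsum_pos
    (fun x => mul_nonneg (hw0 x) (hp.crossScale_pos x).le) x₀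
    (mul_pos (lt_of_le_of_ne (hw0 x₀) hx₀.symm) (hp.crossScale_pos _)), ?_⟩
  have h1 : ∑' x : D, (w x : ℂ) * (crossScale p x * (1 - Complex.I)) =
      ((∑' x : D, w x * crossScale p x : ℝ) : ℂ) * (1 - Complex.I) := by
    rw [Complex.ofReal_tsum, ← tsum_mul_right]
    refine tsum_congr fun x => ?_
    push_cast
    ring
  rw [h1] at hmain
  refine hmain.congr fun θ => ?_
  rw [hp.oscillation_mixture hw0 hw ha, ← tsum_div_const]
  simp only [mul_div_assoc]

end CrossMass

/-! ### The period of a lattice walk. -/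

/-- `d` is the period of the walk with step mass `p`, whose steps are multiples of `h`; the
differences of its steps generate the multiples of `g`. -/
structure IsLatticeMass (p : AddMonoidAlgebra ℝ ℝ) (h g x₁ : ℝ) (d : ℕ) : Prop where
  pos : 0 < h
  mem_zmultiples : ∀ x ∈ p.coeff.support, x ∈ AddSubgroup.zmultiples h
  gen_pos : 0 < g
  diffGroup_eq : diffGroup p = AddSubgroup.zmultiples g
  mem_support : x₁ ∈ p.coeff.support
  neZero : NeZero d
  zsmul_mem_iff : ∀ n : ℤ, n • x₁ ∈ diffGroup p ↔ (d : ℤ) ∣ n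

lemma exists_abs_le_of_support (p : AddMonoidAlgebra ℝ ℝ) : ∃ B, ∀ x ∈ p.coeff.support, |x| ≤ B :=
  (p.coeff.support.image (|·|)).bddAbove.imp fun _ hB _ hx => hB (by
    rw [Finset.coe_image]; exact Set.mem_image_of_mem _ hx)

section Lattice

variable {p : AddMonoidAlgebra ℝ ℝ} {h g x₁ : ℝ} {d : ℕ}

lemma diffGroup_le_zmultiples (hlat : ∀ x ∈ p.coeff.support, x ∈ AddSubgroup.zmultiples h) :
    diffGroup p ≤ AddSubgroup.zmultiples h := by
  refine (AddSubgroup.closure_le _).2 ?_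
  rintro _ ⟨x, hx, x', hx', rfl⟩
  exact AddSubgroup.sub_mem _ (hlat x hx) (hlat x' hx')

lemma IsStepMass.support_nonempty (hp : IsStepMass p) : p.coeff.support.Nonempty := by
  by_contra hne
  have := hp.sum_eq_one
  rw [Finset.not_nonempty_iff_eq_empty.1 hne] at this
  simp at this

lemma IsStepMass.diffGroup_ne_bot (hp : IsStepMass p) : diffGroup p ≠ ⊥ := by
  intro hbot
  obtain ⟨x₁, hx₁⟩ := hp.support_nonempty
  have heq : ∀ x ∈ p.coeff.support, x = x₁ := fun x hx => by
    have : x - x₁ ∈ diffGroup p := AddSubgroup.subset_closure ⟨x, hx, x₁, hx₁, rfl⟩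
    rw [hbot, AddSubgroup.mem_bot] at this
    linarith
  have h1 : x₁ = 0 := by
    have h2 := hp.mean_eq_zero
    have h3 : ∑ x ∈ p.coeff.support, p.coeff x * x = ∑ x ∈ p.coeff.support, p.coeff x * x₁ :=
      Finset.sum_congr rfl fun x hx => by rw [heq x hx]
    rwa [h3, ← Finset.sum_mul, hp.sum_eq_one, one_mul] at h2
  have h2 := hp.variance_pos
  rw [Finset.sum_eq_zero fun x hx => by rw [heq x hx, h1]; simp] at h2
  exact lt_irrefl 0 h2

/-- The difference group sits in the discrete group `hℤ`, so it is cyclic, and nontrivial because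
the step is not constant. The period `d` is the order of any possible step `x₁` in the quotient of
`ℝ` by it. -/
lemma IsStepMass.exists_isLatticeMass (hp : IsStepMass p) (hh : 0 < h)
    (hlat : ∀ x ∈ p.coeff.support, x ∈ AddSubgroup.zmultiples h) :
    ∃ g x₁ d, IsLatticeMass p h g x₁ d := by
  have hle := diffGroup_le_zmultiples hlat
  obtain ⟨b, hb⟩ := AddSubgroup.cyclic_of_isolated_zero (H := diffGroup p) hh (by
    refine Set.disjoint_left.2 fun x hx hx' => ?_
    obtain ⟨k, rfl⟩ := AddSubgroup.mem_zmultiples_iff.1 (hle hx)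
    rw [zsmul_eq_mul, Set.mem_Ioo] at hx'
    have h1 : (0 : ℝ) < k := pos_of_mul_pos_left hx'.1 hh.le
    have h2 : (k : ℝ) < 1 := by
      by_contra h3
      nlinarith [hx'.2, not_lt.1 h3]
    have h1' : (0 : ℤ) < k := by exact_mod_cast h1
    have h2' : k < (1 : ℤ) := by exact_mod_cast h2
    omega)
  rw [← AddSubgroup.zmultiples_eq_closure] at hb
  have hb0 : b ≠ 0 := by
    rintro rfl
    exact hp.diffGroup_ne_bot (by rw [hb, AddSubgroup.zmultiples_zero_eq_bot])
  obtain ⟨x₁, hx₁⟩ := hp.support_nonempty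
  obtain ⟨j, hj⟩ := AddSubgroup.mem_zmultiples_iff.1 (hlat x₁ hx₁)
  obtain ⟨k, hk⟩ := AddSubgroup.mem_zmultiples_iff.1
    (hle (by rw [hb]; exact AddSubgroup.mem_zmultiples b))
  have hk0 : k ≠ 0 := by
    rintro rfl
    exact hb0 (by rw [← hk, zero_zsmul])
  have hdvd : ∀ n : ℤ, n • x₁ ∈ diffGroup p ↔
      (addOrderOf (x₁ : ℝ ⧸ diffGroup p) : ℤ) ∣ n := fun n => by
    rw [addOrderOf_dvd_iff_zsmul_eq_zero, ← QuotientAddGroup.mk_zsmul,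
      QuotientAddGroup.eq_zero_iff]
  refine ⟨|b|, x₁, addOrderOf (x₁ : ℝ ⧸ diffGroup p), hh, hlat, abs_pos.2 hb0, ?_, hx₁, ⟨?_⟩, hdvd⟩
  · rcases abs_choice b with hab | hab <;> rw [hab, hb]
    rw [AddSubgroup.zmultiples_neg]
  · intro h0
    rw [h0] at hdvd
    -- With `x₁ = j • h` and `b = k • h`, the multiple `k • x₁ = j • b` lies in the group, so the
    -- order of `x₁` is finite.
    have h1 : k • x₁ ∈ diffGroup p := by
      rw [← hj, smul_comm, hk, hb]
      exact AddSubgroup.zsmul_mem _ (AddSubgroup.mem_zmultiples b) j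
    exact hk0 (by simpa using (hdvd k).1 h1)

lemma IsLatticeMass.natCast_mul_mem (hl : IsLatticeMass p h g x₁ d) :
    (d : ℝ) * x₁ ∈ diffGroup p := by
  have := (hl.zsmul_mem_iff d).2 dvd_rfl
  rwa [zsmul_eq_mul, Int.cast_natCast] at this

/-- The reflected walk has the same period, so a single `d` serves crossings in both directions. -/
lemma IsLatticeMass.reflect (hl : IsLatticeMass p h g x₁ d) :
    IsLatticeMass (reflectMass p) h g (-x₁) d where
  pos := hl.pos
  mem_zmultiples x hx := by
    have := hl.mem_zmultiples _ (mem_support_reflectMass.1 hx)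
    rwa [AddSubgroup.neg_mem_iff] at this
  gen_pos := hl.gen_pos
  diffGroup_eq := by rw [diffGroup_reflectMass, hl.diffGroup_eq]
  mem_support := by rw [mem_support_reflectMass, neg_neg]; exact hl.mem_support
  neZero := hl.neZero
  zsmul_mem_iff n := by
    rw [diffGroup_reflectMass, smul_neg, AddSubgroup.neg_mem_iff, hl.zsmul_mem_iff]

lemma IsLatticeMass.hasPeriodicLimit_passMass (hl : IsLatticeMass p h g x₁ d) (hp : IsStepMass p)
    {y z : ℝ} (hy : 0 ≤ y) (hz : y < z) :
    HasPeriodicLimit d fun n => (passMass p y n).coeff z :=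
  have := hl.neZero
  hp.hasPeriodicLimit_passMass hl.mem_support hl.gen_pos hl.diffGroup_eq hl.pos hl.mem_zmultiples
    hl.natCast_mul_mem hy hz

lemma IsLatticeMass.hasPeriodicLimit_realLaplace_passMass (hl : IsLatticeMass p h g x₁ d)
    (hp : IsStepMass p) {y : ℝ} (hy : 0 ≤ y) :
    HasPeriodicLimit d fun n => realLaplace 0 (passMass p y n) :=
  have := hl.neZero
  hp.hasPeriodicLimit_realLaplace_passMass hl.mem_support hl.gen_pos hl.diffGroup_eq hl.pos
    hl.mem_zmultiples hl.natCast_mul_mem hy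

lemma IsLatticeMass.hasPeriodicLimit_crossMass (hl : IsLatticeMass p h g x₁ d)
    (hp : IsStepMass p) (x : ℝ) : HasPeriodicLimit d (crossMass p x) := by
  unfold crossMass
  split_ifs
  · exact hl.reflect.hasPeriodicLimit_realLaplace_passMass hp.reflect (abs_nonneg x)
  · exact hl.hasPeriodicLimit_realLaplace_passMass hp (abs_nonneg x)

/-- The passage times at a given point all lie in one residue class. -/
lemma IsLatticeMass.modEq_of_coeff_ne_zero (hl : IsLatticeMass p h g x₁ d) {y z : ℝ} {m n : ℕ}
    (hm : (passMass p y m).coeff z ≠ 0) (hn : (passMass p y n).coeff z ≠ 0) : n ≡ m [MOD d] := by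
  have h1 : z - m * x₁ ∈ diffGroup p := by
    by_contra hne; exact hm (supportedIn_passMass_diffGroup hl.mem_support y m z hne)
  have h2 : z - n * x₁ ∈ diffGroup p := by
    by_contra hne; exact hn (supportedIn_passMass_diffGroup hl.mem_support y n z hne)
  have h3 := AddSubgroup.sub_mem _ h2 h1
  have h4 : ((m : ℤ) - n) • x₁ ∈ diffGroup p := by
    convert h3 using 1
    rw [zsmul_eq_mul]
    push_cast
    ring
  exact (Nat.modEq_iff_dvd).2 ((hl.zsmul_mem_iff _).1 h4)

lemma HasPeriodicLimit.exists_asympPeriodic_sum_pos [NeZero d] {a : ℕ → ℝ}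
    (ha : HasPeriodicLimit d a) (hne : ∃ m, a m ≠ 0) :
    ∃ c : ZMod d → ℝ, AsympPeriodic d (3 / 2) a c ∧ 0 < ∑ r, c r := by
  obtain ⟨c, hc, hpos⟩ := ha.exists_limit
  obtain ⟨r, hr⟩ := hpos hne
  exact ⟨c, hc, Finset.sum_pos' (fun r _ => hc.nonneg ha.nonneg r) ⟨r, Finset.mem_univ r, hr⟩⟩

/-- Optional stopping only handles the total passage mass, not its restriction to one landing point.
The total mass above `0` serves as a reference sequence with known oscillation, and `a` is compared
with it through the ratio of the sums of their periodic limits. -/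
lemma IsLatticeMass.exists_tendsto_oscillation (hl : IsLatticeMass p h g x₁ d)
    (hp : IsStepMass p) {a : ℕ → ℝ} (ha : HasPeriodicLimit d a) (hne : ∃ m, a m ≠ 0) :
    ∃ c : ℝ, 0 < c ∧ Tendsto (fun θ : ℝ => (∑' n : ℕ, (a n : ℂ) *
        (1 - Complex.exp ((θ * n : ℝ) * Complex.I))) / (√θ : ℂ)) (𝓝[>] 0)
      (𝓝 (c * (1 - Complex.I))) := by
  have := hl.neZero
  obtain ⟨ca, hca, hcapos⟩ := ha.exists_asympPeriodic_sum_pos hne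
  have hb := hl.hasPeriodicLimit_realLaplace_passMass hp (le_refl 0)
  obtain ⟨cb, hcb, hcbpos⟩ := hb.exists_asympPeriodic_sum_pos (by
    by_contra! h0
    have := hp.tsum_passMass (le_refl 0)
    simp [h0] at this)
  refine ⟨(∑ r, ca r) / (∑ r, cb r) * (meanPassage p 0 / √(secondMoment p)),
    mul_pos (div_pos hcapos hcbpos) (div_pos (hp.meanPassage_pos (le_refl 0))
      (Real.sqrt_pos.2 hp.secondMoment_pos)), ?_⟩
  rw [Complex.ofReal_mul, mul_assoc]
  exact hca.tendsto_oscillation hcb hcbpos.ne' (hp.tendsto_oscillation_passMass (le_refl 0))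

end Lattice

/-! ### Asymptotics of the jump and inter-half-excursion times. -/

section Times

variable {Ω : Type*} [mΩ : MeasurableSpace Ω] {P : Measure Ω}
  {𝓕 : ℕ → MeasurableSpace Ω} {X : ℕ → Ω → ℝ} {p : AddMonoidAlgebra ℝ ℝ} {h g x₁ : ℝ} {d : ℕ}

lemma IsStepSequence.measurable_jumpTime (hX : IsStepSequence P 𝓕 X p) (y l : ℝ) :
    Measurable fun ω => jumpTime y l (fun n => X n ω) := by
  have hS : ∀ n, Measurable fun ω => walkFrom (-y) (fun n => X n ω) n := fun n => by
    simp only [walkFrom_eq_shiftSum]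
    exact ((measurable_shiftSum hX 0 n).mono (hX.le _) le_rfl).const_add _
  refine measurable_of_measurableSet_eq_natCast fun n => ?_
  simp only [jumpTime, sInf_natCast_eq_iff]
  have hQ : ∀ n : ℕ, MeasurableSet {ω | walkFrom (-y) (fun n => X n ω) n = l ∧
      ∀ t, 1 ≤ t → t < n → walkFrom (-y) (fun n => X n ω) t ≤ 0} := fun n => by
    have h1 : MeasurableSet {ω | ∀ t, 1 ≤ t → t < n → walkFrom (-y) (fun n => X n ω) t ≤ 0} := by
      simp only [Set.ofPred_forall]
      exact MeasurableSet.iInter fun t => MeasurableSet.iInter fun _ =>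
        MeasurableSet.iInter fun _ => hS t measurableSet_Iic
    exact (hS n (measurableSet_singleton l)).inter h1
  have h2 : MeasurableSet {ω | ∀ k < n, ¬ (walkFrom (-y) (fun n => X n ω) k = l ∧
      ∀ t, 1 ≤ t → t < k → walkFrom (-y) (fun n => X n ω) t ≤ 0)} := by
    simp only [Set.ofPred_forall]
    exact MeasurableSet.iInter fun k => MeasurableSet.iInter fun _ => (hQ k).compl
  exact (hQ n).inter h2

variable [IsProbabilityMeasure P]

/-- The times at which a walk started at `-y` enters the positive half-line at `l`. -/
lemma IsStepSequence.jumpTime_asymptotics (hX : IsStepSequence P 𝓕 X p) (hp : IsStepMass p)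
    (hl : IsLatticeMass p h g x₁ d) {y l : ℝ} (hy : 0 < y) (hlpos : 0 < l)
    (h0 : P {ω | jumpTime y l (fun n => X n ω) ≠ ⊤} ≠ 0) :
    (∃ r : ℕ, r < d ∧
      (∀ n : ℕ, ¬ n ≡ r [MOD d] → P {ω | jumpTime y l (fun n => X n ω) = (n : ℕ∞)} = 0) ∧
      ∃ C : ℝ, 0 < C ∧ HasMassLimit P (fun ω => jumpTime y l (fun n => X n ω)) d r C) ∧
    ∃ c : ℝ, 0 < c ∧ IsLevyHalfType P (fun ω => jumpTime y l (fun n => X n ω)) c := by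
  have := hl.neZero
  have hmass := hX.measureReal_jumpTime hy hlpos
  have hT := hX.measurable_jumpTime y l
  have hper := hl.hasPeriodicLimit_passMass hp hy.le (lt_add_of_pos_right y hlpos)
  have hA : 0 < P.real {ω | jumpTime y l (fun n => X n ω) ≠ ⊤} :=
    lt_of_le_of_ne measureReal_nonneg (Ne.symm (by
      rw [measureReal_def, ENNReal.toReal_ne_zero]; exact ⟨h0, measure_ne_top _ _⟩))
  have hex : ∃ m, (passMass p y m).coeff (y + l) ≠ 0 := by
    by_contra! hall
    have hs := hasSum_measureReal_finite (P := P) hT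
    simp only [hmass, hall] at hs
    exact hA.ne' (hs.unique hasSum_zero)
  constructor
  · obtain ⟨m, hm⟩ := hex
    obtain ⟨c, hc, hpos⟩ := hper.exists_limit
    obtain ⟨r, hr⟩ := hpos ⟨m, hm⟩
    have hzero : ∀ n : ℕ, ¬ n ≡ m [MOD d] → (passMass p y n).coeff (y + l) = 0 := fun n hn => by
      by_contra hne
      exact hn (hl.modEq_of_coeff_ne_zero hm hne)
    -- All masses outside the class of `m` vanish, so a positive limit can occur only in that class.
    have hrm : r = (m : ZMod d) := by
      by_contra hne
      have h1 := hc.tendsto_class r.val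
      rw [ZMod.natCast_zmod_val] at h1
      refine hr.ne' (tendsto_nhds_unique h1 (tendsto_const_nhds.congr fun k => ?_))
      rw [hzero, mul_zero]
      rw [← ZMod.natCast_eq_natCast_iff]
      simpa using hne
    refine ⟨m % d, Nat.mod_lt _ (Nat.pos_of_neZero d), fun n hn => ?_, c r, hr, ?_⟩
    · have h1 := hmass n
      rw [hzero n fun h' => hn (h'.trans (Nat.mod_modEq m d).symm),
        measureReal_eq_zero_iff] at h1
      exact h1
    · have h1 := hc.tendsto_class (m % d)
      rw [ZMod.natCast_mod, ← hrm] at h1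
      refine h1.congr fun k => ?_
      rw [hmass]
  · obtain ⟨c, hc, hlim⟩ := hl.exists_tendsto_oscillation hp hper hex
    simp only [← hmass] at hlim
    exact ⟨_, mul_pos (inv_pos.2 hA) hc, isLevyHalfType_of_tendsto hT h0 hlim⟩

lemma IsStepSequence.measureReal_interTime_ne_top (hX : IsStepSequence P 𝓕 X p)
    (hp : IsStepMass p) (i : ℕ) :
    P.real {ω | interTime (walkFrom 0 fun n => X n ω) i ≠ ⊤} = 1 := by
  have h2 : {ω | interTime (walkFrom 0 fun n => X n ω) i ≠ ⊤} ∈ ae P := by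
    filter_upwards [hX.ae_crossingTime_ne_top hp i, hX.ae_crossingTime_ne_top hp (i + 1)]
      with ω h3 h4
    obtain ⟨m, hm⟩ := ENat.ne_top_iff_exists.1 h3
    rwa [Ne, interTime_eq_top_iff hm.symm]
  rw [measureReal_congr (eventuallyEq_univ.2 h2), probReal_univ]

lemma IsStepSequence.interTime_asymptotics (hX : IsStepSequence P 𝓕 X p) (hp : IsStepMass p)
    (hl : IsLatticeMass p h g x₁ d) (i : ℕ) :
    ∃ C : ℕ → ℝ, (∀ r < d, 0 ≤ C r) ∧ (∃ r < d, 0 < C r) ∧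
      ∀ r < d, HasMassLimit P (fun ω => interTime (walkFrom 0 fun n => X n ω) i) d r (C r) := by
  have := hl.neZero
  obtain ⟨B, hB⟩ := exists_abs_le_of_support p
  -- Landing points are multiples of `h` bounded by the largest step, so the mixture is finite and
  -- the closure properties of periodic limits apply.
  set D : Finset ℝ := (Finset.Icc ⌈-B / h⌉ ⌊B / h⌋).image fun k : ℤ => (k : ℝ) * h
  have hD : ∀ᵐ ω ∂P, crossingValue (walkFrom 0 fun n => X n ω) i ∈ (D : Set ℝ) := by
    filter_upwards [hX.ae_abs_crossingValue_le hp hB i, ae_all_iff.2 hX.mem_support] with ω h1 h2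
    have h3 : crossingValue (walkFrom 0 fun n => X n ω) i ∈ AddSubgroup.zmultiples h := by
      rw [crossingValue, walkFrom, zero_add]
      exact AddSubgroup.sum_mem _ fun k _ => hl.mem_zmultiples _ (h2 k)
    obtain ⟨k, hk⟩ := AddSubgroup.mem_zmultiples_iff.1 h3
    rw [zsmul_eq_mul] at hk
    rw [← hk, abs_le] at h1
    simp only [D, Finset.coe_image, Set.mem_image, Finset.coe_Icc, Set.mem_Icc]
    refine ⟨k, ⟨Int.ceil_le.2 ?_, Int.le_floor.2 ?_⟩, hk⟩
    · rw [div_le_iff₀ hl.pos]; exact h1.1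
    · rw [le_div_iff₀ hl.pos]; exact h1.2
  set w : ℝ → ℝ := fun x => P.real {ω | crossingValue (walkFrom 0 fun n => X n ω) i = x}
  have hmass : ∀ n : ℕ, P.real {ω | interTime (walkFrom 0 fun n => X n ω) i = n} =
      ∑ x ∈ D, w x * crossMass p x n := fun n => by
    have h1 := hX.hasSum_interTime hp D.countable_toSet hD n
    rw [← h1.tsum_eq]
    exact Finset.tsum_subtype D fun x => w x * crossMass p x n
  have hper : HasPeriodicLimit d fun n => ∑ x ∈ D, w x * crossMass p x n :=
    HasPeriodicLimit.sum fun x _ => (hl.hasPeriodicLimit_crossMass hp x).const_mul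
      measureReal_nonneg
  obtain ⟨c, hc, hpos⟩ := hper.exists_limit
  have hex : ∃ m, ∑ x ∈ D, w x * crossMass p x m ≠ 0 := by
    by_contra! hall
    have hs := hasSum_measureReal_finite (P := P) (hX.measurable_interTime i)
    simp only [hmass, hall] at hs
    exact one_ne_zero ((hX.measureReal_interTime_ne_top hp i).symm.trans (hs.unique hasSum_zero))
  obtain ⟨r, hr⟩ := hpos hex
  refine ⟨fun r => c r, fun r _ => hc.nonneg hper.nonneg _,
    ⟨r.val, ZMod.val_lt r, by simpa using hr⟩, fun r _ => ?_⟩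
  refine (hc.tendsto_class r).congr fun k => ?_
  rw [hmass]

/-- Off the lattice the set of landing points is only known to be countable, but it is bounded; the
uniform bounds on oscillation replace finiteness. -/
lemma IsStepSequence.exists_isLevyHalfType_interTime (hX : IsStepSequence P 𝓕 X p)
    (hp : IsStepMass p) (i : ℕ) :
    ∃ c : ℝ, 0 < c ∧
      IsLevyHalfType P (fun ω => interTime (walkFrom 0 fun n => X n ω) i) c := by
  obtain ⟨B, hB⟩ := exists_abs_le_of_support p
  obtain ⟨D, hD, hDmem⟩ := hX.exists_countable_walkFrom_mem
  have hiD : ∀ᵐ ω ∂P, crossingValue (walkFrom 0 fun n => X n ω) i ∈ D ∩ {x | |x| ≤ B} := by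
    filter_upwards [hDmem, hX.ae_abs_crossingValue_le hp hB i] with ω h1 h2 using ⟨h1 _, h2⟩
  have hD' : (D ∩ {x | |x| ≤ B}).Countable := hD.mono Set.inter_subset_left
  obtain ⟨c, hc, hlim⟩ := hp.exists_tendsto_oscillation_mixture (fun x hx => hx.2)
    (fun x => measureReal_nonneg) (hX.hasSum_crossingValue hD' hiD) (hX.hasSum_interTime hp hD' hiD)
  have hT := hX.measurable_interTime i
  have h1 := hX.measureReal_interTime_ne_top hp i
  have h0 : P {ω | interTime (walkFrom 0 fun n => X n ω) i ≠ ⊤} ≠ 0 := fun h0 => by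
    rw [measureReal_def, h0] at h1
    exact zero_ne_one h1
  refine ⟨_, ?_, isLevyHalfType_of_tendsto hT h0 hlim⟩
  rwa [h1, inv_one, one_mul]

end Times

theorem lemma2p1 {Ω : Type*} [MeasurableSpace Ω] (P : Measure Ω) [IsProbabilityMeasure P]
    (X : ℕ → Ω → ℝ) (hmeas : ∀ n, Measurable (X n)) (hindep : iIndepFun X P)
    (hident : ∀ n, IdentDistrib (X n) (X 0) P P)
    (hfin : ∃ F : Finset ℝ, ∀ᵐ ω ∂P, X 0 ω ∈ F)
    (hmean : ∫ ω, X 0 ω ∂P = 0)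
    (hnondeg : ¬ ∀ᵐ ω ∂P, X 0 ω = 0) :
    -- lattice walks: the times `τ_{-y,l}`, and the local behaviour of the `τ_i`
    ((∃ h : ℝ, 0 < h ∧ ∀ᵐ ω ∂P, ∃ k : ℤ, X 0 ω = k * h) →
      ∃ d : ℕ, 1 ≤ d ∧
        (∀ y l : ℝ, 0 < y → 0 < l →
          P {ω | jumpTime y l (fun n => X n ω) ≠ ⊤} ≠ 0 →
          (∃ r : ℕ, r < d ∧
            (∀ n : ℕ, ¬ n ≡ r [MOD d] →
              P {ω | jumpTime y l (fun n => X n ω) = (n : ℕ∞)} = 0) ∧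
            ∃ C : ℝ, 0 < C ∧ HasMassLimit P (fun ω => jumpTime y l (fun n => X n ω)) d r C) ∧
          ∃ c : ℝ, 0 < c ∧ IsLevyHalfType P (fun ω => jumpTime y l (fun n => X n ω)) c) ∧
        (∀ i : ℕ, ∃ C : ℕ → ℝ, (∀ r < d, 0 ≤ C r) ∧ (∃ r < d, 0 < C r) ∧
          ∀ r < d, HasMassLimit P (fun ω => interTime (walkFrom 0 fun n => X n ω) i) d r (C r))) ∧
    -- every inter-half-excursion time is a.s. finite and of Lévy(1/2) type
    ((∀ᵐ ω ∂P, ∀ i : ℕ, crossingTime (walkFrom 0 fun n => X n ω) i ≠ ⊤) ∧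
      ∀ i : ℕ, ∃ c : ℝ, 0 < c ∧
        IsLevyHalfType P (fun ω => interTime (walkFrom 0 fun n => X n ω) i) c) := by
  obtain ⟨p, hp, hpx, hsupp⟩ := exists_isStepMass (hmeas 0) hfin hmean hnondeg
  have hX := isStepSequence_pastAlgebra hmeas hindep hident hpx hsupp
  refine ⟨?_, ae_all_iff.2 fun i => hX.ae_crossingTime_ne_top hp i,
    fun i => hX.exists_isLevyHalfType_interTime hp i⟩
  rintro ⟨h, hh, hlat⟩
  -- Every point of the support has positive probability, so the almost sure lattice condition holds
  -- at each of them.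
  have hlat' : ∀ x ∈ p.coeff.support, x ∈ AddSubgroup.zmultiples h := fun x hx => by
    by_contra hne
    rw [Finsupp.mem_support_iff, hpx] at hx
    refine hx ?_
    rw [measureReal_eq_zero_iff]
    have : ∀ᵐ ω ∂P, ¬ X 0 ω = x := by
      filter_upwards [hlat] with ω ⟨k, hk⟩ hω
      exact hne (AddSubgroup.mem_zmultiples_iff.2 ⟨k, by rw [zsmul_eq_mul, ← hk, hω]⟩)
    simpa [ae_iff] using this
  obtain ⟨g, x₁, d, hl⟩ := hp.exists_isLatticeMass hh hlat'
  have := hl.neZero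
  exact ⟨d, Nat.pos_of_neZero d, fun y l hy hlpos h0 => hX.jumpTime_asymptotics hp hl hy hlpos h0,
    fun i => hX.interTime_asymptotics hp hl i⟩
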